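/- Consider the class $\mathcal K$ of equations $f(x)u_t=(g(x)e^{nu}u_x)_x+h(x)e^{mu}$ with arbitrary elements $\theta=(f,g,h,n,m)$, where $f,g,h$ are smooth functions on an open interval and $n,m$ are constants with $nfg\neq0$, and its subclass $\mathcal K_{m=n}$ singled out by $m=n$, i.e. $f(x)u_t=(g(x)e^{nu}u_x)_x+h(x)e^{nu}$. A generalized extended equivalence transformation of a class assigns to each tuple $\theta$ of the class, depending smoothly on $\theta$ but possibly in a nonlocal way and one-to-one on arbitrary elements, a local point transformation $(t,x,u)\mapsto(\tilde t,\tilde x,\tilde u)$ (smooth, with nonvanishing Jacobian) and a tuple $\tilde\theta$ of the class such that the point transformation maps the equation with $\theta$ to the equation with $\tilde\theta$. It is called usual if moreover the point transformation does not depend on $\theta$, the values of $\tilde f,\tilde g,\tilde h$ at the new point and of $\tilde n,\tilde m$ are functions of the old point, of $n,m$ and of finitely many derivatives of $f,g,h$ at the old point, and $\theta\mapsto\tilde\theta$ is a bijection of the class over the old $x$-interval onto the class over the new one. All intervals ($t\in A$, $x\in J$, $u\in C$) are nonempty and open. (1) Let $\delta_0,\delta_1,\delta_2,\delta_3$ be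 arbitrary constants with $\delta_0\delta_1\delta_3\ne0$, let $\varphi,\psi$ be arbitrary smooth functions of $x$ on $J$ with $\varphi_x\ne0$, and put $\Psi=e^{-n\psi/\delta_3}$. The transformation $$\tilde t=\delta_1t+\delta_2,\quad \tilde x=\varphi(x),\quad \tilde u=\delta_3u+\psi(x),$$ $$\tilde f=\frac{\delta_0\delta_1}{\varphi_x}\Psi f,\quad \tilde g=\delta_0\varphi_x\Psi^2g,\quad \tilde h=\frac{\delta_0\delta_3}{n\varphi_x}\bigl[nh\Psi+(g\Psi_x)_x\bigr]\Psi,\quad \tilde n=\frac n{\delta_3}$$ (with $\tilde m=\tilde n$) is a usual equivalence transformation of $\mathcal K_{m=n}$. (2) Conversely, every usual equivalence transformation of $\mathcal K_{m=n}$ has this form, with $\delta_1,\delta_2,\delta_3,\varphi,\psi$ not depending on $\theta$; only the constant multiplier $\delta_0$ of the whole equation may take different values for equations that differ in the constant $n$ or in the signs of $f$ and $g$. (3) The generalized extended equivalence group of $\mathcal K_{m=n}$ coincides with the usual one in the following sense: for every generalized extended equivalence transformation and every $\theta$ in $\mathcal K_{m=n}$, its action on the equation with $\theta$ (both on $(t,x,u)$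 and on the arbitrary elements) coincides with the action of a usual equivalence transformation from the family (1). (4) The equivalence group of $\mathcal K_{m=n}$ is a nontrivial conditional equivalence group of $\mathcal K$: there is a usual equivalence transformation of $\mathcal K_{m=n}$ whose action on $(t,x,u)$ is not the restriction to $\mathcal K_{m=n}$ of any generalized extended (in particular, of any usual) equivalence transformation of the whole class $\mathcal K$. -/

import Mathlib

open scoped ContDiff

namespace ExpRD

/-- Arbitrary elements `(f, g, h, n, m)` of the equations
`f(x) u_t = (g(x) e^{n u} u_x)_x + h(x) e^{m u}`.
Only the values of `f, g, h` on the interval under consideration matter. -/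
structure Elems where
  f : ℝ → ℝ
  g : ℝ → ℝ
  h : ℝ → ℝ
  n : ℝ
  m : ℝ

/-- The two tuples of arbitrary elements are equal as data over `J`. -/
def Elems.Agree (J : Set ℝ) (θ θ' : Elems) : Prop :=
  θ.n = θ'.n ∧ θ.m = θ'.m ∧ Set.EqOn θ.f θ'.f J ∧ Set.EqOn θ.g θ'.g J ∧ Set.EqOn θ.h θ'.h J

/-- The function `u(t,x)` satisfies the equation with arbitrary elements `θ` at the point `(t,x)`. -/
def Elems.SolvesAt (θ : Elems) (u : ℝ → ℝ → ℝ) (t x : ℝ) : Prop :=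
  θ.f x * deriv (fun s => u s x) t =
    deriv (fun y => θ.g y * Real.exp (θ.n * u t y) * deriv (fun z => u t z) y) x
      + θ.h x * Real.exp (θ.m * u t x)

/-- The whole class: `f, g, h` smooth on the `x`-interval `J`, and `f g n ≠ 0`. -/
def wholeClass (J : Set ℝ) : Set Elems :=
  {θ | ContDiffOn ℝ ∞ θ.f J ∧ ContDiffOn ℝ ∞ θ.g J ∧ ContDiffOn ℝ ∞ θ.h J ∧
    (∀ x ∈ J, θ.f x ≠ 0 ∧ θ.g x ≠ 0) ∧ θ.n ≠ 0}

/-- The subclass singled out of the whole class by the additional condition `m = n`. -/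
def subclassEq (J : Set ℝ) : Set Elems :=
  {θ | θ ∈ wholeClass J ∧ θ.m = θ.n}

/-- The box of points `(t, x, u)` with `t ∈ A`, `x ∈ J`, `u ∈ C`. -/
def box (A J C : Set ℝ) : Set (ℝ × ℝ × ℝ) := A ×ˢ J ×ˢ C

/-- A (local) point transformation `(t,x,u) ↦ (T,X,U)` on `B`:
smooth with nonvanishing Jacobian. -/
def IsPointTransf (B : Set (ℝ × ℝ × ℝ)) (τ : ℝ × ℝ × ℝ → ℝ × ℝ × ℝ) : Prop :=
  ContDiffOn ℝ ∞ τ B ∧ ∀ q ∈ B, (fderiv ℝ τ q).det ≠ 0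

/-- The set of values of the new independent variable `x̃`. -/
def newInterval (B : Set (ℝ × ℝ × ℝ)) (τ : ℝ × ℝ × ℝ → ℝ × ℝ × ℝ) : Set ℝ :=
  (fun q => (τ q).2.1) '' B

/-- The point transformation `τ` on `B` maps the equation `θ` to the equation `θ'`, i.e. the
prolongation of `τ` to second-order jets identifies the two equations (as submanifolds of the jet
space). Jets are represented by functions: `v` is the transform of `u` near `(t,x)`, which makes
sense when `(t,x) ↦ (T,X)(t,x,u(t,x))` has a nonzero Jacobian there. -/
def MapsEquation (B : Set (ℝ × ℝ × ℝ)) (τ : ℝ × ℝ × ℝ → ℝ × ℝ × ℝ) (θ θ' : Elems) : Prop :=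
  ∀ (u v : ℝ → ℝ → ℝ) (t x : ℝ),
    (t, x, u t x) ∈ B →
    ContDiffAt ℝ ∞ (fun q : ℝ × ℝ => u q.1 q.2) (t, x) →
    (fderiv ℝ (fun q : ℝ × ℝ =>
      ((τ (q.1, q.2, u q.1 q.2)).1, (τ (q.1, q.2, u q.1 q.2)).2.1)) (t, x)).det ≠ 0 →
    ContDiffAt ℝ ∞ (fun q : ℝ × ℝ => v q.1 q.2)
      ((τ (t, x, u t x)).1, (τ (t, x, u t x)).2.1) →
    (∀ᶠ q : ℝ × ℝ in nhds (t, x),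
      v (τ (q.1, q.2, u q.1 q.2)).1 (τ (q.1, q.2, u q.1 q.2)).2.1
        = (τ (q.1, q.2, u q.1 q.2)).2.2) →
    (θ.SolvesAt u t x ↔ θ'.SolvesAt v (τ (t, x, u t x)).1 (τ (t, x, u t x)).2.1)

/-- A (local) transformation of variables and arbitrary elements: to every tuple `θ` of arbitrary
elements it assigns a transformation `tr θ` of `(t,x,u)`, the tuple `img θ` of new arbitrary elements,
and the `x`-interval `domX θ` on which they are considered. (Nonlocal expressions such as
`∫ dx/g + 1` need not be nonzero on the same interval for all `g`.) -/
structure Transf where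
  domX : Elems → Set ℝ
  tr : Elems → ℝ × ℝ × ℝ → ℝ × ℝ × ℝ
  img : Elems → Elems

/-- The domain of `tr θ`, for `t ∈ A` and `u ∈ C`. -/
def Transf.dom (Φ : Transf) (A C : Set ℝ) (θ : Elems) : Set (ℝ × ℝ × ℝ) := box A (Φ.domX θ) C

/-- The `x̃`-interval on which `img θ` is considered. -/
def Transf.newX (Φ : Transf) (A C : Set ℝ) (θ : Elems) : Set ℝ :=
  newInterval (Φ.dom A C θ) (Φ.tr θ)

/-- A smooth one-parameter family of arbitrary elements over `J`. -/
def SmoothFamily (J : Set ℝ) (θ : ℝ → Elems) : Prop :=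
  ContDiffOn ℝ ∞ (fun z : ℝ × ℝ => (θ z.1).f z.2) (Set.univ ×ˢ J) ∧
  ContDiffOn ℝ ∞ (fun z : ℝ × ℝ => (θ z.1).g z.2) (Set.univ ×ˢ J) ∧
  ContDiffOn ℝ ∞ (fun z : ℝ × ℝ => (θ z.1).h z.2) (Set.univ ×ˢ J) ∧
  ContDiff ℝ ∞ (fun ε => (θ ε).n) ∧ ContDiff ℝ ∞ (fun ε => (θ ε).m)

/-- `Φ` depends smoothly on the arbitrary elements: it takes smooth one-parameter families in the
class `K` to smooth ones. -/
def DependsSmoothly (K : Set ℝ → Set Elems) (A J C : Set ℝ) (Φ : Transf) : Prop :=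
  ∀ θ : ℝ → Elems, (∀ ε, θ ε ∈ K J) → SmoothFamily J θ →
    IsOpen {z : ℝ × ℝ × ℝ × ℝ | z.2 ∈ Φ.dom A C (θ z.1)} ∧
    ContDiffOn ℝ ∞ (fun z : ℝ × ℝ × ℝ × ℝ => Φ.tr (θ z.1) z.2)
      {z | z.2 ∈ Φ.dom A C (θ z.1)} ∧
    ContDiffOn ℝ ∞ (fun z : ℝ × ℝ × ℝ × ℝ => (Φ.img (θ z.1)).f (Φ.tr (θ z.1) z.2).2.1)
      {z | z.2 ∈ Φ.dom A C (θ z.1)} ∧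
    ContDiffOn ℝ ∞ (fun z : ℝ × ℝ × ℝ × ℝ => (Φ.img (θ z.1)).g (Φ.tr (θ z.1) z.2).2.1)
      {z | z.2 ∈ Φ.dom A C (θ z.1)} ∧
    ContDiffOn ℝ ∞ (fun z : ℝ × ℝ × ℝ × ℝ => (Φ.img (θ z.1)).h (Φ.tr (θ z.1) z.2).2.1)
      {z | z.2 ∈ Φ.dom A C (θ z.1)} ∧
    ContDiff ℝ ∞ (fun ε => (Φ.img (θ ε)).n) ∧ ContDiff ℝ ∞ (fun ε => (Φ.img (θ ε)).m)

/-- (Local) generalized extended equivalence transformation of the class `K` over `t ∈ A`, `x ∈ J`,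
`u ∈ C`: every equation of the class is mapped to an equation of the class by a point
transformation; both this point transformation ("generalized") and the new arbitrary elements
("extended") may depend on the old arbitrary elements in any smooth, possibly nonlocal way, and the
action on arbitrary elements is one-to-one. -/
structure IsGenExtEquiv (K : Set ℝ → Set Elems) (A J C : Set ℝ) (Φ : Transf) : Prop where
  /-- `domX θ` is a nonempty open subinterval of `J` -/
  interval : ∀ θ ∈ K J, IsOpen (Φ.domX θ) ∧ (Φ.domX θ).OrdConnected ∧ (Φ.domX θ).Nonempty ∧
    Φ.domX θ ⊆ J
  /-- the variables undergo a point transformation -/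
  point : ∀ θ ∈ K J, IsPointTransf (Φ.dom A C θ) (Φ.tr θ)
  /-- the class is preserved -/
  mem : ∀ θ ∈ K J, Φ.img θ ∈ K (Φ.newX A C θ)
  /-- equations are mapped to equations -/
  maps : ∀ θ ∈ K J, MapsEquation (Φ.dom A C θ) (Φ.tr θ) θ (Φ.img θ)
  /-- `Φ` depends only on the restriction of the arbitrary elements to `J` -/
  congr : ∀ θ₁ ∈ K J, ∀ θ₂ ∈ K J, θ₁.Agree J θ₂ →
    Φ.domX θ₁ = Φ.domX θ₂ ∧ Set.EqOn (Φ.tr θ₁) (Φ.tr θ₂) (Φ.dom A C θ₁) ∧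
    (Φ.img θ₁).Agree (Φ.newX A C θ₁) (Φ.img θ₂)
  /-- the action on arbitrary elements is one-to-one -/
  inj : ∀ θ₁ ∈ K J, ∀ θ₂ ∈ K J, Φ.newX A C θ₁ = Φ.newX A C θ₂ →
    (Φ.img θ₁).Agree (Φ.newX A C θ₁) (Φ.img θ₂) →
    Φ.domX θ₁ = Φ.domX θ₂ ∧ θ₁.Agree (Φ.domX θ₁) θ₂
  /-- dependence on the arbitrary elements is smooth -/
  smooth : DependsSmoothly K A J C Φ

/-- The two functions have the same derivatives up to order `k` at `x`. -/
def SameJet (k : ℕ) (a b : ℝ → ℝ) (x : ℝ) : Prop :=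
  ∀ i ≤ k, iteratedDeriv i a x = iteratedDeriv i b x

/-- Usual equivalence transformation of the class `K` on the box `A × J × C`: the transformation of
`(t,x,u)` does not depend on the arbitrary elements, the new arbitrary elements at the new point
are functions of the old point, the constants `n, m` and finitely many derivatives of `f, g, h` at
the old point, and the action on arbitrary elements is a bijection of the class over `J` to the
class over the new interval. -/
structure IsUsualEquiv (K : Set ℝ → Set Elems) (A J C : Set ℝ) (Φ : Transf) : Prop
    extends IsGenExtEquiv K A J C Φ where
  full : ∀ θ ∈ K J, Φ.domX θ = J
  indep : ∀ θ₁ ∈ K J, ∀ θ₂ ∈ K J, Set.EqOn (Φ.tr θ₁) (Φ.tr θ₂) (box A J C)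
  loc : ∃ k : ℕ, ∀ θ₁ ∈ K J, ∀ θ₂ ∈ K J, ∀ q ∈ box A J C,
    θ₁.n = θ₂.n → θ₁.m = θ₂.m →
    SameJet k θ₁.f θ₂.f q.2.1 → SameJet k θ₁.g θ₂.g q.2.1 → SameJet k θ₁.h θ₂.h q.2.1 →
    (Φ.img θ₁).f (Φ.tr θ₁ q).2.1 = (Φ.img θ₂).f (Φ.tr θ₂ q).2.1 ∧
    (Φ.img θ₁).g (Φ.tr θ₁ q).2.1 = (Φ.img θ₂).g (Φ.tr θ₂ q).2.1 ∧
    (Φ.img θ₁).h (Φ.tr θ₁ q).2.1 = (Φ.img θ₂).h (Φ.tr θ₂ q).2.1 ∧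
    (Φ.img θ₁).n = (Φ.img θ₂).n ∧ (Φ.img θ₁).m = (Φ.img θ₂).m
  /-- the action on arbitrary elements is onto -/
  surj : ∀ θ ∈ K J, ∀ θ' ∈ K (Φ.newX A C θ), ∃ θ₀ ∈ K J, (Φ.img θ₀).Agree (Φ.newX A C θ) θ'

/-- Parameters of the explicit family of transformations. -/
structure Param where
  δ₀ : ℝ
  δ₁ : ℝ
  δ₂ : ℝ
  δ₃ : ℝ
  φ : ℝ → ℝ
  ψ : ℝ → ℝ

/-- `δ₀ δ₁ δ₃ ≠ 0`, and `φ`, `ψ` are smooth on `J` with `φ_x ≠ 0`. -/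
def Param.Valid (p : Param) (J : Set ℝ) : Prop :=
  p.δ₀ * p.δ₁ * p.δ₃ ≠ 0 ∧ ContDiffOn ℝ ∞ p.φ J ∧ ContDiffOn ℝ ∞ p.ψ J ∧
    ∀ x ∈ J, deriv p.φ x ≠ 0

/-- `Ψ = e^{- n ψ / δ₃}`. -/
noncomputable def Param.bigPsi (p : Param) (n : ℝ) (x : ℝ) : ℝ :=
  Real.exp (-(n * p.ψ x / p.δ₃))

/-- On `A × J × C`, the transformation `Φ` acts on the equation `θ` of the subclass `m = n` by the
explicit formulas with parameters `p`. -/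
def Param.Acts (p : Param) (A J C : Set ℝ) (Φ : Transf) (θ : Elems) : Prop :=
  (∀ t ∈ A, ∀ x ∈ J, ∀ u ∈ C, Φ.tr θ (t, x, u) = (p.δ₁ * t + p.δ₂, p.φ x, p.δ₃ * u + p.ψ x)) ∧
  (∀ x ∈ J,
    (Φ.img θ).f (p.φ x) = p.δ₀ * p.δ₁ / deriv p.φ x * p.bigPsi θ.n x * θ.f x ∧
    (Φ.img θ).g (p.φ x) = p.δ₀ * deriv p.φ x * p.bigPsi θ.n x ^ 2 * θ.g x ∧
    (Φ.img θ).h (p.φ x) = p.δ₀ * p.δ₃ / (θ.n * deriv p.φ x) *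
      (θ.n * θ.h x * p.bigPsi θ.n x
        + deriv (fun y => θ.g y * deriv (p.bigPsi θ.n) y) x) * p.bigPsi θ.n x) ∧
  (Φ.img θ).n = θ.n / p.δ₃ ∧ (Φ.img θ).m = (Φ.img θ).n

/-- The equivalence group of the subclass `K` is a nontrivial conditional equivalence group of the
class `K₀`: some usual equivalence transformation of `K` is not obtained by restriction to `K` from
any equivalence transformation of `K₀`, even a generalized extended one, even on smaller intervals. -/
def NontrivialConditional (K K₀ : Set ℝ → Set Elems) (A J C : Set ℝ) : Prop :=
  (∀ I, K I ⊆ K₀ I) ∧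
  ∃ Φ, IsUsualEquiv K A J C Φ ∧
    ¬ ∃ Φ₀, IsGenExtEquiv K₀ A J C Φ₀ ∧
      ∀ θ ∈ K J, Set.EqOn (Φ₀.tr θ) (Φ.tr θ) (Φ₀.dom A C θ)

end ExpRD

namespace ExpRD

open Filter Topology

/-! A point transformation between two equations of the class is tested on quadratic functions `u`,
whose jets at a point have arbitrary `u`, `u_t`, `u_x`, `u_xx` and `u_tt`. The derivative `u_tt`
occurs in neither equation, which forces `T_x = T_u = 0` (`time_partial_zero`). Comparing the
coefficients of `u_t` and `u_xx` then gives `X_u = 0` and a relation between `f, g` and the new `f,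
g` whose dependence on `u` is exponential, so `U` is affine in `u` with slope `n / ñ`
(`leading_coefficients`, `normal_form`). What remains is one identity in `u` and `q = u_x`
(`balance`).

If `m = n` in both equations, every term of this identity carries `e^{nu}` except those with `X_t`
and `ψ_t`. Hence `X` and `ψ` do not depend on `t` and `T` is affine. The part linear in `q`
integrates to the formula for the new `g`, with `δ₀` as the constant of integration, and the part
free of `q` gives the new `h` (`subclass_form`, `subclass_param`). The argument treats one equation
at a time, so it covers generalized extended transformations. For a usual one, independence of the
point transformation from `θ` fixes every parameter but `δ₀`, and locality restricts `δ₀` by gluing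
two tuples with a cutoff (`exists_glue`). The converse is a direct computation (`Param.Valid.maps`,
`Param.Valid.isUsualEquiv`).

For nontriviality, take `u_t = (e^u u_x)_x + e^{mu}` with `m > 1`. Independence of exponentials in
`balance` makes `e^{-ñψ}` affine in `x` (`powerElems_affine`). Smooth dependence on `θ` carries this
to the limit `m → 1`, but `ũ = u + x` is admissible there and `e^{-x}` is not affine. -/

/-! ### Determinants, chain rules and the transform of a function. -/

lemma det_pair (L : ℝ × ℝ →L[ℝ] ℝ × ℝ) :
    L.det = (L (1, 0)).1 * (L (0, 1)).2 - (L (0, 1)).1 * (L (1, 0)).2 := by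
  unfold ContinuousLinearMap.det
  rw [← LinearMap.det_toMatrix (Module.Basis.finTwoProd ℝ), Matrix.det_fin_two]
  simp [LinearMap.toMatrix_apply]

/-- The standard basis of `ℝ × ℝ × ℝ`. -/
noncomputable def tripleBasis : Module.Basis (Fin 3) ℝ (ℝ × ℝ × ℝ) :=
  Module.Basis.ofEquivFun
    { toFun := fun q => ![q.1, q.2.1, q.2.2]
      map_add' := fun a b => by ext i; fin_cases i <;> rfl
      map_smul' := fun c a => by ext i; fin_cases i <;> rfl
      invFun := fun v => (v 0, v 1, v 2)
      left_inv := fun _ => rfl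
      right_inv := fun v => by ext i; fin_cases i <;> rfl }

lemma tripleBasis_repr (q : ℝ × ℝ × ℝ) (i : Fin 3) :
    tripleBasis.repr q i = ![q.1, q.2.1, q.2.2] i := rfl

lemma tripleBasis_zero : tripleBasis 0 = (1, 0, 0) := by
  refine tripleBasis.repr.injective (Finsupp.ext fun i => ?_)
  rw [Module.Basis.repr_self, tripleBasis_repr]
  fin_cases i <;> simp

lemma tripleBasis_one : tripleBasis 1 = (0, 1, 0) := by
  refine tripleBasis.repr.injective (Finsupp.ext fun i => ?_)
  rw [Module.Basis.repr_self, tripleBasis_repr]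
  fin_cases i <;> simp

lemma tripleBasis_two : tripleBasis 2 = (0, 0, 1) := by
  refine tripleBasis.repr.injective (Finsupp.ext fun i => ?_)
  rw [Module.Basis.repr_self, tripleBasis_repr]
  fin_cases i <;> simp

lemma det_triple (L : ℝ × ℝ × ℝ →L[ℝ] ℝ × ℝ × ℝ) :
    L.det =
      (L (1, 0, 0)).1 * ((L (0, 1, 0)).2.1 * (L (0, 0, 1)).2.2
        - (L (0, 0, 1)).2.1 * (L (0, 1, 0)).2.2)
      - (L (0, 1, 0)).1 * ((L (1, 0, 0)).2.1 * (L (0, 0, 1)).2.2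
        - (L (0, 0, 1)).2.1 * (L (1, 0, 0)).2.2)
      + (L (0, 0, 1)).1 * ((L (1, 0, 0)).2.1 * (L (0, 1, 0)).2.2
        - (L (0, 1, 0)).2.1 * (L (1, 0, 0)).2.2) := by
  unfold ContinuousLinearMap.det
  rw [← LinearMap.det_toMatrix tripleBasis, Matrix.det_fin_three]
  simp only [LinearMap.toMatrix_apply, tripleBasis_repr, tripleBasis_zero, tripleBasis_one,
    tripleBasis_two, ContinuousLinearMap.coe_coe, Matrix.cons_val_zero, Matrix.cons_val_one,
    Matrix.cons_val]
  ring

lemma contDiffAt_deriv {f : ℝ → ℝ} {x : ℝ} {m n : ℕ∞ω} (hf : ContDiffAt ℝ n f x)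
    (h : m + 1 ≤ n) : ContDiffAt ℝ m (deriv f) x :=
  (hf.fderiv_right h).clm_apply contDiffAt_const

/-- Second-order chain rule on the line, for `W ∘ y = z`. -/
lemma chain_line {W y z : ℝ → ℝ} {x : ℝ} (hW : ContDiffAt ℝ 2 W (y x)) (hy : ContDiffAt ℝ 2 y x)
    (h : ∀ᶠ s in 𝓝 x, W (y s) = z s) :
    deriv W (y x) * deriv y x = deriv z x ∧
    deriv (deriv W) (y x) * deriv y x ^ 2 + deriv W (y x) * deriv (deriv y) x
      = deriv (deriv z) x := by
  have h1 : ∀ᶠ s in 𝓝 x, deriv W (y s) * deriv y s = deriv z s := by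
    have hW' : ∀ᶠ s in 𝓝 x, ContDiffAt ℝ 2 W (y s) :=
      hy.continuousAt.eventually (hW.eventually (by simp))
    filter_upwards [h.eventually_nhds, hW', hy.eventually (by simp)] with s hs hWs hys
    have e : (fun s => W (y s)) =ᶠ[𝓝 s] z := hs
    rw [← e.deriv_eq]
    exact ((hWs.differentiableAt (by simp)).hasDerivAt.comp s
      (hys.differentiableAt (by simp)).hasDerivAt).deriv.symm
  refine ⟨h1.self_of_nhds, ?_⟩
  have e : (fun s => deriv W (y s) * deriv y s) =ᶠ[𝓝 x] deriv z := h1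
  rw [← e.deriv_eq]
  have dW : DifferentiableAt ℝ (deriv W) (y x) :=
    (contDiffAt_deriv (m := 1) hW (by norm_num)).differentiableAt (by simp)
  have dy' : DifferentiableAt ℝ (deriv y) x :=
    (contDiffAt_deriv (m := 1) hy (by norm_num)).differentiableAt (by simp)
  have dy : DifferentiableAt ℝ y x := hy.differentiableAt (by simp)
  have := (dW.hasDerivAt.comp x dy.hasDerivAt).mul dy'.hasDerivAt
  refine Eq.symm (this.deriv.trans ?_)
  simp only [Function.comp]
  ring

/-- Carrying out the outer differentiation makes the equation an algebraic relation in the 2-jet of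
`u`, the form used in all jet computations. -/
lemma Elems.solvesAt_iff {θ : Elems} {u : ℝ → ℝ → ℝ} {t x : ℝ} (hg : DifferentiableAt ℝ θ.g x)
    (hu : ContDiffAt ℝ 2 (u t) x) :
    θ.SolvesAt u t x ↔ θ.f x * deriv (fun s => u s x) t =
      Real.exp (θ.n * u t x) * (deriv θ.g x * deriv (u t) x + θ.n * θ.g x * deriv (u t) x ^ 2
        + θ.g x * deriv (deriv (u t)) x) + θ.h x * Real.exp (θ.m * u t x) := by
  have du : DifferentiableAt ℝ (u t) x := hu.differentiableAt (by simp)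
  have ddu : DifferentiableAt ℝ (deriv (u t)) x :=
    (contDiffAt_deriv (m := 1) hu (by norm_num)).differentiableAt (by simp)
  have : deriv (fun y => θ.g y * Real.exp (θ.n * u t y) * deriv (fun z => u t z) y) x =
      Real.exp (θ.n * u t x) * (deriv θ.g x * deriv (u t) x + θ.n * θ.g x * deriv (u t) x ^ 2
        + θ.g x * deriv (deriv (u t)) x) := by
    refine ((hg.hasDerivAt.mul (du.hasDerivAt.const_mul θ.n).exp).mul ddu.hasDerivAt).deriv.trans ?_
    simp only [Pi.mul_apply]
    ring
  unfold Elems.SolvesAt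
  rw [this]

/-- `MapsEquation` speaks of pairs `u`, `v`, so a `v` must be produced. The inverse function theorem
inverts `(t, x) ↦ (T, X)(t, x, u(t, x))` near the point, and `v` is the new dependent variable
composed with that inverse. -/
lemma exists_transform {B : Set (ℝ × ℝ × ℝ)} {τ : ℝ × ℝ × ℝ → ℝ × ℝ × ℝ} {θ θ' : Elems}
    (hm : MapsEquation B τ θ θ') {u : ℝ → ℝ → ℝ} {t x : ℝ} (hB : (t, x, u t x) ∈ B)
    (hτ : ContDiffAt ℝ ∞ τ (t, x, u t x))
    (hu : ContDiffAt ℝ ∞ (fun q : ℝ × ℝ => u q.1 q.2) (t, x))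
    (hd : (fderiv ℝ (fun q : ℝ × ℝ =>
      ((τ (q.1, q.2, u q.1 q.2)).1, (τ (q.1, q.2, u q.1 q.2)).2.1)) (t, x)).det ≠ 0) :
    ∃ v : ℝ → ℝ → ℝ,
      ContDiffAt ℝ ∞ (fun q : ℝ × ℝ => v q.1 q.2)
        ((τ (t, x, u t x)).1, (τ (t, x, u t x)).2.1) ∧
      (∀ᶠ q : ℝ × ℝ in 𝓝 (t, x),
        v (τ (q.1, q.2, u q.1 q.2)).1 (τ (q.1, q.2, u q.1 q.2)).2.1
          = (τ (q.1, q.2, u q.1 q.2)).2.2) ∧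
      (θ.SolvesAt u t x ↔ θ'.SolvesAt v (τ (t, x, u t x)).1 (τ (t, x, u t x)).2.1) := by
  have hγ : ContDiffAt ℝ ∞ (fun q : ℝ × ℝ => τ (q.1, q.2, u q.1 q.2)) (t, x) :=
    ContDiffAt.comp (t, x) (f := fun q : ℝ × ℝ => (q.1, q.2, u q.1 q.2)) hτ
      (contDiffAt_fst.prodMk (contDiffAt_snd.prodMk hu))
  set M : ℝ × ℝ → ℝ × ℝ := fun q : ℝ × ℝ =>
      ((τ (q.1, q.2, u q.1 q.2)).1, (τ (q.1, q.2, u q.1 q.2)).2.1) with hM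
  have hMs : ContDiffAt ℝ ∞ M (t, x) := hγ.fst.prodMk hγ.snd.fst
  let e := (fderiv ℝ M (t, x)).toContinuousLinearEquivOfDetNeZero hd
  have he : HasFDerivAt M (e : ℝ × ℝ →L[ℝ] ℝ × ℝ) (t, x) := by
    have := (hMs.differentiableAt (by simp)).hasFDerivAt
    simpa [e] using this
  have hN := hMs.to_localInverse he (by simp)
  set N := hMs.localInverse he (by simp) with hNdef
  have hl : ∀ᶠ q in 𝓝 (t, x), N (M q) = q :=
    (hMs.hasStrictFDerivAt' he (by simp)).eventually_left_inverse
  have hN0 : N (M (t, x)) = (t, x) := hl.self_of_nhds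
  have hv : ContDiffAt ℝ ∞ (fun q : ℝ × ℝ =>
      (τ ((N q).1, (N q).2, u (N q).1 (N q).2)).2.2) (M (t, x)) := by
    have : ContDiffAt ℝ ∞ (fun q : ℝ × ℝ => (τ (q.1, q.2, u q.1 q.2)).2.2) (N (M (t, x))) := by
      rw [hN0]; exact hγ.snd.snd
    exact this.comp (M (t, x)) hN
  let v : ℝ → ℝ → ℝ := fun a b => (τ ((N (a, b)).1, (N (a, b)).2, u (N (a, b)).1 (N (a, b)).2)).2.2
  have hev : ∀ᶠ q : ℝ × ℝ in 𝓝 (t, x),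
      v
        (τ (q.1, q.2, u q.1 q.2)).1 (τ (q.1, q.2, u q.1 q.2)).2.1
          = (τ (q.1, q.2, u q.1 q.2)).2.2 := by
    filter_upwards [hl] with q hq
    have : N ((τ (q.1, q.2, u q.1 q.2)).1, (τ (q.1, q.2, u q.1 q.2)).2.1) = q := hq
    simp only [v, this]
  exact ⟨v, hv, hev, hm u v t x hB hu hd hv hev⟩

/-- Bridge between the one-variable derivatives in `SolvesAt` and the Fréchet derivatives to which
the chain rule applies. -/
lemma line_derivs {v : ℝ → ℝ → ℝ} {t x : ℝ}
    (hv : ContDiffAt ℝ ∞ (fun q : ℝ × ℝ => v q.1 q.2) (t, x)) :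
    deriv (fun s => v s x) t = fderiv ℝ (fun q : ℝ × ℝ => v q.1 q.2) (t, x) (1, 0) ∧
    deriv (v t) x = fderiv ℝ (fun q : ℝ × ℝ => v q.1 q.2) (t, x) (0, 1) ∧
    deriv (deriv (v t)) x =
      fderiv ℝ (fun y => fderiv ℝ (fun q : ℝ × ℝ => v q.1 q.2) y (0, 1)) (t, x) (0, 1) ∧
    ContDiffAt ℝ ∞ (v t) x ∧ ContDiffAt ℝ ∞ (fun s => v s x) t := by
  have hx : ∀ y, HasDerivAt (fun y : ℝ => (t, y)) ((0 : ℝ), (1 : ℝ)) y := fun y =>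
    (hasDerivAt_const y t).prodMk (hasDerivAt_id y)
  have ht : HasDerivAt (fun s : ℝ => (s, x)) ((1 : ℝ), (0 : ℝ)) t :=
    (hasDerivAt_id t).prodMk (hasDerivAt_const t x)
  have hv2 : ContDiffAt ℝ 2 (fun q : ℝ × ℝ => v q.1 q.2) (t, x) := hv.of_le (by norm_cast)
  have h1 : ∀ᶠ y in 𝓝 x, deriv (v t) y = fderiv ℝ (fun q : ℝ × ℝ => v q.1 q.2) (t, y) (0, 1) := by
    filter_upwards [(hx x).continuousAt.eventually (hv2.eventually (by simp))] with y hy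
    exact ((hy.differentiableAt (by simp)).hasFDerivAt.comp_hasDerivAt y (hx y)).deriv
  refine ⟨?_, h1.self_of_nhds, ?_, ?_, ?_⟩
  · exact ((hv.differentiableAt (by simp)).hasFDerivAt.comp_hasDerivAt t ht).deriv
  · rw [EventuallyEq.deriv_eq h1]
    have : DifferentiableAt ℝ (fun y => fderiv ℝ (fun q : ℝ × ℝ => v q.1 q.2) y (0, 1)) (t, x) :=
      ((hv2.fderiv_right (m := 1) (by norm_num)).clm_apply contDiffAt_const).differentiableAt
        (by simp)
    exact (this.hasFDerivAt.comp_hasDerivAt x (hx x)).deriv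
  · exact ContDiffAt.comp x (f := fun y : ℝ => (t, y)) hv (contDiffAt_const.prodMk contDiffAt_id)
  · exact ContDiffAt.comp t (f := fun y : ℝ => (y, x)) hv (contDiffAt_id.prodMk contDiffAt_const)

/-! ### First and second derivatives of a transformed function. -/

/-- Partial derivatives of functions of `(t, x, u)`. -/
noncomputable def dT (K : ℝ × ℝ × ℝ → ℝ) (Q : ℝ × ℝ × ℝ) : ℝ := fderiv ℝ K Q (1, 0, 0)
/-- Partial derivative in `x`. -/
noncomputable def dX (K : ℝ × ℝ × ℝ → ℝ) (Q : ℝ × ℝ × ℝ) : ℝ := fderiv ℝ K Q (0, 1, 0)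
/-- Partial derivative in `u`. -/
noncomputable def dU (K : ℝ × ℝ × ℝ → ℝ) (Q : ℝ × ℝ × ℝ) : ℝ := fderiv ℝ K Q (0, 0, 1)

lemma fderiv_triple (K : ℝ × ℝ × ℝ → ℝ) (Q : ℝ × ℝ × ℝ) (a b c : ℝ) :
    fderiv ℝ K Q (a, b, c) = a * dT K Q + b * dX K Q + c * dU K Q := by
  have : ((a, b, c) : ℝ × ℝ × ℝ) = a • (1, 0, 0) + b • (0, 1, 0) + c • (0, 0, 1) := by
    ext <;> simp
  rw [this, map_add, map_add, map_smul, map_smul, map_smul]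
  rfl

lemma fderiv_couple (V : ℝ × ℝ → ℝ) (y : ℝ × ℝ) (a b : ℝ) :
    fderiv ℝ V y (a, b) = fderiv ℝ V y (1, 0) * a + fderiv ℝ V y (0, 1) * b := by
  have : ((a, b) : ℝ × ℝ) = a • (1, 0) + b • (0, 1) := by ext <;> simp
  rw [this, map_add, map_smul, map_smul]
  simp only [smul_eq_mul]; ring

/-- With total derivatives `D_t, D_x`, the expression `D_t K D_x L - D_x K D_t L` is
`br₀ + u_t br₁ + u_x br₂`. -/
noncomputable def br₀ (K L : ℝ × ℝ × ℝ → ℝ) (Q : ℝ × ℝ × ℝ) : ℝ :=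
  dT K Q * dX L Q - dX K Q * dT L Q
/-- The coefficient of `u_t` in the total Jacobian. -/
noncomputable def br₁ (K L : ℝ × ℝ × ℝ → ℝ) (Q : ℝ × ℝ × ℝ) : ℝ :=
  dU K Q * dX L Q - dX K Q * dU L Q
/-- The coefficient of `u_x` in the total Jacobian. -/
noncomputable def br₂ (K L : ℝ × ℝ × ℝ → ℝ) (Q : ℝ × ℝ × ℝ) : ℝ :=
  dT K Q * dU L Q - dU K Q * dT L Q

lemma contDiffAt_partial {K : ℝ × ℝ × ℝ → ℝ} {Q : ℝ × ℝ × ℝ} (hK : ContDiffAt ℝ ∞ K Q) :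
    ContDiffAt ℝ ∞ (dT K) Q ∧ ContDiffAt ℝ ∞ (dX K) Q ∧ ContDiffAt ℝ ∞ (dU K) Q :=
  ⟨(hK.fderiv_right (m := ∞) (by simp)).clm_apply contDiffAt_const,
    (hK.fderiv_right (m := ∞) (by simp)).clm_apply contDiffAt_const,
    (hK.fderiv_right (m := ∞) (by simp)).clm_apply contDiffAt_const⟩

lemma differentiableAt_br {K L : ℝ × ℝ × ℝ → ℝ} {Q : ℝ × ℝ × ℝ} (hK : ContDiffAt ℝ ∞ K Q)
    (hL : ContDiffAt ℝ ∞ L Q) :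
    DifferentiableAt ℝ (br₀ K L) Q ∧ DifferentiableAt ℝ (br₁ K L) Q ∧
      DifferentiableAt ℝ (br₂ K L) Q := by
  obtain ⟨a, b, c⟩ := contDiffAt_partial hK
  obtain ⟨a', b', c'⟩ := contDiffAt_partial hL
  exact ⟨((a.mul b').sub (b.mul a')).differentiableAt (by simp),
    ((c.mul b').sub (b.mul c')).differentiableAt (by simp),
    ((a.mul c').sub (c.mul a')).differentiableAt (by simp)⟩

/-- Chain rule for the graph of `u`. -/
lemma hasFDerivAt_graph {K : ℝ × ℝ × ℝ → ℝ} {u : ℝ → ℝ → ℝ} {z : ℝ × ℝ} {p q : ℝ}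
    (hK : DifferentiableAt ℝ K (z.1, z.2, u z.1 z.2))
    (hu : HasFDerivAt (fun z : ℝ × ℝ => u z.1 z.2)
      (p • ContinuousLinearMap.fst ℝ ℝ ℝ + q • ContinuousLinearMap.snd ℝ ℝ ℝ) z) :
    ∃ K' : ℝ × ℝ →L[ℝ] ℝ, HasFDerivAt (fun z : ℝ × ℝ => K (z.1, z.2, u z.1 z.2)) K' z ∧
      K' (1, 0) = dT K (z.1, z.2, u z.1 z.2) + p * dU K (z.1, z.2, u z.1 z.2) ∧
      K' (0, 1) = dX K (z.1, z.2, u z.1 z.2) + q * dU K (z.1, z.2, u z.1 z.2) := by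
  refine ⟨_, hK.hasFDerivAt.comp z (f := fun z : ℝ × ℝ => (z.1, z.2, u z.1 z.2))
    (hasFDerivAt_fst.prodMk (hasFDerivAt_snd.prodMk hu)), ?_, ?_⟩
  · simp [fderiv_triple]
  · simp [fderiv_triple]

lemma first_order {T X U : ℝ × ℝ × ℝ → ℝ} {V : ℝ × ℝ → ℝ} {u : ℝ → ℝ → ℝ} {z : ℝ × ℝ} {p q : ℝ}
    (hT : DifferentiableAt ℝ T (z.1, z.2, u z.1 z.2))
    (hX : DifferentiableAt ℝ X (z.1, z.2, u z.1 z.2))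
    (hU : DifferentiableAt ℝ U (z.1, z.2, u z.1 z.2))
    (hV : DifferentiableAt ℝ V (T (z.1, z.2, u z.1 z.2), X (z.1, z.2, u z.1 z.2)))
    (hu : HasFDerivAt (fun z : ℝ × ℝ => u z.1 z.2)
      (p • ContinuousLinearMap.fst ℝ ℝ ℝ + q • ContinuousLinearMap.snd ℝ ℝ ℝ) z)
    (h : ∀ᶠ z : ℝ × ℝ in 𝓝 z, V (T (z.1, z.2, u z.1 z.2), X (z.1, z.2, u z.1 z.2))
      = U (z.1, z.2, u z.1 z.2)) :
    let Q := (z.1, z.2, u z.1 z.2)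
    fderiv ℝ V (T Q, X Q) (1, 0) * (dT T Q + p * dU T Q)
      + fderiv ℝ V (T Q, X Q) (0, 1) * (dT X Q + p * dU X Q) = dT U Q + p * dU U Q ∧
    fderiv ℝ V (T Q, X Q) (1, 0) * (dX T Q + q * dU T Q)
      + fderiv ℝ V (T Q, X Q) (0, 1) * (dX X Q + q * dU X Q) = dX U Q + q * dU U Q := by
  intro Q
  obtain ⟨T', hT', t1, t2⟩ := hasFDerivAt_graph hT hu
  obtain ⟨X', hX', x1, x2⟩ := hasFDerivAt_graph hX hu
  obtain ⟨U', hU', u1, u2⟩ := hasFDerivAt_graph hU hu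
  have hc := HasFDerivAt.comp z (f := fun z : ℝ × ℝ =>
    (T (z.1, z.2, u z.1 z.2), X (z.1, z.2, u z.1 z.2))) hV.hasFDerivAt (hT'.prodMk hX')
  have he := (hU'.congr_of_eventuallyEq h).unique hc
  rw [← t1, ← t2, ← x1, ← x2, ← u1, ← u2, he]
  constructor
  · rw [ContinuousLinearMap.comp_apply, ContinuousLinearMap.prod_apply]
    exact (fderiv_couple _ _ _ _).symm
  · rw [ContinuousLinearMap.comp_apply, ContinuousLinearMap.prod_apply]
    exact (fderiv_couple _ _ _ _).symm

/-- Quadratic function with prescribed jet at `(t₀, x₀)`. -/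
noncomputable def quad (t₀ x₀ u₀ p q w r : ℝ) (t x : ℝ) : ℝ :=
  u₀ + p * (t - t₀) + q * (x - x₀) + w / 2 * (x - x₀) ^ 2 + r / 2 * (t - t₀) ^ 2

lemma quad_self (t₀ x₀ u₀ p q w r : ℝ) : quad t₀ x₀ u₀ p q w r t₀ x₀ = u₀ := by simp [quad]

lemma contDiff_quad (t₀ x₀ u₀ p q w r : ℝ) :
    ContDiff ℝ ∞ (fun z : ℝ × ℝ => quad t₀ x₀ u₀ p q w r z.1 z.2) := by
  unfold quad; fun_prop

lemma hasFDerivAt_quad (t₀ x₀ u₀ p q w r : ℝ) (z : ℝ × ℝ) :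
    HasFDerivAt (fun z : ℝ × ℝ => quad t₀ x₀ u₀ p q w r z.1 z.2)
      ((p + r * (z.1 - t₀)) • ContinuousLinearMap.fst ℝ ℝ ℝ
        + (q + w * (z.2 - x₀)) • ContinuousLinearMap.snd ℝ ℝ ℝ) z := by
  have h1 : HasFDerivAt (fun z : ℝ × ℝ => z.1 - t₀) (ContinuousLinearMap.fst ℝ ℝ ℝ) z :=
    hasFDerivAt_fst.sub_const t₀
  have h2 : HasFDerivAt (fun z : ℝ × ℝ => z.2 - x₀) (ContinuousLinearMap.snd ℝ ℝ ℝ) z :=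
    hasFDerivAt_snd.sub_const x₀
  have := ((((hasFDerivAt_const u₀ z).add (h1.const_mul p)).add (h2.const_mul q)).add
    ((h2.pow 2).const_mul (w / 2))).add ((h1.pow 2).const_mul (r / 2))
  refine this.congr_fderiv ?_
  ext <;> simp <;> ring

lemma quad_derivs (t₀ x₀ u₀ p q w r : ℝ) :
    deriv (fun s => quad t₀ x₀ u₀ p q w r s x₀) t₀ = p ∧
    deriv (quad t₀ x₀ u₀ p q w r t₀) x₀ = q ∧
    deriv (deriv (quad t₀ x₀ u₀ p q w r t₀)) x₀ = w := by
  have hx : ∀ x, HasDerivAt (quad t₀ x₀ u₀ p q w r t₀) (q + w * (x - x₀)) x := by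
    intro x
    have := (hasFDerivAt_quad t₀ x₀ u₀ p q w r (t₀, x)).comp_hasDerivAt x
      (f := fun y : ℝ => (t₀, y)) ((hasDerivAt_const x t₀).prodMk (hasDerivAt_id x))
    refine this.congr_deriv ?_
    simp
  have ht := (hasFDerivAt_quad t₀ x₀ u₀ p q w r (t₀, x₀)).comp_hasDerivAt t₀
      (f := fun y : ℝ => (y, x₀)) ((hasDerivAt_id t₀).prodMk (hasDerivAt_const t₀ x₀))
  refine ⟨?_, ?_, ?_⟩
  · refine ht.deriv.trans ?_; simp
  · rw [(hx x₀).deriv]; simp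
  · rw [show deriv (quad t₀ x₀ u₀ p q w r t₀) = fun x => q + w * (x - x₀) from
      funext fun x => (hx x).deriv]
    have := (((hasDerivAt_id x₀).sub_const x₀).const_mul w).const_add q
    exact this.deriv.trans (by simp)

/-- Derivative of `br₀ + p br₁ + q br₂` along `e` at frozen `p`, `q`. -/
noncomputable def dbr (K L : ℝ × ℝ × ℝ → ℝ) (Q : ℝ × ℝ × ℝ) (p q : ℝ) (e : ℝ × ℝ × ℝ) : ℝ :=
  fderiv ℝ (br₀ K L) Q e + p * fderiv ℝ (br₁ K L) Q e + q * fderiv ℝ (br₂ K L) Q e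

/-- Since `quad` has no mixed term, `u_t` is constant along the `x`-line, and only `u_x = q + w (x -
x₀)` adds a term beyond the frozen derivative `dbr`. -/
lemma hasDerivAt_br_x {K L : ℝ × ℝ × ℝ → ℝ} {t₀ x₀ u₀ : ℝ} (p q w r : ℝ)
    (hK : ContDiffAt ℝ ∞ K (t₀, x₀, u₀)) (hL : ContDiffAt ℝ ∞ L (t₀, x₀, u₀)) :
    HasDerivAt (fun x => br₀ K L (t₀, x, quad t₀ x₀ u₀ p q w r t₀ x)
        + p * br₁ K L (t₀, x, quad t₀ x₀ u₀ p q w r t₀ x)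
        + (q + w * (x - x₀)) * br₂ K L (t₀, x, quad t₀ x₀ u₀ p q w r t₀ x))
      (dbr K L (t₀, x₀, u₀) p q (0, 1, q) + w * br₂ K L (t₀, x₀, u₀)) x₀ := by
  obtain ⟨h0, h1, h2⟩ := differentiableAt_br hK hL
  have hq : HasDerivAt (quad t₀ x₀ u₀ p q w r t₀) q x₀ := by
    have := (hasFDerivAt_quad t₀ x₀ u₀ p q w r (t₀, x₀)).comp_hasDerivAt x₀
      (f := fun y : ℝ => (t₀, y)) ((hasDerivAt_const x₀ t₀).prodMk (hasDerivAt_id x₀))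
    refine this.congr_deriv ?_
    simp
  have hγ : HasDerivAt (fun x => (t₀, x, quad t₀ x₀ u₀ p q w r t₀ x)) (0, 1, q) x₀ :=
    (hasDerivAt_const x₀ t₀).prodMk ((hasDerivAt_id x₀).prodMk hq)
  have e : (t₀, x₀, quad t₀ x₀ u₀ p q w r t₀ x₀) = (t₀, x₀, u₀) := by rw [quad_self]
  rw [← e] at h0 h1 h2
  have d0 := h0.hasFDerivAt.comp_hasDerivAt x₀ hγ
  have d1 := h1.hasFDerivAt.comp_hasDerivAt x₀ hγ
  have d2 := h2.hasFDerivAt.comp_hasDerivAt x₀ hγ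
  have dq : HasDerivAt (fun x => q + w * (x - x₀)) w x₀ := by
    simpa using (((hasDerivAt_id x₀).sub_const x₀).const_mul w).const_add q
  have := (d0.add (d1.const_mul p)).add (dq.mul d2)
  refine this.congr_deriv ?_
  simp only [quad_self, dbr, Function.comp]
  ring

lemma hasDerivAt_br_t {K L : ℝ × ℝ × ℝ → ℝ} {t₀ x₀ u₀ : ℝ} (p q w r : ℝ)
    (hK : ContDiffAt ℝ ∞ K (t₀, x₀, u₀)) (hL : ContDiffAt ℝ ∞ L (t₀, x₀, u₀)) :
    HasDerivAt (fun t => br₀ K L (t, x₀, quad t₀ x₀ u₀ p q w r t x₀)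
        + (p + r * (t - t₀)) * br₁ K L (t, x₀, quad t₀ x₀ u₀ p q w r t x₀)
        + q * br₂ K L (t, x₀, quad t₀ x₀ u₀ p q w r t x₀))
      (dbr K L (t₀, x₀, u₀) p q (1, 0, p) + r * br₁ K L (t₀, x₀, u₀)) t₀ := by
  obtain ⟨h0, h1, h2⟩ := differentiableAt_br hK hL
  have hq : HasDerivAt (fun t => quad t₀ x₀ u₀ p q w r t x₀) p t₀ := by
    have := (hasFDerivAt_quad t₀ x₀ u₀ p q w r (t₀, x₀)).comp_hasDerivAt t₀
      (f := fun y : ℝ => (y, x₀)) ((hasDerivAt_id t₀).prodMk (hasDerivAt_const t₀ x₀))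
    refine this.congr_deriv ?_
    simp
  have hγ : HasDerivAt (fun t => (t, x₀, quad t₀ x₀ u₀ p q w r t x₀)) (1, 0, p) t₀ :=
    (hasDerivAt_id t₀).prodMk ((hasDerivAt_const t₀ x₀).prodMk hq)
  have e : (t₀, x₀, quad t₀ x₀ u₀ p q w r t₀ x₀) = (t₀, x₀, u₀) := by rw [quad_self]
  rw [← e] at h0 h1 h2
  have d0 := h0.hasFDerivAt.comp_hasDerivAt t₀ hγ
  have d1 := h1.hasFDerivAt.comp_hasDerivAt t₀ hγ
  have d2 := h2.hasFDerivAt.comp_hasDerivAt t₀ hγ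
  have dp : HasDerivAt (fun t => p + r * (t - t₀)) r t₀ := by
    simpa using (((hasDerivAt_id t₀).sub_const t₀).const_mul r).const_add p
  have := (d0.add (dp.mul d1)).add (d2.const_mul q)
  refine this.congr_deriv ?_
  simp only [quad_self, dbr, Function.comp]
  ring

/-- The first and second derivatives of the transform `V` of a quadratic function. -/
lemma second_order {T X U : ℝ × ℝ × ℝ → ℝ} {V : ℝ × ℝ → ℝ} {t₀ x₀ u₀ p q w r : ℝ}
    (hT : ContDiffAt ℝ ∞ T (t₀, x₀, u₀)) (hX : ContDiffAt ℝ ∞ X (t₀, x₀, u₀))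
    (hU : ContDiffAt ℝ ∞ U (t₀, x₀, u₀))
    (hV : ContDiffAt ℝ ∞ V (T (t₀, x₀, u₀), X (t₀, x₀, u₀)))
    (h : ∀ᶠ z : ℝ × ℝ in 𝓝 (t₀, x₀), V (T (z.1, z.2, quad t₀ x₀ u₀ p q w r z.1 z.2),
      X (z.1, z.2, quad t₀ x₀ u₀ p q w r z.1 z.2)) = U (z.1, z.2, quad t₀ x₀ u₀ p q w r z.1 z.2)) :
    let Q := (t₀, x₀, u₀)
    let VT := fderiv ℝ V (T Q, X Q) (1, 0)
    let VX := fderiv ℝ V (T Q, X Q) (0, 1)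
    let VXX := fderiv ℝ (fun y => fderiv ℝ V y (0, 1)) (T Q, X Q) (0, 1)
    VT * (dT T Q + p * dU T Q) + VX * (dT X Q + p * dU X Q) = dT U Q + p * dU U Q ∧
    VT * (dX T Q + q * dU T Q) + VX * (dX X Q + q * dU X Q) = dX U Q + q * dU U Q ∧
    VXX * (br₀ T X Q + p * br₁ T X Q + q * br₂ T X Q) ^ 2 =
      (dT T Q + p * dU T Q) * (dbr T U Q p q (0, 1, q) + w * br₂ T U Q
        - VX * (dbr T X Q p q (0, 1, q) + w * br₂ T X Q))
      - (dX T Q + q * dU T Q) * (dbr T U Q p q (1, 0, p) + r * br₁ T U Q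
        - VX * (dbr T X Q p q (1, 0, p) + r * br₁ T X Q)) := by
  intro Q VT VX VXX
  set u := quad t₀ x₀ u₀ p q w r with hu
  have hu0 : u t₀ x₀ = u₀ := quad_self _ _ _ _ _ _ _
  have hγc : ContinuousAt (fun z : ℝ × ℝ => (z.1, z.2, u z.1 z.2)) (t₀, x₀) :=
    (continuous_fst.prodMk (continuous_snd.prodMk
      (contDiff_quad t₀ x₀ u₀ p q w r).continuous)).continuousAt
  have two : ∀ {E : Type} [NormedAddCommGroup E] [NormedSpace ℝ E] {K : E → ℝ} {y : E},
      ContDiffAt ℝ ∞ K y → ∀ᶠ z in 𝓝 y, DifferentiableAt ℝ K z := fun hK =>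
    ((hK.of_le (m := 1) (by norm_cast)).eventually (by simp)).mono
      fun z hz => hz.differentiableAt (by simp)
  have hγ0 : ((t₀, x₀).1, (t₀, x₀).2, u (t₀, x₀).1 (t₀, x₀).2) = (t₀, x₀, u₀) := by
    simp only [hu0]
  have eT := hγc.eventually (hγ0 ▸ two hT)
  have eX := hγc.eventually (hγ0 ▸ two hX)
  have eU := hγc.eventually (hγ0 ▸ two hU)
  have hMc : ContinuousAt (fun z : ℝ × ℝ => (T (z.1, z.2, u z.1 z.2), X (z.1, z.2, u z.1 z.2)))
      (t₀, x₀) :=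
    (ContinuousAt.comp (f := fun z : ℝ × ℝ => (z.1, z.2, u z.1 z.2)) (hγ0 ▸ hT.continuousAt)
      hγc).prodMk (ContinuousAt.comp (f := fun z : ℝ × ℝ => (z.1, z.2, u z.1 z.2))
      (hγ0 ▸ hX.continuousAt) hγc)
  have eV := hMc.eventually (p := fun y => DifferentiableAt ℝ V y) (by
    simp only [hu0]; exact two hV)
  have key := ((((eT.and eX).and eU).and eV).and h.eventually_nhds).mono fun z hz =>
    first_order hz.1.1.1.1 hz.1.1.1.2 hz.1.1.2 hz.1.2 (hasFDerivAt_quad t₀ x₀ u₀ p q w r z) hz.2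
  have key0 := key.self_of_nhds
  simp only [hu0, sub_self, mul_zero, add_zero] at key0
  obtain ⟨k1, k2⟩ := key0
  refine ⟨k1, k2, ?_⟩
  -- `V_T` is eliminated from the two first-order identities, which leaves `V_X` times the total
  -- Jacobian.
  have elim : ∀ᶠ z : ℝ × ℝ in 𝓝 (t₀, x₀),
      fderiv ℝ V (T (z.1, z.2, u z.1 z.2), X (z.1, z.2, u z.1 z.2)) (0, 1) *
        (br₀ T X (z.1, z.2, u z.1 z.2) + (p + r * (z.1 - t₀)) * br₁ T X (z.1, z.2, u z.1 z.2)
          + (q + w * (z.2 - x₀)) * br₂ T X (z.1, z.2, u z.1 z.2)) =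
      br₀ T U (z.1, z.2, u z.1 z.2) + (p + r * (z.1 - t₀)) * br₁ T U (z.1, z.2, u z.1 z.2)
          + (q + w * (z.2 - x₀)) * br₂ T U (z.1, z.2, u z.1 z.2) := by
    filter_upwards [key] with z hz
    obtain ⟨h1, h2⟩ := hz
    simp only [br₀, br₁, br₂]
    linear_combination
      (dT T (z.1, z.2, u z.1 z.2) + (p + r * (z.1 - t₀)) * dU T (z.1, z.2, u z.1 z.2)) * h2
      - (dX T (z.1, z.2, u z.1 z.2) + (q + w * (z.2 - x₀)) * dU T (z.1, z.2, u z.1 z.2)) * h1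
  have dVX : DifferentiableAt ℝ (fun y => fderiv ℝ V y (0, 1)) (T (t₀, x₀, u t₀ x₀), X (t₀, x₀, u t₀ x₀)) := by
    rw [hu0]
    exact ((hV.fderiv_right (m := 1) (by norm_cast)).clm_apply contDiffAt_const).differentiableAt
        (by simp)
  have lx : ∀ y, HasDerivAt (fun y : ℝ => (t₀, y)) ((0 : ℝ), (1 : ℝ)) y := fun y =>
    (hasDerivAt_const y t₀).prodMk (hasDerivAt_id y)
  have lt : ∀ y, HasDerivAt (fun s : ℝ => (s, x₀)) ((1 : ℝ), (0 : ℝ)) y := fun y =>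
    (hasDerivAt_id y).prodMk (hasDerivAt_const y x₀)
  obtain ⟨T', hT', t1, t2⟩ := hasFDerivAt_graph (u := u) (z := (t₀, x₀))
    (hγ0 ▸ hT.differentiableAt (by simp)) (hasFDerivAt_quad t₀ x₀ u₀ p q w r (t₀, x₀))
  obtain ⟨X', hX', s1, s2⟩ := hasFDerivAt_graph (u := u) (z := (t₀, x₀))
    (hγ0 ▸ hX.differentiableAt (by simp)) (hasFDerivAt_quad t₀ x₀ u₀ p q w r (t₀, x₀))
  simp only [hu0, sub_self, mul_zero, add_zero] at t1 t2 s1 s2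
  have hc := HasFDerivAt.comp (t₀, x₀) (f := fun z : ℝ × ℝ =>
    (T (z.1, z.2, u z.1 z.2), X (z.1, z.2, u z.1 z.2))) dVX.hasFDerivAt (hT'.prodMk hX')
  have cx := hc.comp_hasDerivAt x₀ (lx x₀)
  have ct := hc.comp_hasDerivAt t₀ (lt t₀)
  have ex := (lx x₀).continuousAt.eventually elim
  have et := (lt t₀).continuousAt.eventually elim
  simp only [sub_self, mul_zero, add_zero] at ex et
  -- `elim` holds near the point, so it may be differentiated once more along each coordinate axis.
  have hx := ((cx.mul (hasDerivAt_br_x p q w r hT hX)).congr_of_eventuallyEq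
    (EventuallyEq.symm ex)).unique (hasDerivAt_br_x p q w r hT hU)
  have ht := ((ct.mul (hasDerivAt_br_t p q w r hT hX)).congr_of_eventuallyEq
    (EventuallyEq.symm et)).unique (hasDerivAt_br_t p q w r hT hU)
  simp only [Function.comp, ← hu, hu0, ContinuousLinearMap.comp_apply, ContinuousLinearMap.prod_apply, t1, t2, s1, s2,
    sub_self, mul_zero, add_zero] at hx ht
  rw [fderiv_couple _ _ (dX T _ + _)] at hx
  rw [fderiv_couple _ _ (dT T _ + _)] at ht
  simp only [Q, VX, VXX]
  have e : br₀ T X (t₀, x₀, u₀) + p * br₁ T X (t₀, x₀, u₀) + q * br₂ T X (t₀, x₀, u₀)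
      = (dT T (t₀, x₀, u₀) + p * dU T (t₀, x₀, u₀)) * (dX X (t₀, x₀, u₀) + q * dU X (t₀, x₀, u₀))
      - (dX T (t₀, x₀, u₀) + q * dU T (t₀, x₀, u₀)) * (dT X (t₀, x₀, u₀) + p * dU X (t₀, x₀, u₀)) := by
    simp only [br₀, br₁, br₂]; ring
  generalize br₀ T X (t₀, x₀, u₀) + p * br₁ T X (t₀, x₀, u₀) + q * br₂ T X (t₀, x₀, u₀) = D
    at e hx ht ⊢
  -- The weights `D_t T` and `-D_x T` cancel the mixed derivative of `V`, so that `V_XX` alone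
  -- survives, multiplied by the square of the total Jacobian.
  linear_combination (dT T (t₀, x₀, u₀) + p * dU T (t₀, x₀, u₀)) * hx
    - (dX T (t₀, x₀, u₀) + q * dU T (t₀, x₀, u₀)) * ht
    + D * fderiv ℝ (fun y => fderiv ℝ V y (0, 1)) (T (t₀, x₀, u₀), X (t₀, x₀, u₀)) (0, 1) * e

/-! ### Determining equations from the highest derivatives. -/

/-- The equation `θ` at the point `x` for a function with value `u`, first derivatives `p`, `q` and
second `x`-derivative `w`. -/
def Elems.Jet (θ : Elems) (x u p q w : ℝ) : Prop :=
  θ.f x * p = Real.exp (θ.n * u) * (deriv θ.g x * q + θ.n * θ.g x * q ^ 2 + θ.g x * w)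
    + θ.h x * Real.exp (θ.m * u)

/-- The value of `u_t` found from the equation. -/
noncomputable def Elems.solveT (θ : Elems) (x u q w : ℝ) : ℝ :=
  (Real.exp (θ.n * u) * (deriv θ.g x * q + θ.n * θ.g x * q ^ 2 + θ.g x * w)
    + θ.h x * Real.exp (θ.m * u)) / θ.f x

lemma Elems.jet_solveT {θ : Elems} {x : ℝ} (hf : θ.f x ≠ 0) (u q w : ℝ) :
    θ.Jet x u (θ.solveT x u q w) q w := by
  unfold Elems.Jet Elems.solveT; field_simp

lemma fderiv_components {τ : ℝ × ℝ × ℝ → ℝ × ℝ × ℝ} {Q : ℝ × ℝ × ℝ}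
    (hτ : DifferentiableAt ℝ τ Q) (e : ℝ × ℝ × ℝ) :
    (fderiv ℝ τ Q e).1 = fderiv ℝ (fun Q => (τ Q).1) Q e ∧
    (fderiv ℝ τ Q e).2.1 = fderiv ℝ (fun Q => (τ Q).2.1) Q e ∧
    (fderiv ℝ τ Q e).2.2 = fderiv ℝ (fun Q => (τ Q).2.2) Q e := by
  have h := hτ.hasFDerivAt
  rw [h.fst.fderiv, h.snd.fst.fderiv, h.snd.snd.fderiv]
  exact ⟨rfl, rfl, rfl⟩

/-- Expansion along the gradient of `U`. A nonzero determinant thus prevents the three brackets of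
`T` and `X` from vanishing together, so the total Jacobian is nonzero for some `u_t`, `u_x`. -/
lemma det_eq_br {τ : ℝ × ℝ × ℝ → ℝ × ℝ × ℝ} {Q : ℝ × ℝ × ℝ} (hτ : DifferentiableAt ℝ τ Q) :
    (fderiv ℝ τ Q).det = dU (fun Q => (τ Q).2.2) Q * br₀ (fun Q => (τ Q).1) (fun Q => (τ Q).2.1) Q
      - dX (fun Q => (τ Q).2.2) Q * br₂ (fun Q => (τ Q).1) (fun Q => (τ Q).2.1) Q
      - dT (fun Q => (τ Q).2.2) Q * br₁ (fun Q => (τ Q).1) (fun Q => (τ Q).2.1) Q := by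
  rw [det_triple]
  simp only [(fderiv_components hτ _).1, (fderiv_components hτ _).2.1,
    (fderiv_components hτ _).2.2, br₀, br₁, br₂, dT, dX, dU]
  ring

/-- What an equation-preserving point transformation does to the jet of a quadratic function. -/
lemma transform_jet {B : Set (ℝ × ℝ × ℝ)} {τ : ℝ × ℝ × ℝ → ℝ × ℝ × ℝ} {θ θ' : Elems}
    (hm : MapsEquation B τ θ θ') {t₀ x₀ u₀ : ℝ} (hB : (t₀, x₀, u₀) ∈ B)
    (hτ : ContDiffAt ℝ ∞ τ (t₀, x₀, u₀)) (hg : DifferentiableAt ℝ θ.g x₀)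
    (hg' : DifferentiableAt ℝ θ'.g (τ (t₀, x₀, u₀)).2.1) (p q w r : ℝ) :
    let Q := (t₀, x₀, u₀)
    let T : ℝ × ℝ × ℝ → ℝ := fun Q => (τ Q).1
    let X : ℝ × ℝ × ℝ → ℝ := fun Q => (τ Q).2.1
    let U : ℝ × ℝ × ℝ → ℝ := fun Q => (τ Q).2.2
    br₀ T X Q + p * br₁ T X Q + q * br₂ T X Q ≠ 0 → ∃ VT VX VXX : ℝ,
    VT * (dT T Q + p * dU T Q) + VX * (dT X Q + p * dU X Q) = dT U Q + p * dU U Q ∧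
    VT * (dX T Q + q * dU T Q) + VX * (dX X Q + q * dU X Q) = dX U Q + q * dU U Q ∧
    VXX * (br₀ T X Q + p * br₁ T X Q + q * br₂ T X Q) ^ 2 =
      (dT T Q + p * dU T Q) * (dbr T U Q p q (0, 1, q) + w * br₂ T U Q
        - VX * (dbr T X Q p q (0, 1, q) + w * br₂ T X Q))
      - (dX T Q + q * dU T Q) * (dbr T U Q p q (1, 0, p) + r * br₁ T U Q
        - VX * (dbr T X Q p q (1, 0, p) + r * br₁ T X Q)) ∧
    (θ.Jet x₀ u₀ p q w ↔ θ'.Jet (X Q) (U Q) VT VX VXX) := by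
  intro Q T X U hD
  have hT : ContDiffAt ℝ ∞ T Q := hτ.fst
  have hX : ContDiffAt ℝ ∞ X Q := hτ.snd.fst
  have hU : ContDiffAt ℝ ∞ U Q := hτ.snd.snd
  set u := quad t₀ x₀ u₀ p q w r with hu
  have hu0 : u t₀ x₀ = u₀ := quad_self _ _ _ _ _ _ _
  have hus := (contDiff_quad t₀ x₀ u₀ p q w r).contDiffAt (x := (t₀, x₀))
  have hγ0 : ((t₀, x₀).1, (t₀, x₀).2, u (t₀, x₀).1 (t₀, x₀).2) = (t₀, x₀, u₀) := by
    simp only [hu0]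
  have hdet : (fderiv ℝ (fun q : ℝ × ℝ =>
      ((τ (q.1, q.2, u q.1 q.2)).1, (τ (q.1, q.2, u q.1 q.2)).2.1)) (t₀, x₀)).det ≠ 0 := by
    obtain ⟨T', hT', t1, t2⟩ := hasFDerivAt_graph (K := T) (u := u) (z := (t₀, x₀))
      (hγ0 ▸ hT.differentiableAt (by simp)) (hasFDerivAt_quad t₀ x₀ u₀ p q w r (t₀, x₀))
    obtain ⟨X', hX', s1, s2⟩ := hasFDerivAt_graph (K := X) (u := u) (z := (t₀, x₀))
      (hγ0 ▸ hX.differentiableAt (by simp)) (hasFDerivAt_quad t₀ x₀ u₀ p q w r (t₀, x₀))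
    simp only [hu0, sub_self, mul_zero, add_zero] at t1 t2 s1 s2
    rw [(hT'.prodMk hX').fderiv, det_pair]
    simp only [ContinuousLinearMap.prod_apply, t1, t2, s1, s2]
    refine fun h => hD ?_
    simp only [br₀, br₁, br₂, Q]
    linear_combination h
  obtain ⟨v, hv, hev, hiff⟩ := exists_transform hm (u := u) (t := t₀) (x := x₀)
    (by rw [hu0]; exact hB) (by rw [hu0]; exact hτ) hus hdet
  rw [hu0] at hv hiff
  obtain ⟨a, b, c⟩ := second_order (V := fun q => v q.1 q.2) hT hX hU hv hev
  obtain ⟨d1, d2, d3, d4, -⟩ := line_derivs hv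
  refine ⟨_, _, _, a, b, c, ?_⟩
  obtain ⟨e1, e2, e3⟩ := quad_derivs t₀ x₀ u₀ p q w r
  have hv0 : v (τ Q).1 (τ Q).2.1 = (τ Q).2.2 := by
    have := hev.self_of_nhds
    simpa only [hu0] using this
  rw [Elems.solvesAt_iff hg ((line_derivs hus).2.2.2.1.of_le (by norm_cast)),
    Elems.solvesAt_iff hg' (d4.of_le (by norm_cast)), quad_self, hv0, e1, e2, e3, d1, d2, d3] at hiff
  exact hiff

/-- A nonzero affine function of `(p, q)` is nonzero at two points with different `q`, and two
values of `q` determine an affine function of `q`. When the function is not constant, the witnesses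
are solved so that it takes the value 1 or 2. -/
lemma affine_nonvanishing {b₀ b₁ b₂ a c : ℝ} (hb : ¬ (b₀ = 0 ∧ b₁ = 0 ∧ b₂ = 0))
    (h : ∀ p q : ℝ, b₀ + p * b₁ + q * b₂ ≠ 0 → a + q * c = 0) : a = 0 ∧ c = 0 := by
  suffices ∃ p q p' q', q ≠ q' ∧ b₀ + p * b₁ + q * b₂ ≠ 0 ∧ b₀ + p' * b₁ + q' * b₂ ≠ 0 by
    obtain ⟨p, q, p', q', hq, h1, h2⟩ := this
    have e1 := h p q h1
    have e2 := h p' q' h2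
    have hc : c = 0 := by
      have : (q - q') * c = 0 := by linear_combination e1 - e2
      exact (mul_eq_zero.1 this).resolve_left (sub_ne_zero.2 hq)
    exact ⟨by simpa [hc] using e1, hc⟩
  by_cases h1 : b₁ = 0
  · by_cases h2 : b₂ = 0
    · refine ⟨0, 0, 0, 1, by norm_num, ?_, ?_⟩ <;> simp_all
    · refine ⟨0, (1 - b₀) / b₂, 0, (2 - b₀) / b₂, ?_, ?_, ?_⟩
      · intro h
        rw [div_left_inj' h2] at h
        linarith
      · field_simp; simp
      · field_simp; simp
  · refine ⟨(1 - b₀) / b₁, 0, (1 - b₀ - b₂) / b₁, 1, by norm_num, ?_, ?_⟩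
    · field_simp; simp
    · field_simp; ring_nf; norm_num

/-- The new time does not depend on `x` and `u`. -/
lemma time_partial_zero {B : Set (ℝ × ℝ × ℝ)} {τ : ℝ × ℝ × ℝ → ℝ × ℝ × ℝ} {θ θ' : Elems}
    (hm : MapsEquation B τ θ θ') {t₀ x₀ u₀ : ℝ} (hB : (t₀, x₀, u₀) ∈ B)
    (hτ : ContDiffAt ℝ ∞ τ (t₀, x₀, u₀)) (hdet : (fderiv ℝ τ (t₀, x₀, u₀)).det ≠ 0)
    (hg : DifferentiableAt ℝ θ.g x₀)
    (hg' : DifferentiableAt ℝ θ'.g (τ (t₀, x₀, u₀)).2.1) (hg0' : θ'.g (τ (t₀, x₀, u₀)).2.1 ≠ 0)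
    (hg0 : θ.g x₀ ≠ 0) :
    dX (fun Q => (τ Q).1) (t₀, x₀, u₀) = 0 ∧ dU (fun Q => (τ Q).1) (t₀, x₀, u₀) = 0 := by
  rw [det_eq_br (hτ.differentiableAt (by simp))] at hdet
  set Q := (t₀, x₀, u₀) with hQ
  set T : ℝ × ℝ × ℝ → ℝ := fun Q => (τ Q).1
  set X : ℝ × ℝ × ℝ → ℝ := fun Q => (τ Q).2.1
  set U : ℝ × ℝ × ℝ → ℝ := fun Q => (τ Q).2.2
  refine affine_nonvanishing (b₀ := br₀ T X Q) (b₁ := br₁ T X Q) (b₂ := br₂ T X Q)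
    (fun h => hdet (by simp [h.1, h.2.1, h.2.2])) fun p q hD => ?_
  -- choose `w` so that the equation is satisfied
  set w : ℝ := ((θ.f x₀ * p - θ.h x₀ * Real.exp (θ.m * u₀)) / Real.exp (θ.n * u₀)
    - deriv θ.g x₀ * q - θ.n * θ.g x₀ * q ^ 2) / θ.g x₀ with hw
  have hjet : θ.Jet x₀ u₀ p q w := by
    unfold Elems.Jet
    rw [hw]
    have := Real.exp_ne_zero (θ.n * u₀)
    field_simp
    ring
  -- The last parameter is `u_tt`. It is absent from the equation, so the jets with `u_tt = 0` and
  -- `u_tt = 1` both satisfy it.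
  obtain ⟨T0, X0, S0, a0, b0, c0, i0⟩ := transform_jet hm hB hτ hg hg' p q w 0 hD
  obtain ⟨T1, X1, S1, a1, b1, c1, i1⟩ := transform_jet hm hB hτ hg hg' p q w 1 hD
  have j0 := i0.1 hjet
  have j1 := i1.1 hjet
  have hDe : br₀ T X Q + p * br₁ T X Q + q * br₂ T X Q
      = (dT T Q + p * dU T Q) * (dX X Q + q * dU X Q)
      - (dX T Q + q * dU T Q) * (dT X Q + p * dU X Q) := by
    simp only [br₀, br₁, br₂]; ring
  have eX : ∀ {VT VX : ℝ}, VT * (dT T Q + p * dU T Q) + VX * (dT X Q + p * dU X Q)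
      = dT U Q + p * dU U Q →
      VT * (dX T Q + q * dU T Q) + VX * (dX X Q + q * dU X Q) = dX U Q + q * dU U Q →
      VX * (br₀ T X Q + p * br₁ T X Q + q * br₂ T X Q) =
        (dT T Q + p * dU T Q) * (dX U Q + q * dU U Q)
      - (dX T Q + q * dU T Q) * (dT U Q + p * dU U Q) ∧
      VT * (br₀ T X Q + p * br₁ T X Q + q * br₂ T X Q) =
        (dX X Q + q * dU X Q) * (dT U Q + p * dU U Q)
      - (dT X Q + p * dU X Q) * (dX U Q + q * dU U Q) := by
    intro VT VX h1 h2
    rw [hDe]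
    constructor
    · linear_combination (dT T Q + p * dU T Q) * h2 - (dX T Q + q * dU T Q) * h1
    · linear_combination (dX X Q + q * dU X Q) * h1 - (dT X Q + p * dU X Q) * h2
  obtain ⟨f0, g0⟩ := eX a0 b0
  obtain ⟨f1, g1⟩ := eX a1 b1
  have hX : X0 = X1 := mul_right_cancel₀ hD (f0.trans f1.symm)
  have hT : T0 = T1 := mul_right_cancel₀ hD (g0.trans g1.symm)
  subst hX hT
  -- As the new `g` is nonzero, the new equation determines `V_XX` from `V_T` and `V_X`, which do
  -- not involve `u_tt`.
  have hS : S0 = S1 := by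
    unfold Elems.Jet at j0 j1
    have e : Real.exp (θ'.n * U Q) * θ'.g (X Q) * (S0 - S1) = 0 := by
      linear_combination j1 - j0
    have := (mul_eq_zero.1 e).resolve_left (mul_ne_zero (Real.exp_ne_zero _) hg0')
    linarith
  subst hS
  have e1 : (dX T Q + q * dU T Q) * (br₁ T U Q - X0 * br₁ T X Q) = 0 := by
    linear_combination c1 - c0
  -- After multiplication by the total Jacobian and substitution of `V_X`, the second factor of `e1`
  -- becomes `-(T_x + q T_u)` times the Jacobian determinant of `τ`.
  have e2 : (dX T Q + q * dU T Q) ^ 2 * (dU U Q * br₀ T X Q - dX U Q * br₂ T X Q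
      - dT U Q * br₁ T X Q) = 0 := by
    have : (br₀ T X Q + p * br₁ T X Q + q * br₂ T X Q) * br₁ T U Q
        - ((dT T Q + p * dU T Q) * (dX U Q + q * dU U Q)
          - (dX T Q + q * dU T Q) * (dT U Q + p * dU U Q)) * br₁ T X Q
        = -(dX T Q + q * dU T Q) * (dU U Q * br₀ T X Q - dX U Q * br₂ T X Q
          - dT U Q * br₁ T X Q) := by
      simp only [br₀, br₁, br₂]; ring
    linear_combination (dX T Q + q * dU T Q) * this
      - (br₀ T X Q + p * br₁ T X Q + q * br₂ T X Q) * e1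
      - (dX T Q + q * dU T Q) * br₁ T X Q * f0
  have := (mul_eq_zero.1 e2).resolve_right hdet
  exact pow_eq_zero_iff (two_ne_zero) |>.1 this

/-- When `T` depends locally on `t` only, `br₁ T K` vanishes on an open set and so does its
derivative. Hence `dbr T K` loses its dependence on `p`. -/
lemma br₁_eq_zero_near {T K : ℝ × ℝ × ℝ → ℝ} {B : Set (ℝ × ℝ × ℝ)} (hB : IsOpen B)
    (h : ∀ Q ∈ B, dX T Q = 0 ∧ dU T Q = 0) {Q : ℝ × ℝ × ℝ} (hQ : Q ∈ B) (e : ℝ × ℝ × ℝ) :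
    br₁ T K Q = 0 ∧ fderiv ℝ (br₁ T K) Q e = 0 := by
  have h0 : ∀ Q ∈ B, br₁ T K Q = 0 := fun Q hQ => by simp [br₁, h Q hQ]
  refine ⟨h0 Q hQ, ?_⟩
  have : br₁ T K =ᶠ[𝓝 Q] fun _ => 0 := by
    filter_upwards [hB.mem_nhds hQ] with y hy using h0 y hy
  rw [this.fderiv_eq]
  simp

/-- The coefficients of `u_t` and of `u_xx` transform proportionally. -/
lemma leading_coefficients {B : Set (ℝ × ℝ × ℝ)} {τ : ℝ × ℝ × ℝ → ℝ × ℝ × ℝ} {θ θ' : Elems}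
    (hBo : IsOpen B) (hm : MapsEquation B τ θ θ')
    (hz : ∀ Q ∈ B, dX (fun Q => (τ Q).1) Q = 0 ∧ dU (fun Q => (τ Q).1) Q = 0)
    {t₀ x₀ u₀ : ℝ} (hB : (t₀, x₀, u₀) ∈ B)
    (hτ : ContDiffAt ℝ ∞ τ (t₀, x₀, u₀)) (hdet : (fderiv ℝ τ (t₀, x₀, u₀)).det ≠ 0)
    (hg : DifferentiableAt ℝ θ.g x₀) (hf : θ.f x₀ ≠ 0) (hg0 : θ.g x₀ ≠ 0)
    (hg' : DifferentiableAt ℝ θ'.g (τ (t₀, x₀, u₀)).2.1) (hf' : θ'.f (τ (t₀, x₀, u₀)).2.1 ≠ 0) :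
    let Q := (t₀, x₀, u₀)
    dT (fun Q => (τ Q).1) Q ≠ 0 ∧ dX (fun Q => (τ Q).2.1) Q ≠ 0 ∧ dU (fun Q => (τ Q).2.2) Q ≠ 0 ∧
    dU (fun Q => (τ Q).2.1) Q = 0 ∧
    θ'.f (τ Q).2.1 * θ.g x₀ * Real.exp (θ.n * u₀) * dX (fun Q => (τ Q).2.1) Q ^ 2
      = θ.f x₀ * θ'.g (τ Q).2.1 * Real.exp (θ'.n * (τ Q).2.2) * dT (fun Q => (τ Q).1) Q := by
  intro Q
  rw [det_eq_br (hτ.differentiableAt (by simp))] at hdet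
  set T : ℝ × ℝ × ℝ → ℝ := fun Q => (τ Q).1
  set X : ℝ × ℝ × ℝ → ℝ := fun Q => (τ Q).2.1
  set U : ℝ × ℝ × ℝ → ℝ := fun Q => (τ Q).2.2
  change _ * br₀ T X Q - _ * br₂ T X Q - _ * br₁ T X Q ≠ 0 at hdet
  obtain ⟨hTx, hTu⟩ := hz Q hB
  have hJ : dT T Q * (dU U Q * dX X Q - dX U Q * dU X Q) ≠ 0 := by
    intro h; apply hdet
    simp only [br₀, br₁, br₂]
    change dX T Q = 0 at hTx
    change dU T Q = 0 at hTu
    rw [hTx, hTu]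
    linear_combination h
  have hTt : dT T Q ≠ 0 := left_ne_zero_of_mul hJ
  -- Two jets with `u_xx = 0` and `u_xx = 1`, each with `u_t` solved from the equation, are
  -- compared. Lower-order terms cancel in the difference of the two transformed equations.
  have main : ∀ q, dX X Q + q * dU X Q ≠ 0 →
      θ'.f (X Q) * θ.g x₀ * Real.exp (θ.n * u₀) * (dX X Q + q * dU X Q) ^ 2
      = θ.f x₀ * θ'.g (X Q) * Real.exp (θ'.n * U Q) * dT T Q := by
    intro q hq
    have br1 := fun K e => br₁_eq_zero_near (K := K) hBo hz hB e
    change ∀ K e, br₁ T K Q = 0 ∧ fderiv ℝ (br₁ T K) Q e = 0 at br1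
    have br0 : ∀ K, br₀ T K Q = dT T Q * dX K Q := fun K => by simp only [br₀]; rw [hTx]; ring
    have br2 : ∀ K, br₂ T K Q = dT T Q * dU K Q := fun K => by simp only [br₂]; rw [hTu]; ring
    have hD : ∀ p, br₀ T X Q + p * br₁ T X Q + q * br₂ T X Q ≠ 0 := fun p => by
      rw [br0, br2, (br1 X 0).1]
      intro h; apply mul_ne_zero hTt hq; linear_combination h
    have hdbr : ∀ K p p' e, dbr T K Q p q e = dbr T K Q p' q e := fun K p p' e => by
      simp only [dbr, (br1 K e).2, mul_zero]
    obtain ⟨T0, X0, S0, a0, b0, c0, i0⟩ := transform_jet hm hB hτ hg hg'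
      (θ.solveT x₀ u₀ q 0) q 0 0 (hD _)
    obtain ⟨T1, X1, S1, a1, b1, c1, i1⟩ := transform_jet hm hB hτ hg hg'
      (θ.solveT x₀ u₀ q 1) q 1 0 (hD _)
    have j0 := i0.1 (Elems.jet_solveT hf _ _ _)
    have j1 := i1.1 (Elems.jet_solveT hf _ _ _)
    have hp : θ.f x₀ * (θ.solveT x₀ u₀ q 1 - θ.solveT x₀ u₀ q 0)
        = Real.exp (θ.n * u₀) * θ.g x₀ := by
      unfold Elems.solveT; field_simp; ring
    generalize θ.solveT x₀ u₀ q 1 = p1 at *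
    generalize θ.solveT x₀ u₀ q 0 = p0 at *
    change T0 * (dT T Q + p0 * dU T Q) + X0 * (dT X Q + p0 * dU X Q) = dT U Q + p0 * dU U Q at a0
    change T1 * (dT T Q + p1 * dU T Q) + X1 * (dT X Q + p1 * dU X Q) = dT U Q + p1 * dU U Q at a1
    change T0 * (dX T Q + q * dU T Q) + X0 * (dX X Q + q * dU X Q) = dX U Q + q * dU U Q at b0
    change T1 * (dX T Q + q * dU T Q) + X1 * (dX X Q + q * dU X Q) = dX U Q + q * dU U Q at b1
    change dX T Q = 0 at hTx
    change dU T Q = 0 at hTu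
    rw [hTx, hTu] at b0 b1
    rw [hTu] at a0 a1
    have hX : X0 = X1 := by
      have : (X0 - X1) * (dX X Q + q * dU X Q) = 0 := by linear_combination b0 - b1
      have := (mul_eq_zero.1 this).resolve_right hq
      linarith
    subst hX
    have c0' : S0 * (dT T Q * (dX X Q + q * dU X Q)) ^ 2 = dT T Q *
        (dbr T U Q 0 q (0, 1, q) - X0 * dbr T X Q 0 q (0, 1, q)) := by
      have := c0
      change S0 * (br₀ T X Q + p0 * br₁ T X Q + q * br₂ T X Q) ^ 2 =
        (dT T Q + p0 * dU T Q) * (dbr T U Q p0 q (0, 1, q) + 0 * br₂ T U Q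
        - X0 * (dbr T X Q p0 q (0, 1, q) + 0 * br₂ T X Q))
        - (dX T Q + q * dU T Q) * (dbr T U Q p0 q (1, 0, p0) + 0 * br₁ T U Q
        - X0 * (dbr T X Q p0 q (1, 0, p0) + 0 * br₁ T X Q)) at this
      rw [hTx, hTu, (br1 X 0).1, br0, br2, hdbr U p0 0, hdbr X p0 0] at this
      linear_combination this
    have c1' : S1 * (dT T Q * (dX X Q + q * dU X Q)) ^ 2 = dT T Q *
        (dbr T U Q 0 q (0, 1, q) + dT T Q * dU U Q
          - X0 * (dbr T X Q 0 q (0, 1, q) + dT T Q * dU X Q)) := by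
      have := c1
      change S1 * (br₀ T X Q + p1 * br₁ T X Q + q * br₂ T X Q) ^ 2 =
        (dT T Q + p1 * dU T Q) * (dbr T U Q p1 q (0, 1, q) + 1 * br₂ T U Q
        - X0 * (dbr T X Q p1 q (0, 1, q) + 1 * br₂ T X Q))
        - (dX T Q + q * dU T Q) * (dbr T U Q p1 q (1, 0, p1) + 0 * br₁ T U Q
        - X0 * (dbr T X Q p1 q (1, 0, p1) + 0 * br₁ T X Q)) at this
      rw [hTx, hTu, (br1 X 0).1, br0, br2, br2, hdbr U p1 0, hdbr X p1 0] at this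
      linear_combination this
    have hS : (S1 - S0) * (dX X Q + q * dU X Q) ^ 2 = dU U Q - X0 * dU X Q := by
      have : dT T Q ^ 2 * ((S1 - S0) * (dX X Q + q * dU X Q) ^ 2 - (dU U Q - X0 * dU X Q)) = 0 := by
        linear_combination c1' - c0'
      have := (mul_eq_zero.1 this).resolve_left (pow_ne_zero _ hTt)
      linarith
    -- Multiplied by `X_x + q X_u`, this quantity is the `(x, u)` Jacobian of `(X, U)`, which is
    -- nonzero by `hJ`.
    have hκ : dU U Q - X0 * dU X Q ≠ 0 := by
      intro h
      apply hJ
      linear_combination dT T Q * (dX X Q + q * dU X Q) * h - dT T Q * dU X Q * (-b0)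
    have hT : (T1 - T0) * dT T Q = (p1 - p0) * (dU U Q - X0 * dU X Q) := by
      linear_combination a1 - a0
    unfold Elems.Jet at j0 j1
    have hj : θ'.f (X Q) * (T1 - T0) = Real.exp (θ'.n * U Q) * θ'.g (X Q) * (S1 - S0) := by
      linear_combination j1 - j0
    refine mul_right_cancel₀ hκ ?_
    linear_combination (-θ'.f (X Q) * (dX X Q + q * dU X Q) ^ 2 * (dU U Q - X0 * dU X Q)) * hp
      - θ'.f (X Q) * (dX X Q + q * dU X Q) ^ 2 * θ.f x₀ * hT
      + θ.f x₀ * dT T Q * (dX X Q + q * dU X Q) ^ 2 * hj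
      + θ.f x₀ * dT T Q * Real.exp (θ'.n * U Q) * θ'.g (X Q) * hS
  -- The right side of `main` is free of `q`. If `X_u ≠ 0`, some values of `q` give `X_x + q X_u =
  -- 1` and `2`, so a nonzero number would equal four times itself.
  have hXu : dU X Q = 0 := by
    by_contra hXu
    have h1 := main ((1 - dX X Q) / dU X Q) (by field_simp; simp)
    have h2 := main ((2 - dX X Q) / dU X Q) (by field_simp; simp)
    have e1 : dX X Q + (1 - dX X Q) / dU X Q * dU X Q = 1 := by field_simp; ring
    have e2 : dX X Q + (2 - dX X Q) / dU X Q * dU X Q = 2 := by field_simp; ring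
    rw [e1] at h1
    rw [e2] at h2
    have : θ'.f (X Q) * θ.g x₀ * Real.exp (θ.n * u₀) = 0 := by linarith
    exact mul_ne_zero (mul_ne_zero hf' hg0) (Real.exp_ne_zero _) this
  rw [hXu] at hJ main
  have h3 : dX X Q ≠ 0 ∧ dU U Q ≠ 0 := by
    constructor <;> (intro h; apply hJ; rw [h]; ring)
  refine ⟨hTt, h3.1, h3.2, hXu, ?_⟩
  have := main 0 (by simpa using h3.1)
  simpa using this

/-! ### Normal form of point transformations in the whole class. -/

/-- By the inverse function theorem `τ` maps open sets to open sets, and projections are open.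
Openness is what turns smoothness of the new elements on the interval into genuine derivatives at
its points. -/
lemma IsPointTransf.isOpen_newInterval {B : Set (ℝ × ℝ × ℝ)} {τ : ℝ × ℝ × ℝ → ℝ × ℝ × ℝ}
    (hB : IsOpen B) (hτ : IsPointTransf B τ) : IsOpen (newInterval B τ) := by
  have h1 : IsOpen (τ '' B) := by
    rw [isOpen_iff_mem_nhds]
    rintro _ ⟨q, hq, rfl⟩
    have hs : ContDiffAt ℝ ∞ τ q := hτ.1.contDiffAt (hB.mem_nhds hq)
    let e := (fderiv ℝ τ q).toContinuousLinearEquivOfDetNeZero (hτ.2 q hq)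
    have he : HasFDerivAt τ (e : ℝ × ℝ × ℝ →L[ℝ] ℝ × ℝ × ℝ) q := by
      have := (hs.differentiableAt (by simp)).hasFDerivAt
      simpa [e] using this
    rw [← (hs.hasStrictFDerivAt' he (by simp)).map_nhds_eq_of_equiv]
    exact image_mem_map (hB.mem_nhds hq)
  have h2 : newInterval B τ = Prod.fst '' (Prod.snd '' (τ '' B)) := by
    unfold newInterval
    rw [Set.image_image, Set.image_image]
  rw [h2]
  exact isOpenMap_fst _ (isOpenMap_snd _ h1)

lemma box_open {A J C : Set ℝ} (hA : IsOpen A) (hJ : IsOpen J) (hC : IsOpen C) :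
    IsOpen (box A J C) := hA.prod (hJ.prod hC)

lemma hasDerivAt_lines {K : ℝ × ℝ × ℝ → ℝ} {t x u : ℝ} (hK : DifferentiableAt ℝ K (t, x, u)) :
    HasDerivAt (fun s => K (s, x, u)) (dT K (t, x, u)) t ∧
    HasDerivAt (fun y => K (t, y, u)) (dX K (t, x, u)) x ∧
    HasDerivAt (fun v => K (t, x, v)) (dU K (t, x, u)) u := by
  refine ⟨?_, ?_, ?_⟩
  · exact hK.hasFDerivAt.comp_hasDerivAt t (f := fun s => (s, x, u))
      ((hasDerivAt_id t).prodMk ((hasDerivAt_const t x).prodMk (hasDerivAt_const t u)))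
  · exact hK.hasFDerivAt.comp_hasDerivAt x (f := fun y => (t, y, u))
      ((hasDerivAt_const x t).prodMk ((hasDerivAt_id x).prodMk (hasDerivAt_const x u)))
  · exact hK.hasFDerivAt.comp_hasDerivAt u (f := fun v => (t, x, v))
      ((hasDerivAt_const u t).prodMk ((hasDerivAt_const u x).prodMk (hasDerivAt_id u)))

lemma const_of_hasDerivAt_zero {S : Set ℝ} (hS : IsOpen S) (hS' : S.OrdConnected) {F : ℝ → ℝ}
    (h : ∀ x ∈ S, HasDerivAt F 0 x) {x y : ℝ} (hx : x ∈ S) (hy : y ∈ S) : F x = F y :=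
  hS.is_const_of_deriv_eq_zero hS'.isPreconnected
    (fun z hz => (h z hz).differentiableAt.differentiableWithinAt)
    (fun z hz => (h z hz).deriv) hx hy

lemma deriv_eq_of_eqOn {S : Set ℝ} (hS : IsOpen S) {F G : ℝ → ℝ} (h : Set.EqOn F G S) {x : ℝ}
    (hx : x ∈ S) : deriv F x = deriv G x :=
  (h.eventuallyEq_of_mem (hS.mem_nhds hx)).deriv_eq

/-- A point transformation between two equations of the class has the form
`(T(t), X(t, x), δ u + ψ(t, x))`. -/
theorem normal_form {A J C : Set ℝ}
    (hA : IsOpen A ∧ A.OrdConnected ∧ A.Nonempty)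
    (hJ : IsOpen J ∧ J.OrdConnected ∧ J.Nonempty)
    (hC : IsOpen C ∧ C.OrdConnected ∧ C.Nonempty)
    {τ : ℝ × ℝ × ℝ → ℝ × ℝ × ℝ} {θ θ' : Elems} (hτ : IsPointTransf (box A J C) τ)
    (hθ : θ ∈ wholeClass J) (hθ' : θ' ∈ wholeClass (newInterval (box A J C) τ))
    (hm : MapsEquation (box A J C) τ θ θ') :
    ∃ (T : ℝ → ℝ) (X ψ : ℝ → ℝ → ℝ),
      (∀ t ∈ A, ∀ x ∈ J, ∀ u ∈ C, τ (t, x, u) = (T t, X t x, θ.n / θ'.n * u + ψ t x)) ∧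
      (∀ t ∈ A, ContDiffAt ℝ ∞ T t ∧ deriv T t ≠ 0) ∧
      (∀ t ∈ A, ∀ x ∈ J, ContDiffAt ℝ ∞ (fun q : ℝ × ℝ => X q.1 q.2) (t, x) ∧
        ContDiffAt ℝ ∞ (fun q : ℝ × ℝ => ψ q.1 q.2) (t, x) ∧ deriv (X t) x ≠ 0 ∧
        ContDiffAt ℝ ∞ θ'.g (X t x) ∧ θ'.f (X t x) ≠ 0 ∧ θ'.g (X t x) ≠ 0 ∧
        θ'.f (X t x) * θ.g x * deriv (X t) x ^ 2
          = θ.f x * θ'.g (X t x) * Real.exp (θ'.n * ψ t x) * deriv T t) := by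
  have hBo : IsOpen (box A J C) := box_open hA.1 hJ.1 hC.1
  have hNo := hτ.isOpen_newInterval hBo
  obtain ⟨hf, hg, hh, hfg, hn⟩ := hθ
  obtain ⟨hf', hg', hh', hfg', hn'⟩ := hθ'
  have hτs : ∀ Q ∈ box A J C, ContDiffAt ℝ ∞ τ Q := fun Q hQ =>
    hτ.1.contDiffAt (hBo.mem_nhds hQ)
  have hN : ∀ Q ∈ box A J C, (τ Q).2.1 ∈ newInterval (box A J C) τ := fun Q hQ => ⟨Q, hQ, rfl⟩
  have hgs' : ∀ Q ∈ box A J C, ContDiffAt ℝ ∞ θ'.g (τ Q).2.1 := fun Q hQ =>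
    hg'.contDiffAt (hNo.mem_nhds (hN Q hQ))
  have hgs : ∀ x ∈ J, ContDiffAt ℝ ∞ θ.g x := fun x hx => hg.contDiffAt (hJ.1.mem_nhds hx)
  have hz : ∀ Q ∈ box A J C, dX (fun Q => (τ Q).1) Q = 0 ∧ dU (fun Q => (τ Q).1) Q = 0 := by
    rintro ⟨t, x, u⟩ hQ
    exact time_partial_zero hm hQ (hτs _ hQ) (hτ.2 _ hQ)
      ((hgs x hQ.2.1).differentiableAt (by simp))
      ((hgs' _ hQ).differentiableAt (by simp)) (hfg' _ (hN _ hQ)).2 (hfg x hQ.2.1).2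
  have lead := fun t x u (hQ : (t, x, u) ∈ box A J C) =>
    leading_coefficients hBo hm hz hQ (hτs _ hQ) (hτ.2 _ hQ)
      ((hgs x hQ.2.1).differentiableAt (by simp)) (hfg x hQ.2.1).1 (hfg x hQ.2.1).2
      ((hgs' _ hQ).differentiableAt (by simp)) (hfg' _ (hN _ hQ)).1
  simp only at lead
  have dTd : ∀ Q ∈ box A J C, DifferentiableAt ℝ (fun Q => (τ Q).1) Q := fun Q hQ =>
    (hτs Q hQ).fst.differentiableAt (by simp)
  have dXd : ∀ Q ∈ box A J C, DifferentiableAt ℝ (fun Q => (τ Q).2.1) Q := fun Q hQ =>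
    (hτs Q hQ).snd.fst.differentiableAt (by simp)
  obtain ⟨x₀, hx₀⟩ := hJ.2.2
  obtain ⟨u₀, hu₀⟩ := hC.2.2
  have cT : ∀ t ∈ A, ∀ x ∈ J, ∀ u ∈ C, (τ (t, x, u)).1 = (τ (t, x₀, u₀)).1 := by
    intro t ht x hx u hu
    have e1 : (τ (t, x, u)).1 = (τ (t, x₀, u)).1 :=
      const_of_hasDerivAt_zero hJ.1 hJ.2.1 (F := fun y => (τ (t, y, u)).1) (fun y hy => by
        have := (hasDerivAt_lines (dTd (t, y, u) ⟨ht, hy, hu⟩)).2.1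
        rwa [(hz (t, y, u) ⟨ht, hy, hu⟩).1] at this) hx hx₀
    have e2 : (τ (t, x₀, u)).1 = (τ (t, x₀, u₀)).1 :=
      const_of_hasDerivAt_zero hC.1 hC.2.1 (F := fun y => (τ (t, x₀, y)).1) (fun y hy => by
        have := (hasDerivAt_lines (dTd (t, x₀, y) ⟨ht, hx₀, hy⟩)).2.2
        rwa [(hz (t, x₀, y) ⟨ht, hx₀, hy⟩).2] at this) hu hu₀
    rw [e1, e2]
  have cX : ∀ t ∈ A, ∀ x ∈ J, ∀ u ∈ C, (τ (t, x, u)).2.1 = (τ (t, x, u₀)).2.1 := by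
    intro t ht x hx u hu
    exact const_of_hasDerivAt_zero hC.1 hC.2.1 (F := fun y => (τ (t, x, y)).2.1) (fun y hy => by
        have := (hasDerivAt_lines (dXd (t, x, y) ⟨ht, hx, hy⟩)).2.2
        rwa [(lead t x y ⟨ht, hx, hy⟩).2.2.2.1] at this) hu hu₀
  have eTt : ∀ t ∈ A, ∀ x ∈ J, ∀ u ∈ C,
      dT (fun Q => (τ Q).1) (t, x, u) = deriv (fun t => (τ (t, x₀, u₀)).1) t := by
    intro t ht x hx u hu
    rw [← (hasDerivAt_lines (dTd (t, x, u) ⟨ht, hx, hu⟩)).1.deriv]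
    exact deriv_eq_of_eqOn hA.1 (fun s hs => cT s hs x hx u hu) ht
  have eXx : ∀ t ∈ A, ∀ x ∈ J, ∀ u ∈ C,
      dX (fun Q => (τ Q).2.1) (t, x, u) = deriv (fun x => (τ (t, x, u₀)).2.1) x := by
    intro t ht x hx u hu
    rw [← (hasDerivAt_lines (dXd (t, x, u) ⟨ht, hx, hu⟩)).2.1.deriv]
    exact deriv_eq_of_eqOn hJ.1 (fun s hs => cX t ht s hs u hu) hx
  -- Between `u` and `u₀` the relation of `leading_coefficients` changes only through its
  -- exponentials, so `n u - ñ U` does not depend on `u`.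
  have cU : ∀ t ∈ A, ∀ x ∈ J, ∀ u ∈ C,
      (τ (t, x, u)).2.2 = θ.n / θ'.n * u + ((τ (t, x, u₀)).2.2 - θ.n / θ'.n * u₀) := by
    intro t ht x hx u hu
    obtain ⟨a1, a2, -, -, a3⟩ := lead t x u ⟨ht, hx, hu⟩
    obtain ⟨b1, b2, -, -, b3⟩ := lead t x u₀ ⟨ht, hx, hu₀⟩
    rw [eXx t ht x hx u hu, eTt t ht x hx u hu, cX t ht x hx u hu] at a3
    rw [eXx t ht x hx u₀ hu₀, eTt t ht x hx u₀ hu₀] at b3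
    rw [eXx t ht x hx u hu] at a2
    have hQ : (t, x, u₀) ∈ box A J C := ⟨ht, hx, hu₀⟩
    have h1 : θ'.f (τ (t, x, u₀)).2.1 * θ.g x * deriv (fun x => (τ (t, x, u₀)).2.1) x ^ 2 *
        (θ.f x * θ'.g (τ (t, x, u₀)).2.1 * deriv (fun t => (τ (t, x₀, u₀)).1) t) ≠ 0 := by
      rw [eTt t ht x hx u hu] at a1
      exact mul_ne_zero (mul_ne_zero (mul_ne_zero (hfg' _ (hN _ hQ)).1 (hfg x hx).2)
        (pow_ne_zero _ a2)) (mul_ne_zero (mul_ne_zero (hfg x hx).1 (hfg' _ (hN _ hQ)).2) a1)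
    have h2 : Real.exp (θ.n * u) * Real.exp (θ'.n * (τ (t, x, u₀)).2.2)
        = Real.exp (θ.n * u₀) * Real.exp (θ'.n * (τ (t, x, u)).2.2) := by
      refine mul_left_cancel₀ h1 ?_
      linear_combination (θ.f x * θ'.g (τ (t, x, u₀)).2.1 * deriv (fun t => (τ (t, x₀, u₀)).1) t
        * Real.exp (θ'.n * (τ (t, x, u₀)).2.2)) * a3
        - (θ.f x * θ'.g (τ (t, x, u₀)).2.1 * deriv (fun t => (τ (t, x₀, u₀)).1) t
        * Real.exp (θ'.n * (τ (t, x, u)).2.2)) * b3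
    rw [← Real.exp_add, ← Real.exp_add, Real.exp_eq_exp] at h2
    field_simp
    linear_combination -h2
  refine ⟨fun t => (τ (t, x₀, u₀)).1, fun t x => (τ (t, x, u₀)).2.1,
    fun t x => (τ (t, x, u₀)).2.2 - θ.n / θ'.n * u₀, ?_, ?_, ?_⟩
  · intro t ht x hx u hu
    exact Prod.ext (cT t ht x hx u hu) (Prod.ext (cX t ht x hx u hu) (cU t ht x hx u hu))
  · intro t ht
    refine ⟨?_, ?_⟩
    · exact ContDiffAt.comp t (f := fun s : ℝ => (s, x₀, u₀)) (hτs (t, x₀, u₀) ⟨ht, hx₀, hu₀⟩).fst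
        (contDiffAt_id.prodMk (contDiffAt_const.prodMk contDiffAt_const))
    · rw [← eTt t ht x₀ hx₀ u₀ hu₀]
      exact (lead t x₀ u₀ ⟨ht, hx₀, hu₀⟩).1
  · intro t ht x hx
    have hQ : (t, x, u₀) ∈ box A J C := ⟨ht, hx, hu₀⟩
    have hι : ContDiffAt ℝ ∞ (fun q : ℝ × ℝ => τ (q.1, q.2, u₀)) (t, x) :=
      ContDiffAt.comp (t, x) (f := fun q : ℝ × ℝ => (q.1, q.2, u₀)) (hτs (t, x, u₀) hQ)
        (contDiffAt_fst.prodMk (contDiffAt_snd.prodMk contDiffAt_const))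
    obtain ⟨-, a2, -, -, a3⟩ := lead t x u₀ hQ
    rw [eXx t ht x hx u₀ hu₀] at a2 a3
    rw [eTt t ht x hx u₀ hu₀] at a3
    refine ⟨hι.snd.fst, hι.snd.snd.sub contDiffAt_const, a2, hgs' _ hQ, (hfg' _ (hN _ hQ)).1,
      (hfg' _ (hN _ hQ)).2, ?_⟩
    have : Real.exp (θ'.n * ((τ (t, x, u₀)).2.2 - θ.n / θ'.n * u₀)) =
        Real.exp (θ'.n * (τ (t, x, u₀)).2.2) / Real.exp (θ.n * u₀) := by
      rw [← Real.exp_sub]; congr 1; field_simp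
    simp only at this ⊢
    rw [this]
    have he := Real.exp_ne_zero (θ.n * u₀)
    field_simp
    linear_combination a3

/-! ### Jets under the normal form and the classifying identity. -/

/-- Derivatives of `v` when `v(T(t), X(t, x)) = δ u + ψ(t, x)`. -/
lemma normal_jets {T : ℝ → ℝ} {X ψ u v : ℝ → ℝ → ℝ} {δ t x : ℝ} (hT : ContDiffAt ℝ ∞ T t)
    (hX : ContDiffAt ℝ ∞ (fun q : ℝ × ℝ => X q.1 q.2) (t, x))
    (hψ : ContDiffAt ℝ ∞ (fun q : ℝ × ℝ => ψ q.1 q.2) (t, x))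
    (hu : ContDiffAt ℝ ∞ (fun q : ℝ × ℝ => u q.1 q.2) (t, x))
    (hv : ContDiffAt ℝ ∞ (fun q : ℝ × ℝ => v q.1 q.2) (T t, X t x))
    (h : ∀ᶠ q : ℝ × ℝ in 𝓝 (t, x), v (T q.1) (X q.1 q.2) = δ * u q.1 q.2 + ψ q.1 q.2) :
    deriv (fun s => v s (X t x)) (T t) * deriv T t
        + deriv (v (T t)) (X t x) * deriv (fun s => X s x) t
      = δ * deriv (fun s => u s x) t + deriv (fun s => ψ s x) t ∧
    deriv (v (T t)) (X t x) * deriv (X t) x = δ * deriv (u t) x + deriv (ψ t) x ∧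
    deriv (deriv (v (T t))) (X t x) * deriv (X t) x ^ 2
        + deriv (v (T t)) (X t x) * deriv (deriv (X t)) x
      = δ * deriv (deriv (u t)) x + deriv (deriv (ψ t)) x := by
  obtain ⟨vt, vx, -, vsx, -⟩ := line_derivs hv
  obtain ⟨-, -, -, Xsx, Xst⟩ := line_derivs hX
  obtain ⟨-, -, -, ψsx, ψst⟩ := line_derivs hψ
  obtain ⟨-, -, -, usx, ust⟩ := line_derivs hu
  have lx : ContinuousAt (fun y : ℝ => (t, y)) x := (Continuous.prodMk_right t).continuousAt
  have lt : ContinuousAt (fun s : ℝ => (s, x)) t := (Continuous.prodMk_left x).continuousAt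
  constructor
  · have h1 : (fun s => v (T s) (X s x)) =ᶠ[𝓝 t] fun s => δ * u s x + ψ s x := lt.eventually h
    have h2 := ((hv.differentiableAt (by simp)).hasFDerivAt.comp_hasDerivAt t
      (f := fun s => (T s, X s x)) ((hT.differentiableAt (by simp)).hasDerivAt.prodMk
        (Xst.differentiableAt (by simp)).hasDerivAt))
    have h3 := ((ust.differentiableAt (by simp)).hasDerivAt.const_mul δ).add
      (ψst.differentiableAt (by simp)).hasDerivAt
    have := (h2.congr_of_eventuallyEq h1.symm).unique h3
    rw [fderiv_couple, ← vt, ← vx] at this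
    exact this
  · have h1 : ∀ᶠ y in 𝓝 x, v (T t) (X t y) = δ * u t y + ψ t y := lx.eventually h
    obtain ⟨a, b⟩ := chain_line (vsx.of_le (by norm_cast)) (Xsx.of_le (by norm_cast)) h1
    have usx2 : ContDiffAt ℝ 2 (u t) x := usx.of_le (by norm_cast)
    have ψsx2 : ContDiffAt ℝ 2 (ψ t) x := ψsx.of_le (by norm_cast)
    have d1 : deriv (fun y => δ * u t y + ψ t y) =ᶠ[𝓝 x] fun y => δ * deriv (u t) y + deriv (ψ t) y := by
      filter_upwards [usx2.eventually (by simp), ψsx2.eventually (by simp)] with y h1 h2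
      exact (((h1.differentiableAt (by simp)).hasDerivAt.const_mul δ).add
        (h2.differentiableAt (by simp)).hasDerivAt).deriv
    rw [d1.self_of_nhds] at a
    rw [d1.deriv_eq] at b
    refine ⟨a, b.trans ?_⟩
    exact ((((contDiffAt_deriv (m := 1) usx2 (by norm_num)).differentiableAt
      (by simp)).hasDerivAt.const_mul δ).add ((contDiffAt_deriv (m := 1) ψsx2
      (by norm_num)).differentiableAt (by simp)).hasDerivAt).deriv

/-- The transformation of jets under a transformation of the normal form. -/
lemma normal_form_jet {A J C : Set ℝ} (hA : IsOpen A) (hJ : IsOpen J) (hC : IsOpen C)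
    {τ : ℝ × ℝ × ℝ → ℝ × ℝ × ℝ} {θ θ' : Elems}
    (hτ : IsPointTransf (box A J C) τ) (hm : MapsEquation (box A J C) τ θ θ')
    {T : ℝ → ℝ} {X ψ : ℝ → ℝ → ℝ} {δ : ℝ}
    (hform : ∀ t ∈ A, ∀ x ∈ J, ∀ u ∈ C, τ (t, x, u) = (T t, X t x, δ * u + ψ t x))
    {t x u : ℝ} (ht : t ∈ A) (hx : x ∈ J) (hu : u ∈ C)
    (hT : ContDiffAt ℝ ∞ T t) (hT0 : deriv T t ≠ 0)
    (hX : ContDiffAt ℝ ∞ (fun q : ℝ × ℝ => X q.1 q.2) (t, x)) (hX0 : deriv (X t) x ≠ 0)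
    (hψ : ContDiffAt ℝ ∞ (fun q : ℝ × ℝ => ψ q.1 q.2) (t, x))
    (hg : DifferentiableAt ℝ θ.g x) (hg' : DifferentiableAt ℝ θ'.g (X t x)) (p q w : ℝ) :
    θ.Jet x u p q w ↔ θ'.Jet (X t x) (δ * u + ψ t x)
      ((δ * p + deriv (fun s => ψ s x) t
        - (δ * q + deriv (ψ t) x) / deriv (X t) x * deriv (fun s => X s x) t) / deriv T t)
      ((δ * q + deriv (ψ t) x) / deriv (X t) x)
      ((δ * w + deriv (deriv (ψ t)) x
        - (δ * q + deriv (ψ t) x) / deriv (X t) x * deriv (deriv (X t)) x) / deriv (X t) x ^ 2) := by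
  have hBo : IsOpen (box A J C) := box_open hA hJ hC
  have hQ : (t, x, u) ∈ box A J C := ⟨ht, hx, hu⟩
  set U := quad t x u p q w 0 with hU
  have hu0 : U t x = u := quad_self _ _ _ _ _ _ _
  have hUs := (contDiff_quad t x u p q w 0).contDiffAt (x := (t, x))
  have hgr : ∀ᶠ z : ℝ × ℝ in 𝓝 (t, x), (z.1, z.2, U z.1 z.2) ∈ box A J C := by
    have : ContinuousAt (fun z : ℝ × ℝ => (z.1, z.2, U z.1 z.2)) (t, x) :=
      continuousAt_fst.prodMk (continuousAt_snd.prodMk hUs.continuousAt)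
    refine this.eventually (p := fun z => z ∈ box A J C) (hBo.mem_nhds ?_)
    simp only [hu0]; exact hQ
  have hτs : ContDiffAt ℝ ∞ τ (t, x, U t x) := by
    rw [hu0]; exact hτ.1.contDiffAt (hBo.mem_nhds hQ)
  have hdet : (fderiv ℝ (fun q : ℝ × ℝ =>
      ((τ (q.1, q.2, U q.1 q.2)).1, (τ (q.1, q.2, U q.1 q.2)).2.1)) (t, x)).det ≠ 0 := by
    have e : (fun q : ℝ × ℝ => ((τ (q.1, q.2, U q.1 q.2)).1, (τ (q.1, q.2, U q.1 q.2)).2.1))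
        =ᶠ[𝓝 (t, x)] fun q => (T q.1, X q.1 q.2) := by
      filter_upwards [hgr] with z hz
      rw [hform _ hz.1 _ hz.2.1 _ hz.2.2]
    have h1 : HasFDerivAt (fun q : ℝ × ℝ => T q.1)
        (deriv T t • ContinuousLinearMap.fst ℝ ℝ ℝ) (t, x) :=
      (hT.differentiableAt (by simp)).hasDerivAt.comp_hasFDerivAt (t, x)
        (f := fun q : ℝ × ℝ => q.1) hasFDerivAt_fst
    rw [e.fderiv_eq, (h1.prodMk (hX.differentiableAt (by simp)).hasFDerivAt).fderiv, det_pair]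
    simp only [ContinuousLinearMap.prod_apply, smul_apply,
      ContinuousLinearMap.coe_fst', smul_eq_mul, mul_one, mul_zero, zero_mul, sub_zero,
      ← (line_derivs hX).2.1]
    exact mul_ne_zero hT0 hX0
  obtain ⟨v, hv, hev, hiff⟩ := exists_transform hm (u := U) (t := t) (x := x)
    (by rw [hu0]; exact hQ) hτs hUs hdet
  have e0 : τ (t, x, U t x) = (T t, X t x, δ * u + ψ t x) := by rw [hu0, hform t ht x hx u hu]
  have hev' : ∀ᶠ q : ℝ × ℝ in 𝓝 (t, x), v (T q.1) (X q.1 q.2) = δ * U q.1 q.2 + ψ q.1 q.2 := by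
    filter_upwards [hev, hgr] with z h1 h2
    rw [hform _ h2.1 _ h2.2.1 _ h2.2.2] at h1
    exact h1
  rw [e0] at hv hiff
  simp only at hv hiff
  obtain ⟨a, b, c⟩ := normal_jets hT hX hψ hUs hv hev'
  have hv0 : v (T t) (X t x) = δ * u + ψ t x := by
    have := hev'.self_of_nhds
    simpa only [hu0] using this
  obtain ⟨e1, e2, e3⟩ := quad_derivs t x u p q w 0
  rw [e1] at a
  rw [e2] at b
  rw [e3] at c
  rw [Elems.solvesAt_iff hg ((line_derivs hUs).2.2.2.1.of_le (by norm_cast)),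
    Elems.solvesAt_iff hg' ((line_derivs hv).2.2.2.1.of_le (by norm_cast)), quad_self, hv0,
    e1, e2, e3] at hiff
  have hb : deriv (v (T t)) (X t x) = (δ * q + deriv (ψ t) x) / deriv (X t) x := by
    rw [eq_div_iff hX0, b]
  rw [hb] at a c hiff
  have ha : deriv (fun s => v s (X t x)) (T t) = (δ * p + deriv (fun s => ψ s x) t
        - (δ * q + deriv (ψ t) x) / deriv (X t) x * deriv (fun s => X s x) t) / deriv T t := by
    rw [eq_div_iff hT0, ← a]; ring
  have hc : deriv (deriv (v (T t))) (X t x) = (δ * w + deriv (deriv (ψ t)) x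
        - (δ * q + deriv (ψ t) x) / deriv (X t) x * deriv (deriv (X t)) x) / deriv (X t) x ^ 2 := by
    rw [eq_div_iff (pow_ne_zero 2 hX0), ← c]; ring
  rw [ha, hc] at hiff
  exact hiff

lemma exists_pair {S : Set ℝ} (hS : IsOpen S) (hne : S.Nonempty) :
    ∃ a ∈ S, ∃ b ∈ S, a < b := by
  obtain ⟨a, ha⟩ := hne
  obtain ⟨ε, hε, hb⟩ := Metric.isOpen_iff.1 hS a ha
  refine ⟨a, ha, a + ε / 2, hb ?_, by linarith⟩
  rw [Metric.mem_ball, Real.dist_eq, add_sub_cancel_left, abs_of_pos (by linarith)]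
  linarith

/-- The classifying condition for a transformation of the normal form. -/
lemma balance {A J C : Set ℝ} (hA : IsOpen A) (hJ : IsOpen J) (hC : IsOpen C)
    {τ : ℝ × ℝ × ℝ → ℝ × ℝ × ℝ} {θ θ' : Elems}
    (hτ : IsPointTransf (box A J C) τ) (hm : MapsEquation (box A J C) τ θ θ')
    {T : ℝ → ℝ} {X ψ : ℝ → ℝ → ℝ} (hn' : θ'.n ≠ 0)
    (hform : ∀ t ∈ A, ∀ x ∈ J, ∀ u ∈ C, τ (t, x, u) = (T t, X t x, θ.n / θ'.n * u + ψ t x))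
    {t x u : ℝ} (ht : t ∈ A) (hx : x ∈ J) (hu : u ∈ C)
    (hT : ContDiffAt ℝ ∞ T t) (hT0 : deriv T t ≠ 0)
    (hX : ContDiffAt ℝ ∞ (fun q : ℝ × ℝ => X q.1 q.2) (t, x)) (hX0 : deriv (X t) x ≠ 0)
    (hψ : ContDiffAt ℝ ∞ (fun q : ℝ × ℝ => ψ q.1 q.2) (t, x)) (hf : θ.f x ≠ 0)
    (hg : DifferentiableAt ℝ θ.g x) (hg' : DifferentiableAt ℝ θ'.g (X t x)) (q : ℝ) :
    θ'.f (X t x) * (θ.n / θ'.n * (Real.exp (θ.n * u) * (deriv θ.g x * q + θ.n * θ.g x * q ^ 2)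
        + θ.h x * Real.exp (θ.m * u)) / θ.f x + deriv (fun s => ψ s x) t
        - (θ.n / θ'.n * q + deriv (ψ t) x) / deriv (X t) x * deriv (fun s => X s x) t) / deriv T t
      = Real.exp (θ.n * u) * Real.exp (θ'.n * ψ t x) *
        (deriv θ'.g (X t x) * ((θ.n / θ'.n * q + deriv (ψ t) x) / deriv (X t) x)
        + θ'.n * θ'.g (X t x) * ((θ.n / θ'.n * q + deriv (ψ t) x) / deriv (X t) x) ^ 2
        + θ'.g (X t x) * ((deriv (deriv (ψ t)) x
          - (θ.n / θ'.n * q + deriv (ψ t) x) / deriv (X t) x * deriv (deriv (X t)) x)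
            / deriv (X t) x ^ 2))
        + θ'.h (X t x) * Real.exp (θ'.m * (θ.n / θ'.n * u + ψ t x)) := by
  -- Taking `u_xx = 0` loses nothing, because the coefficients of `u_xx` are already matched by the
  -- last relation of `normal_form`.
  have h := (normal_form_jet hA hJ hC hτ hm hform ht hx hu hT hT0 hX hX0 hψ hg hg'
    (θ.solveT x u q 0) q 0).1 (Elems.jet_solveT hf _ _ _)
  unfold Elems.Jet Elems.solveT at h
  have he : Real.exp (θ'.n * (θ.n / θ'.n * u + ψ t x))
      = Real.exp (θ.n * u) * Real.exp (θ'.n * ψ t x) := by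
    rw [← Real.exp_add]; congr 1; field_simp
  rw [he] at h
  simp only [mul_zero, add_zero, zero_add] at h
  rw [← h]
  ring

/-! ### Point transformations inside the subclass `m = n`. -/

/-- Transformations between equations of the subclass `m = n`. -/
theorem subclass_form {A J C : Set ℝ}
    (hA : IsOpen A ∧ A.OrdConnected ∧ A.Nonempty)
    (hJ : IsOpen J ∧ J.OrdConnected ∧ J.Nonempty)
    (hC : IsOpen C ∧ C.OrdConnected ∧ C.Nonempty)
    {τ : ℝ × ℝ × ℝ → ℝ × ℝ × ℝ} {θ θ' : Elems} (hτ : IsPointTransf (box A J C) τ)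
    (hθ : θ ∈ subclassEq J) (hθ' : θ' ∈ subclassEq (newInterval (box A J C) τ))
    (hm : MapsEquation (box A J C) τ θ θ') :
    ∃ (δ₁ δ₂ : ℝ) (φ ψ : ℝ → ℝ), δ₁ ≠ 0 ∧
      (∀ t ∈ A, ∀ x ∈ J, ∀ u ∈ C,
        τ (t, x, u) = (δ₁ * t + δ₂, φ x, θ.n / θ'.n * u + ψ x)) ∧
      ∀ x ∈ J, ContDiffAt ℝ ∞ φ x ∧ ContDiffAt ℝ ∞ ψ x ∧ deriv φ x ≠ 0 ∧
        ContDiffAt ℝ ∞ θ'.g (φ x) ∧ θ'.g (φ x) ≠ 0 ∧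
        θ'.f (φ x) * θ.g x * deriv φ x ^ 2 = θ.f x * θ'.g (φ x) * Real.exp (θ'.n * ψ x) * δ₁ ∧
        ∀ q, θ'.f (φ x) * (θ.n / θ'.n * (deriv θ.g x * q + θ.n * θ.g x * q ^ 2
            + θ.h x) / θ.f x) / δ₁
          = Real.exp (θ'.n * ψ x) * (deriv θ'.g (φ x) * ((θ.n / θ'.n * q + deriv ψ x) / deriv φ x)
            + θ'.n * θ'.g (φ x) * ((θ.n / θ'.n * q + deriv ψ x) / deriv φ x) ^ 2
            + θ'.g (φ x) * ((deriv (deriv ψ) x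
              - (θ.n / θ'.n * q + deriv ψ x) / deriv φ x * deriv (deriv φ) x) / deriv φ x ^ 2)
            + θ'.h (φ x)) := by
  obtain ⟨hθ, hmn⟩ := hθ
  obtain ⟨hθ', hmn'⟩ := hθ'
  obtain ⟨T, X, ψ, hform, hT, hXψ⟩ := normal_form hA hJ hC hτ hθ hθ' hm
  have hn' : θ'.n ≠ 0 := hθ'.2.2.2.2
  have hn : θ.n ≠ 0 := hθ.2.2.2.2
  have hδ : θ.n / θ'.n ≠ 0 := div_ne_zero hn hn'
  have hgd : ∀ x ∈ J, DifferentiableAt ℝ θ.g x := fun x hx =>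
    (hθ.2.1.contDiffAt (hJ.1.mem_nhds hx)).differentiableAt (by simp)
  have bal : ∀ t ∈ A, ∀ x ∈ J, ∀ u ∈ C, ∀ q, _ := fun t ht x hx u hu q =>
    balance hA.1 hJ.1 hC.1 hτ hm hn' hform ht hx hu (hT t ht).1 (hT t ht).2 (hXψ t ht x hx).1
      (hXψ t ht x hx).2.2.1 (hXψ t ht x hx).2.1 (hθ.2.2.2.1 x hx).1 (hgd x hx)
      ((hXψ t ht x hx).2.2.2.1.differentiableAt (by simp)) q
  have hE : ∀ t x u, Real.exp (θ'.m * (θ.n / θ'.n * u + ψ t x))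
      = Real.exp (θ.n * u) * Real.exp (θ'.n * ψ t x) := by
    intro t x u
    rw [hmn', ← Real.exp_add]; congr 1; field_simp
  -- the coefficients not multiplied by the exponential vanish
  have free : ∀ t ∈ A, ∀ x ∈ J, ∀ q, deriv (fun s => ψ s x) t
        - (θ.n / θ'.n * q + deriv (ψ t) x) / deriv (X t) x * deriv (fun s => X s x) t = 0 := by
    intro t ht x hx q
    obtain ⟨a, ha, b, hb, hab⟩ := exists_pair hC.1 hC.2.2
    have h1 := bal t ht x hx a ha q
    have h2 := bal t ht x hx b hb q
    rw [hE, hmn] at h1 h2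
    have hf' := (hXψ t ht x hx).2.2.2.2.1
    have hT0 := (hT t ht).2
    have hne : Real.exp (θ.n * a) ≠ Real.exp (θ.n * b) := by
      rw [Ne, Real.exp_eq_exp]
      intro h; exact hab.ne (mul_left_cancel₀ hn h)
    -- Cross-multiplying by the exponentials at `a` and `b` cancels every term proportional to
    -- `e^{nu}`.
    have e : (Real.exp (θ.n * b) - Real.exp (θ.n * a)) * (θ'.f (X t x) *
        (deriv (fun s => ψ s x) t - (θ.n / θ'.n * q + deriv (ψ t) x) / deriv (X t) x *
          deriv (fun s => X s x) t) / deriv T t) = 0 := by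
      linear_combination Real.exp (θ.n * b) * h1 - Real.exp (θ.n * a) * h2
    have := (mul_eq_zero.1 e).resolve_left (sub_ne_zero.2 hne.symm)
    rw [div_eq_zero_iff, mul_eq_zero] at this
    tauto
  -- `free` is affine in `q` with slope a nonzero multiple of `X_t`, so the values `q = 0, 1`
  -- isolate `X_t`, and then `ψ_t`.
  have hXt : ∀ t ∈ A, ∀ x ∈ J, deriv (fun s => X s x) t = 0 := by
    intro t ht x hx
    have h1 := free t ht x hx 1
    have h0 := free t ht x hx 0
    have hX0 := (hXψ t ht x hx).2.2.1
    have : θ.n / θ'.n / deriv (X t) x * deriv (fun s => X s x) t = 0 := by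
      linear_combination h0 - h1
    exact (mul_eq_zero.1 this).resolve_left (div_ne_zero hδ hX0)
  have hψt : ∀ t ∈ A, ∀ x ∈ J, deriv (fun s => ψ s x) t = 0 := by
    intro t ht x hx
    have h0 := free t ht x hx 0
    rw [hXt t ht x hx] at h0
    linarith
  obtain ⟨t₀, ht₀⟩ := hA.2.2
  obtain ⟨x₀, hx₀⟩ := hJ.2.2
  have cX : ∀ t ∈ A, ∀ x ∈ J, X t x = X t₀ x := fun t ht x hx =>
    const_of_hasDerivAt_zero hA.1 hA.2.1 (F := fun s => X s x) (fun s hs => by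
      rw [← hXt s hs x hx]
      exact ((line_derivs (hXψ s hs x hx).1).2.2.2.2.differentiableAt (by simp)).hasDerivAt) ht ht₀
  have cψ : ∀ t ∈ A, ∀ x ∈ J, ψ t x = ψ t₀ x := fun t ht x hx =>
    const_of_hasDerivAt_zero hA.1 hA.2.1 (F := fun s => ψ s x) (fun s hs => by
      rw [← hψt s hs x hx]
      exact ((line_derivs (hXψ s hs x hx).2.1).2.2.2.2.differentiableAt
        (by simp)).hasDerivAt) ht ht₀
  -- In the relation between leading coefficients everything except `T_t` is now known to be
  -- independent of `t`.
  have cT : ∀ t ∈ A, deriv T t = deriv T t₀ := by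
    intro t ht
    obtain ⟨-, -, -, -, -, b0, b1⟩ := hXψ t ht x₀ hx₀
    obtain ⟨-, -, -, -, -, -, c1⟩ := hXψ t₀ ht₀ x₀ hx₀
    rw [cX t ht x₀ hx₀, cψ t ht x₀ hx₀,
      deriv_eq_of_eqOn hJ.1 (fun x hx => cX t ht x hx) hx₀] at b1
    rw [cX t ht x₀ hx₀] at b0
    refine mul_left_cancel₀ (mul_ne_zero (mul_ne_zero (hθ.2.2.2.1 x₀ hx₀).1 b0)
      (Real.exp_ne_zero (θ'.n * ψ t₀ x₀))) (b1.symm.trans c1)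
  have cT2 : ∀ t ∈ A, T t = deriv T t₀ * t + (T t₀ - deriv T t₀ * t₀) := by
    intro t ht
    have := const_of_hasDerivAt_zero hA.1 hA.2.1 (F := fun s => T s - deriv T t₀ * s)
      (fun s hs => by
        have := ((hT s hs).1.differentiableAt (by simp)).hasDerivAt.sub
          ((hasDerivAt_id s).const_mul (deriv T t₀))
        rw [cT s hs] at this
        exact this.congr_deriv (by simp)) ht ht₀
    linear_combination this
  refine ⟨deriv T t₀, T t₀ - deriv T t₀ * t₀, X t₀, ψ t₀, (hT t₀ ht₀).2, ?_, ?_⟩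
  · intro t ht x hx u hu
    rw [hform t ht x hx u hu, cX t ht x hx, cψ t ht x hx, cT2 t ht]
  · intro x hx
    obtain ⟨a1, a2, a3, a4, a5, a6, a7⟩ := hXψ t₀ ht₀ x hx
    refine ⟨(line_derivs a1).2.2.2.1, (line_derivs a2).2.2.2.1, a3, a4, a6, a7, fun q => ?_⟩
    obtain ⟨u, hu⟩ := hC.2.2
    have h1 := bal t₀ ht₀ x hx u hu q
    rw [hE, hmn, hXt t₀ ht₀ x hx, hψt t₀ ht₀ x hx] at h1
    refine mul_left_cancel₀ (Real.exp_ne_zero (θ.n * u)) ?_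
    linear_combination h1

lemma hasDerivAt_bigPsi {p : Param} {x : ℝ} (n : ℝ) (hψ : DifferentiableAt ℝ p.ψ x) :
    HasDerivAt (p.bigPsi n) (-(n / p.δ₃) * deriv p.ψ x * p.bigPsi n x) x := by
  have := (((hψ.hasDerivAt.const_mul n).div_const p.δ₃).neg).exp
  refine this.congr_deriv ?_
  simp only [Param.bigPsi, Pi.neg_apply]
  ring

/-- Since `Ψ_x` is a multiple of `ψ_x Ψ`, the factor `Ψ` can be pulled out. The result shows that
`g` enters the new `h` only through `g` and `g_x`. -/
lemma deriv_g_bigPsi {p : Param} {x : ℝ} (n : ℝ) {g : ℝ → ℝ} (hψ : ContDiffAt ℝ ∞ p.ψ x)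
    (hg : DifferentiableAt ℝ g x) :
    deriv (fun y => g y * deriv (p.bigPsi n) y) x = -(n / p.δ₃) * p.bigPsi n x *
      (deriv g x * deriv p.ψ x + g x * deriv (deriv p.ψ) x
        - n / p.δ₃ * g x * deriv p.ψ x ^ 2) := by
  have hψ2 : ContDiffAt ℝ 2 p.ψ x := hψ.of_le (by norm_cast)
  have e : (fun y => g y * deriv (p.bigPsi n) y) =ᶠ[𝓝 x]
      fun y => g y * (-(n / p.δ₃) * deriv p.ψ y * p.bigPsi n y) := by
    filter_upwards [hψ2.eventually (by simp)] with y hy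
    rw [(hasDerivAt_bigPsi n (hy.differentiableAt (by simp))).deriv]
  rw [e.deriv_eq]
  have hd : DifferentiableAt ℝ (deriv p.ψ) x :=
    (contDiffAt_deriv (m := 1) hψ2 (by norm_num)).differentiableAt (by simp)
  have := hg.hasDerivAt.mul ((hd.hasDerivAt.const_mul (-(n / p.δ₃))).mul
    (hasDerivAt_bigPsi n (hψ.differentiableAt (by simp))))
  refine this.deriv.trans ?_
  simp only [Pi.mul_apply]
  ring

/-- Each transformation between equations of the subclass belongs to the explicit family. -/
theorem subclass_param {A J C : Set ℝ}
    (hA : IsOpen A ∧ A.OrdConnected ∧ A.Nonempty)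
    (hJ : IsOpen J ∧ J.OrdConnected ∧ J.Nonempty)
    (hC : IsOpen C ∧ C.OrdConnected ∧ C.Nonempty)
    {τ : ℝ × ℝ × ℝ → ℝ × ℝ × ℝ} {θ θ' : Elems} (hτ : IsPointTransf (box A J C) τ)
    (hθ : θ ∈ subclassEq J) (hθ' : θ' ∈ subclassEq (newInterval (box A J C) τ))
    (hm : MapsEquation (box A J C) τ θ θ') :
    ∃ p : Param, p.Valid J ∧
      (∀ t ∈ A, ∀ x ∈ J, ∀ u ∈ C, τ (t, x, u) = (p.δ₁ * t + p.δ₂, p.φ x, p.δ₃ * u + p.ψ x)) ∧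
      (∀ x ∈ J,
        θ'.f (p.φ x) = p.δ₀ * p.δ₁ / deriv p.φ x * p.bigPsi θ.n x * θ.f x ∧
        θ'.g (p.φ x) = p.δ₀ * deriv p.φ x * p.bigPsi θ.n x ^ 2 * θ.g x ∧
        θ'.h (p.φ x) = p.δ₀ * p.δ₃ / (θ.n * deriv p.φ x) *
          (θ.n * θ.h x * p.bigPsi θ.n x
            + deriv (fun y => θ.g y * deriv (p.bigPsi θ.n) y) x) * p.bigPsi θ.n x) ∧
      θ'.n = θ.n / p.δ₃ ∧ θ'.m = θ'.n := by
  obtain ⟨δ₁, δ₂, φ, ψ, hδ₁, hform, H⟩ := subclass_form hA hJ hC hτ hθ hθ' hm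
  have hn' : θ'.n ≠ 0 := hθ'.1.2.2.2.2
  have hn : θ.n ≠ 0 := hθ.1.2.2.2.2
  have hδ : θ.n / θ'.n ≠ 0 := div_ne_zero hn hn'
  have hfg := hθ.1.2.2.2.1
  have hgd : ∀ x ∈ J, DifferentiableAt ℝ θ.g x := fun x hx =>
    (hθ.1.2.1.contDiffAt (hJ.1.mem_nhds hx)).differentiableAt (by simp)
  -- This is the part of the identity odd in `q`, taken from `q = 1` and `q = -1`, with the new `f`
  -- eliminated through the leading-coefficient relation.
  have lin : ∀ x ∈ J, deriv θ'.g (φ x) * deriv φ x * deriv φ x * θ.g x =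
      θ'.g (φ x) * (deriv φ x * deriv θ.g x - 2 * θ'.n * deriv ψ x * deriv φ x * θ.g x
        + deriv (deriv φ) x * θ.g x) := by
    intro x hx
    obtain ⟨-, -, a3, -, -, a6, a7⟩ := H x hx
    have hf := (hfg x hx).1
    have h1 := a7 1
    have h2 := a7 (-1)
    have hE := Real.exp_ne_zero (θ'.n * ψ x)
    generalize Real.exp (θ'.n * ψ x) = E at *
    generalize θ.n / θ'.n = δ at *
    have h3 : 2 * δ * (θ'.f (φ x) * deriv θ.g x / (θ.f x * δ₁)) = 2 * δ * (E *
        (deriv θ'.g (φ x) / deriv φ x + 2 * θ'.n * θ'.g (φ x) * deriv ψ x / deriv φ x ^ 2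
         - θ'.g (φ x) * deriv (deriv φ) x / deriv φ x ^ 3)) := by
      linear_combination h1 - h2
    have h4 := mul_left_cancel₀ (mul_ne_zero two_ne_zero hδ) h3
    have h5 : θ'.f (φ x) * deriv θ.g x * deriv φ x ^ 3 = E * θ.f x * δ₁ *
        (deriv θ'.g (φ x) * deriv φ x ^ 2 + 2 * θ'.n * θ'.g (φ x) * deriv ψ x * deriv φ x
         - θ'.g (φ x) * deriv (deriv φ) x) := by
      field_simp at h4
      linear_combination h4
    refine mul_left_cancel₀ (mul_ne_zero (mul_ne_zero hE hf) hδ₁) ?_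
    linear_combination -θ.g x * h5 + deriv θ.g x * deriv φ x * a6
  -- `D` is what the asserted formula for the new `g` gives when solved for `δ₀`. Up to a nonzero
  -- factor, `lin` says that its derivative is zero.
  set D : ℝ → ℝ := fun x => θ'.g (φ x) * Real.exp (θ'.n * ψ x) ^ 2 / (deriv φ x * θ.g x) with hD
  have hDc : ∀ x ∈ J, HasDerivAt D 0 x := by
    intro x hx
    obtain ⟨a1, a2, a3, a4, a5, a6, a7⟩ := H x hx
    have hg := (hfg x hx).2
    have d1 := (a4.differentiableAt (by simp)).hasDerivAt.comp x
      (a1.differentiableAt (by simp)).hasDerivAt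
    have d2 := ((a2.differentiableAt (by simp)).hasDerivAt.const_mul θ'.n).exp.pow 2
    have d3 : HasDerivAt (deriv φ) (deriv (deriv φ) x) x :=
      ((contDiffAt_deriv (m := 1) a1 (by norm_cast)).differentiableAt (by simp)).hasDerivAt
    have d4 := (hgd x hx).hasDerivAt
    have := (d1.mul d2).div (d3.mul d4) (mul_ne_zero a3 hg)
    refine this.congr_deriv ?_
    rw [div_eq_zero_iff]
    left
    simp only [Pi.mul_apply, Function.comp, Pi.pow_apply]
    have := lin x hx
    push_cast
    linear_combination Real.exp (θ'.n * ψ x) ^ 2 * this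
  obtain ⟨x₀, hx₀⟩ := hJ.2.2
  have hDe : ∀ x ∈ J, θ'.g (φ x) * Real.exp (θ'.n * ψ x) ^ 2 / (deriv φ x * θ.g x) = D x₀ :=
    fun x hx => const_of_hasDerivAt_zero hJ.1 hJ.2.1 hDc hx hx₀
  have hD0 : D x₀ ≠ 0 := by
    obtain ⟨a1, a2, a3, a4, a5, a6, a7⟩ := H x₀ hx₀
    exact div_ne_zero (mul_ne_zero a5 (pow_ne_zero _ (Real.exp_ne_zero _)))
      (mul_ne_zero a3 (hfg x₀ hx₀).2)
  set p : Param := ⟨D x₀, δ₁, δ₂, θ.n / θ'.n, φ, ψ⟩ with hp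
  have hk : θ.n / p.δ₃ = θ'.n := by rw [hp]; field_simp
  refine ⟨p, ⟨mul_ne_zero (mul_ne_zero hD0 hδ₁) hδ, fun x hx => (H x hx).1.contDiffWithinAt,
    fun x hx => (H x hx).2.1.contDiffWithinAt, fun x hx => (H x hx).2.2.1⟩, hform, ?_, hk.symm,
    hθ'.2⟩
  intro x hx
  obtain ⟨a1, a2, a3, a4, a5, a6, a7⟩ := H x hx
  obtain ⟨hf, hg⟩ := hfg x hx
  have hΨ : p.bigPsi θ.n x = (Real.exp (θ'.n * ψ x))⁻¹ := by
    rw [← Real.exp_neg]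
    unfold Param.bigPsi
    rw [← hk]; congr 1; ring
  rw [deriv_g_bigPsi θ.n a2 (hgd x hx), hΨ, hk]
  have hE := Real.exp_ne_zero (θ'.n * ψ x)
  have hl := lin x hx
  -- The part free of `q` is the only place where the new `h` remains to be found.
  have h0 := a7 0
  have hDx := hDe x hx
  change θ'.f (φ x) = D x₀ * δ₁ / deriv φ x * _ * _ ∧ θ'.g (φ x) = D x₀ * deriv φ x * _ * _ ∧
    θ'.h (φ x) = D x₀ * (θ.n / θ'.n) / (θ.n * deriv φ x) * (_ + _ * (_ * deriv ψ x +
      _ * deriv (deriv ψ) x - _ * deriv ψ x ^ 2)) * _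
  generalize Real.exp (θ'.n * ψ x) = E at *
  rw [← hDx]
  have hf' : θ'.f (φ x) = θ.f x * θ'.g (φ x) * E * δ₁ / (θ.g x * deriv φ x ^ 2) := by
    field_simp; linear_combination a6
  refine ⟨?_, ?_, ?_⟩
  · rw [hf']; field_simp
  · field_simp
  · have hgd' : deriv θ'.g (φ x) = θ'.g (φ x) * (deriv φ x * deriv θ.g x
      - 2 * θ'.n * deriv ψ x * deriv φ x * θ.g x + deriv (deriv φ) x * θ.g x)
        / (deriv φ x * deriv φ x * θ.g x) := by
      field_simp; linear_combination hl
    rw [hf', hgd'] at h0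
    have key : ∀ L S h : ℝ, L = E * (S + h) → h = L / E - S := by
      rintro L S h rfl
      field_simp
      ring
    rw [key _ _ _ h0]
    field_simp
    ring

/-! ### The explicit family consists of usual equivalence transformations. -/

lemma injOn_of_deriv_ne_zero {J : Set ℝ} (hJ' : J.OrdConnected) {φ : ℝ → ℝ}
    (hφ : ∀ x ∈ J, DifferentiableAt ℝ φ x) (h0 : ∀ x ∈ J, deriv φ x ≠ 0) : Set.InjOn φ J := by
  have key : ∀ x ∈ J, ∀ y ∈ J, x < y → φ x ≠ φ y := by
    intro x hx y hy hxy h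
    have hsub : Set.Icc x y ⊆ J := hJ'.out hx hy
    obtain ⟨c, hc, hc'⟩ := exists_deriv_eq_zero hxy
      (fun z hz => (hφ z (hsub hz)).continuousAt.continuousWithinAt) h
    exact h0 c (hsub (Set.Ioo_subset_Icc_self hc)) hc'
  intro x hx y hy h
  rcases lt_trichotomy x y with h' | h' | h'
  · exact absurd h (key x hx y hy h')
  · exact h'
  · exact absurd h.symm (key y hy x hx h')

/-- Injectivity on `J` forces the chosen inverse to coincide, near each point of the image, with the
smooth local inverse of the inverse function theorem. -/
lemma contDiffOn_invFunOn {J : Set ℝ} (hJ : IsOpen J) (hJ' : J.OrdConnected) {φ : ℝ → ℝ}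
    (hφ : ContDiffOn ℝ ∞ φ J) (h0 : ∀ x ∈ J, deriv φ x ≠ 0) :
    ContDiffOn ℝ ∞ (Function.invFunOn φ J) (φ '' J) := by
  have hs : ∀ x ∈ J, ContDiffAt ℝ ∞ φ x := fun x hx => hφ.contDiffAt (hJ.mem_nhds hx)
  have hinj := injOn_of_deriv_ne_zero hJ' (fun x hx => (hs x hx).differentiableAt (by simp)) h0
  rintro _ ⟨x, hx, rfl⟩
  have hd := ((hs x hx).differentiableAt (by simp)).hasDerivAt.hasFDerivAt_equiv (h0 x hx)
  have hN := (hs x hx).to_localInverse hd (by simp)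
  have hst := (hs x hx).hasStrictFDerivAt' hd (by simp)
  set N := (hs x hx).localInverse hd (by simp)
  have hl : N (φ x) = x := hst.localInverse_apply_image
  have hr : ∀ᶠ y in 𝓝 (φ x), φ (N y) = y := hst.eventually_right_inverse
  have hm : ∀ᶠ y in 𝓝 (φ x), N y ∈ J :=
    hN.continuousAt.eventually (p := fun z => z ∈ J) (by rw [hl]; exact hJ.mem_nhds hx)
  refine (hN.congr_of_eventuallyEq ?_).contDiffWithinAt
  filter_upwards [hr, hm] with y h1 h2
  have : y ∈ φ '' J := ⟨N y, h2, h1⟩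
  exact hinj (Function.invFunOn_mem this) h2 ((Function.invFunOn_eq this).trans h1.symm)

/-- New arbitrary element `f` as a function of the old `x`. -/
noncomputable def Param.newF (p : Param) (θ : Elems) (x : ℝ) : ℝ :=
  p.δ₀ * p.δ₁ / deriv p.φ x * p.bigPsi θ.n x * θ.f x
/-- New arbitrary element `g` as a function of the old `x`. -/
noncomputable def Param.newG (p : Param) (θ : Elems) (x : ℝ) : ℝ :=
  p.δ₀ * deriv p.φ x * p.bigPsi θ.n x ^ 2 * θ.g x
/-- New arbitrary element `h` as a function of the old `x`. -/
noncomputable def Param.newH (p : Param) (θ : Elems) (x : ℝ) : ℝ :=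
  p.δ₀ * p.δ₃ / (θ.n * deriv p.φ x) * (θ.n * θ.h x * p.bigPsi θ.n x
    + deriv (fun y => θ.g y * deriv (p.bigPsi θ.n) y) x) * p.bigPsi θ.n x

/-- The transformation with parameters `p` over the `x`-interval `J`. -/
noncomputable def Param.toTransf (p : Param) (J : Set ℝ) : Transf where
  domX _ := J
  tr _ q := (p.δ₁ * q.1 + p.δ₂, p.φ q.2.1, p.δ₃ * q.2.2 + p.ψ q.2.1)
  img θ :=
    -- Outside `φ '' J` the value of `invFunOn` is arbitrary, which is harmless because the new
    -- elements are considered only over that image.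
    { f := fun y => p.newF θ (Function.invFunOn p.φ J y)
      g := fun y => p.newG θ (Function.invFunOn p.φ J y)
      h := fun y => p.newH θ (Function.invFunOn p.φ J y)
      n := θ.n / p.δ₃
      m := θ.n / p.δ₃ }

section Family

variable {p : Param} {A J C : Set ℝ}

lemma Param.Valid.ne (hp : p.Valid J) : p.δ₀ ≠ 0 ∧ p.δ₁ ≠ 0 ∧ p.δ₃ ≠ 0 :=
  ⟨left_ne_zero_of_mul (left_ne_zero_of_mul hp.1), right_ne_zero_of_mul (left_ne_zero_of_mul hp.1),
    right_ne_zero_of_mul hp.1⟩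

lemma Param.Valid.smoothAt (hp : p.Valid J) (hJ : IsOpen J) {x : ℝ} (hx : x ∈ J) :
    ContDiffAt ℝ ∞ p.φ x ∧ ContDiffAt ℝ ∞ p.ψ x :=
  ⟨hp.2.1.contDiffAt (hJ.mem_nhds hx), hp.2.2.1.contDiffAt (hJ.mem_nhds hx)⟩

lemma Param.Valid.injOn (hp : p.Valid J) (hJ : IsOpen J) (hJ' : J.OrdConnected) :
    Set.InjOn p.φ J :=
  injOn_of_deriv_ne_zero hJ'
    (fun _ hx => (hp.smoothAt hJ hx).1.differentiableAt (by simp)) hp.2.2.2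

lemma Param.bigPsi_ne_zero (p : Param) (n x : ℝ) : p.bigPsi n x ≠ 0 := Real.exp_ne_zero _

lemma Param.Valid.img_apply (hp : p.Valid J) (hJ : IsOpen J) (hJ' : J.OrdConnected) (θ : Elems)
    {x : ℝ} (hx : x ∈ J) :
    ((p.toTransf J).img θ).f (p.φ x) = p.newF θ x ∧ ((p.toTransf J).img θ).g (p.φ x) = p.newG θ x ∧
      ((p.toTransf J).img θ).h (p.φ x) = p.newH θ x := by
  have : Function.invFunOn p.φ J (p.φ x) = x := (hp.injOn hJ hJ').leftInvOn_invFunOn hx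
  simp only [Param.toTransf, this, and_self]

lemma Param.toTransf_newX (hA : A.Nonempty) (hC : C.Nonempty) (θ : Elems) :
    (p.toTransf J).newX A C θ = p.φ '' J := by
  obtain ⟨a, ha⟩ := hA
  obtain ⟨c, hc⟩ := hC
  ext y
  constructor
  · rintro ⟨q, hq, rfl⟩
    exact ⟨q.2.1, hq.2.1, rfl⟩
  · rintro ⟨x, hx, rfl⟩
    exact ⟨(a, x, c), ⟨ha, hx, hc⟩, rfl⟩

lemma Param.Valid.point (hp : p.Valid J) (hA : IsOpen A) (hJ : IsOpen J) (hC : IsOpen C)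
    (θ : Elems) : IsPointTransf (box A J C) ((p.toTransf J).tr θ) := by
  have hs : ContDiffOn ℝ ∞ ((p.toTransf J).tr θ) (box A J C) := by
    have hm : Set.MapsTo (fun q : ℝ × ℝ × ℝ => q.2.1) (box A J C) J := fun q hq => hq.2.1
    have h1 : ContDiffOn ℝ ∞ (fun q : ℝ × ℝ × ℝ => q.2.1) (box A J C) := by fun_prop
    have hφ := hp.2.1.comp h1 hm
    have hψ := hp.2.2.1.comp h1 hm
    refine ContDiffOn.prodMk (by fun_prop) (hφ.prodMk (ContDiffOn.add (by fun_prop) hψ))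
  refine ⟨hs, ?_⟩
  rintro ⟨t, x, u⟩ hQ
  have hd : ContDiffAt ℝ ∞ ((p.toTransf J).tr θ) (t, x, u) :=
    hs.contDiffAt ((box_open hA hJ hC).mem_nhds hQ)
  obtain ⟨hφ, hψ⟩ := hp.smoothAt hJ hQ.2.1
  rw [det_eq_br (hd.differentiableAt (by simp))]
  obtain ⟨a1, a2, a3⟩ := hasDerivAt_lines (hd.fst.differentiableAt (by simp))
  obtain ⟨b1, b2, b3⟩ := hasDerivAt_lines (hd.snd.fst.differentiableAt (by simp))
  obtain ⟨-, -, c3⟩ := hasDerivAt_lines (hd.snd.snd.differentiableAt (by simp))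
  have a1' := a1.unique (((hasDerivAt_id t).const_mul p.δ₁).add_const p.δ₂)
  have a2' := a2.unique (hasDerivAt_const x (p.δ₁ * t + p.δ₂))
  have a3' := a3.unique (hasDerivAt_const u (p.δ₁ * t + p.δ₂))
  have b1' := b1.unique (hasDerivAt_const t (p.φ x))
  have b2' := b2.unique (hφ.differentiableAt (by simp)).hasDerivAt
  have b3' := b3.unique (hasDerivAt_const u (p.φ x))
  have c3' := c3.unique (((hasDerivAt_id u).const_mul p.δ₃).add_const (p.ψ x))
  simp only [br₀, br₁, br₂, a1', a2', a3', b1', b2', b3', c3']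
  have := mul_ne_zero hp.ne.2.2 (mul_ne_zero hp.ne.2.1 (hp.2.2.2 x hQ.2.1))
  refine fun h => this ?_
  linear_combination h

lemma Param.Valid.maps (hp : p.Valid J) (hJ : IsOpen J) (hJ' : J.OrdConnected)
    {θ : Elems} (hθ : θ ∈ subclassEq J)
    (hg' : ∀ x ∈ J, DifferentiableAt ℝ ((p.toTransf J).img θ).g (p.φ x)) :
    MapsEquation (box A J C) ((p.toTransf J).tr θ) θ ((p.toTransf J).img θ) := by
  intro u v t x hB hu _ hv hev
  have hx : x ∈ J := hB.2.1
  change ContDiffAt ℝ ∞ (fun q : ℝ × ℝ => v q.1 q.2) (p.δ₁ * t + p.δ₂, p.φ x) at hv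
  obtain ⟨hφ, hψ⟩ := hp.smoothAt hJ hx
  have hn : θ.n ≠ 0 := hθ.1.2.2.2.2
  obtain ⟨h0, h1, h3⟩ := hp.ne
  have hφ0 := hp.2.2.2 x hx
  have hg : ContDiffAt ℝ ∞ θ.g x := hθ.1.2.1.contDiffAt (hJ.mem_nhds hx)
  have hφ2 : ContDiffAt ℝ ∞ (fun q : ℝ × ℝ => p.φ q.2) (t, x) :=
    ContDiffAt.comp (t, x) (f := Prod.snd) hφ contDiffAt_snd
  have hψ2 : ContDiffAt ℝ ∞ (fun q : ℝ × ℝ => p.ψ q.2) (t, x) :=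
    ContDiffAt.comp (t, x) (f := Prod.snd) hψ contDiffAt_snd
  have hTd : ∀ s, HasDerivAt (fun s => p.δ₁ * s + p.δ₂) p.δ₁ s := fun s => by
    simpa using ((hasDerivAt_id s).const_mul p.δ₁).add_const p.δ₂
  obtain ⟨a, b, c⟩ := normal_jets (T := fun s => p.δ₁ * s + p.δ₂) (X := fun _ x => p.φ x)
    (ψ := fun _ x => p.ψ x) (δ := p.δ₃) (by fun_prop) hφ2 hψ2 hu hv hev
  have hv0 : v (p.δ₁ * t + p.δ₂) (p.φ x) = p.δ₃ * u t x + p.ψ x := hev.self_of_nhds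
  change θ.SolvesAt u t x ↔ ((p.toTransf J).img θ).SolvesAt v (p.δ₁ * t + p.δ₂) (p.φ x)
  rw [Elems.solvesAt_iff (hg.differentiableAt (by simp))
    ((line_derivs hu).2.2.2.1.of_le (by norm_cast)),
    Elems.solvesAt_iff (hg' x hx) ((line_derivs hv).2.2.2.1.of_le (by norm_cast)), hv0]
  obtain ⟨i1, i2, i3⟩ := hp.img_apply hJ hJ' θ hx
  rw [i1, i2, i3]
  -- derivative of the new `g`
  have hgd : deriv ((p.toTransf J).img θ).g (p.φ x) * deriv p.φ x =
      p.δ₀ * p.bigPsi θ.n x ^ 2 * (deriv (deriv p.φ) x * θ.g x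
        - 2 * (θ.n / p.δ₃) * deriv p.ψ x * deriv p.φ x * θ.g x + deriv p.φ x * deriv θ.g x) := by
    have e1 := (hg' x hx).hasDerivAt.comp x (hφ.differentiableAt (by simp)).hasDerivAt
    have e2 : (fun y => ((p.toTransf J).img θ).g (p.φ y)) =ᶠ[𝓝 x] p.newG θ := by
      filter_upwards [hJ.mem_nhds hx] with y hy using (hp.img_apply hJ hJ' θ hy).2.1
    have d3 : HasDerivAt (deriv p.φ) (deriv (deriv p.φ) x) x :=
      ((contDiffAt_deriv (m := 1) hφ (by norm_cast)).differentiableAt (by simp)).hasDerivAt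
    have e3 := ((d3.const_mul p.δ₀).mul ((hasDerivAt_bigPsi θ.n
      (hψ.differentiableAt (by simp))).pow 2)).mul (hg.differentiableAt (by simp)).hasDerivAt
    rw [(e1.congr_of_eventuallyEq e2.symm).unique e3]
    simp only [Pi.mul_apply, Pi.pow_apply]
    push_cast
    ring
  have hexp : Real.exp (((p.toTransf J).img θ).n * (p.δ₃ * u t x + p.ψ x)) =
      Real.exp (θ.n * u t x) / p.bigPsi θ.n x := by
    unfold Param.bigPsi
    rw [← Real.exp_sub]
    change Real.exp (θ.n / p.δ₃ * _) = _
    congr 1; field_simp; ring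
  have hmn : ((p.toTransf J).img θ).m = ((p.toTransf J).img θ).n := rfl
  rw [hmn, hexp, hθ.2]
  unfold Param.newF Param.newG Param.newH
  rw [deriv_g_bigPsi θ.n hψ (hg.differentiableAt (by simp))]
  have hnn : ((p.toTransf J).img θ).n = θ.n / p.δ₃ := rfl
  rw [hnn]
  simp only [(hTd t).deriv, deriv_const, mul_zero, add_zero] at a
  have hP := p.bigPsi_ne_zero θ.n x
  have ea : deriv (fun s => v s (p.φ x)) (p.δ₁ * t + p.δ₂)
      = p.δ₃ * deriv (fun s => u s x) t / p.δ₁ := by rw [eq_div_iff h1]; exact a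
  have eb : deriv (v (p.δ₁ * t + p.δ₂)) (p.φ x) = (p.δ₃ * deriv (u t) x + deriv p.ψ x) / deriv p.φ x := by
    rw [eq_div_iff hφ0]; exact b
  change deriv (deriv (v (p.δ₁ * t + p.δ₂))) (p.φ x) * deriv p.φ x ^ 2 +
    deriv (v (p.δ₁ * t + p.δ₂)) (p.φ x) * deriv (deriv p.φ) x =
    p.δ₃ * deriv (deriv (u t)) x + deriv (deriv p.ψ) x at c
  rw [eb] at c
  have ec : deriv (deriv (v (p.δ₁ * t + p.δ₂))) (p.φ x) =
      (p.δ₃ * deriv (deriv (u t)) x + deriv (deriv p.ψ) x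
        - (p.δ₃ * deriv (u t) x + deriv p.ψ x) / deriv p.φ x * deriv (deriv p.φ) x)
        / deriv p.φ x ^ 2 := by
    rw [eq_div_iff (pow_ne_zero 2 hφ0)]; linear_combination c
  have ed := (eq_div_iff hφ0).2 hgd
  rw [ea, eb, ec, ed]
  generalize p.bigPsi θ.n x = P at *
  rw [← sub_eq_zero, ← sub_eq_zero (b := _ + _ * (Real.exp (θ.n * u t x) / P))]
  -- The residual of the new equation is that of the old one times this nonzero factor.
  have hk : p.δ₀ * p.δ₃ * P / deriv p.φ x ≠ 0 :=
    div_ne_zero (mul_ne_zero (mul_ne_zero h0 h3) hP) hφ0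
  rw [← mul_eq_zero_iff_left hk]
  apply Eq.congr_left
  field_simp
  ring

end Family

section Family

variable {p : Param} {A J C : Set ℝ}

lemma Param.Valid.deriv_smooth (hp : p.Valid J) (hJ : IsOpen J) :
    ContDiffOn ℝ ∞ (deriv p.φ) J ∧ ContDiffOn ℝ ∞ (deriv p.ψ) J ∧
      ContDiffOn ℝ ∞ (deriv (deriv p.ψ)) J := by
  have h := hp.2.2.1.deriv_of_isOpen (m := ∞) hJ (by simp)
  exact ⟨hp.2.1.deriv_of_isOpen (m := ∞) hJ (by simp), h,
    h.deriv_of_isOpen (m := ∞) hJ (by simp)⟩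

lemma Param.Valid.family_smooth (hp : p.Valid J) (hJ : IsOpen J) {θ : ℝ → Elems}
    (hθ : ∀ ε, θ ε ∈ subclassEq J) (hs : SmoothFamily J θ) :
    ContDiffOn ℝ ∞ (fun z : ℝ × ℝ => p.newF (θ z.1) z.2) (Set.univ ×ˢ J) ∧
    ContDiffOn ℝ ∞ (fun z : ℝ × ℝ => p.newG (θ z.1) z.2) (Set.univ ×ˢ J) ∧
    ContDiffOn ℝ ∞ (fun z : ℝ × ℝ => p.newH (θ z.1) z.2) (Set.univ ×ˢ J) := by
  obtain ⟨hf, hg, hh, hn, -⟩ := hs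
  have hS : IsOpen ((Set.univ : Set ℝ) ×ˢ J) := isOpen_univ.prod hJ
  have h2 : ContDiffOn ℝ ∞ (fun z : ℝ × ℝ => z.2) ((Set.univ : Set ℝ) ×ˢ J) := by fun_prop
  have hm : Set.MapsTo (fun z : ℝ × ℝ => z.2) ((Set.univ : Set ℝ) ×ˢ J) J := fun z hz => hz.2
  obtain ⟨d1, d2, d3⟩ := hp.deriv_smooth hJ
  have e1 : ContDiffOn ℝ ∞ (fun z : ℝ × ℝ => deriv p.φ z.2) (Set.univ ×ˢ J) := d1.comp h2 hm
  have e2 : ContDiffOn ℝ ∞ (fun z : ℝ × ℝ => deriv p.ψ z.2) (Set.univ ×ˢ J) := d2.comp h2 hm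
  have e3 : ContDiffOn ℝ ∞ (fun z : ℝ × ℝ => deriv (deriv p.ψ) z.2) (Set.univ ×ˢ J) :=
    d3.comp h2 hm
  have e4 : ContDiffOn ℝ ∞ (fun z : ℝ × ℝ => p.ψ z.2) (Set.univ ×ˢ J) := hp.2.2.1.comp h2 hm
  have e5 : ContDiffOn ℝ ∞ (fun z : ℝ × ℝ => (θ z.1).n) (Set.univ ×ˢ J) :=
    hn.comp_contDiffOn contDiffOn_fst
  have e6 : ContDiffOn ℝ ∞ (fun z : ℝ × ℝ => p.bigPsi (θ z.1).n z.2) (Set.univ ×ˢ J) :=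
    (((e5.mul e4).div_const p.δ₃).neg).exp
  -- For fixed `ε` the derivative of `g` is a partial derivative of a jointly smooth function, hence
  -- jointly smooth in `ε` and `x`.
  have e7 : ContDiffOn ℝ ∞ (fun z : ℝ × ℝ => deriv (θ z.1).g z.2) (Set.univ ×ˢ J) := by
    have := (hg.fderiv_of_isOpen (m := ∞) hS (by simp)).clm_apply
      (contDiffOn_const (c := ((0 : ℝ), (1 : ℝ))))
    refine this.congr fun z hz => ?_
    exact (line_derivs (v := fun ε x => (θ ε).g x) (t := z.1) (x := z.2)
      (hg.contDiffAt (hS.mem_nhds hz))).2.1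
  have n1 : ∀ z ∈ (Set.univ : Set ℝ) ×ˢ J, deriv p.φ z.2 ≠ 0 := fun z hz => hp.2.2.2 _ hz.2
  have n2 : ∀ z ∈ (Set.univ : Set ℝ) ×ˢ J, (θ z.1).n * deriv p.φ z.2 ≠ 0 := fun z hz =>
    mul_ne_zero (hθ z.1).1.2.2.2.2 (n1 z hz)
  have hk := e5.div_const p.δ₃
  refine ⟨?_, ?_, ?_⟩
  · exact ((contDiffOn_const.div e1 n1).mul e6).mul hf
  · exact ((contDiffOn_const.mul e1).mul (e6.pow 2)).mul hg
  · have : ContDiffOn ℝ ∞ (fun z : ℝ × ℝ =>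
        p.δ₀ * p.δ₃ / ((θ z.1).n * deriv p.φ z.2) * ((θ z.1).n * (θ z.1).h z.2 * p.bigPsi (θ z.1).n z.2
          + (-((θ z.1).n / p.δ₃) * p.bigPsi (θ z.1).n z.2 *
      (deriv (θ z.1).g z.2 * deriv p.ψ z.2 + (θ z.1).g z.2 * deriv (deriv p.ψ) z.2
        - (θ z.1).n / p.δ₃ * (θ z.1).g z.2 * deriv p.ψ z.2 ^ 2))) * p.bigPsi (θ z.1).n z.2)
        (Set.univ ×ˢ J) :=
      ((contDiffOn_const.div (e5.mul e1) n2).mul (((e5.mul hh).mul e6).add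
        ((hk.neg.mul e6).mul (((e7.mul e2).add (hg.mul e3)).sub
          ((hk.mul hg).mul (e2.pow 2)))))).mul e6
    refine this.congr fun z hz => ?_
    have hgz : DifferentiableAt ℝ (θ z.1).g z.2 :=
      ((hθ z.1).1.2.1.contDiffAt (hJ.mem_nhds hz.2)).differentiableAt (by simp)
    rw [← deriv_g_bigPsi _ (hp.smoothAt hJ hz.2).2 hgz]
    rfl

lemma smoothFamily_const {θ : Elems} (hθ : θ ∈ wholeClass J) : SmoothFamily J fun _ => θ := by
  have h2 : ContDiffOn ℝ ∞ (fun z : ℝ × ℝ => z.2) ((Set.univ : Set ℝ) ×ˢ J) := by fun_prop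
  have hm : Set.MapsTo (fun z : ℝ × ℝ => z.2) ((Set.univ : Set ℝ) ×ˢ J) J := fun z hz => hz.2
  exact ⟨hθ.1.comp h2 hm, hθ.2.1.comp h2 hm, hθ.2.2.1.comp h2 hm, contDiff_const, contDiff_const⟩

lemma Param.Valid.new_smooth (hp : p.Valid J) (hJ : IsOpen J) {θ : Elems}
    (hθ : θ ∈ subclassEq J) :
    ContDiffOn ℝ ∞ (p.newF θ) J ∧ ContDiffOn ℝ ∞ (p.newG θ) J ∧ ContDiffOn ℝ ∞ (p.newH θ) J := by
  obtain ⟨a, b, c⟩ := hp.family_smooth hJ (fun _ => hθ) (smoothFamily_const hθ.1)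
  have h : ContDiffOn ℝ ∞ (fun x : ℝ => ((0 : ℝ), x)) J := by fun_prop
  have hm : Set.MapsTo (fun x : ℝ => ((0 : ℝ), x)) J ((Set.univ : Set ℝ) ×ˢ J) :=
    fun x hx => ⟨trivial, hx⟩
  exact ⟨a.comp h hm, b.comp h hm, c.comp h hm⟩

lemma Param.Valid.new_ne_zero (hp : p.Valid J) {θ : Elems} (hθ : θ ∈ subclassEq J) {x : ℝ}
    (hx : x ∈ J) : p.newF θ x ≠ 0 ∧ p.newG θ x ≠ 0 := by
  obtain ⟨h0, h1, -⟩ := hp.ne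
  obtain ⟨hf, hg⟩ := hθ.1.2.2.2.1 x hx
  exact ⟨mul_ne_zero (mul_ne_zero (div_ne_zero (mul_ne_zero h0 h1) (hp.2.2.2 x hx))
      (p.bigPsi_ne_zero _ _)) hf,
    mul_ne_zero (mul_ne_zero (mul_ne_zero h0 (hp.2.2.2 x hx))
      (pow_ne_zero _ (p.bigPsi_ne_zero _ _))) hg⟩

lemma Param.Valid.img_mem (hp : p.Valid J) (hJ : IsOpen J) (hJ' : J.OrdConnected) {θ : Elems}
    (hθ : θ ∈ subclassEq J) : (p.toTransf J).img θ ∈ subclassEq (p.φ '' J) := by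
  obtain ⟨a, b, c⟩ := hp.new_smooth hJ hθ
  have hι := contDiffOn_invFunOn hJ hJ' hp.2.1 hp.2.2.2
  have hm : Set.MapsTo (Function.invFunOn p.φ J) (p.φ '' J) J := fun y hy =>
    Function.invFunOn_mem hy
  exact ⟨⟨a.comp hι hm, b.comp hι hm, c.comp hι hm, fun y hy => hp.new_ne_zero hθ (hm hy),
    div_ne_zero hθ.1.2.2.2.2 hp.ne.2.2⟩, rfl⟩

lemma Param.Valid.isOpen_image (hp : p.Valid J) (hJ : IsOpen J) : IsOpen (p.φ '' J) := by
  rw [isOpen_iff_mem_nhds]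
  rintro _ ⟨x, hx, rfl⟩
  have hs := (hp.smoothAt hJ hx).1
  have hd := (hs.differentiableAt (by simp)).hasDerivAt.hasFDerivAt_equiv (hp.2.2.2 x hx)
  rw [← (hs.hasStrictFDerivAt' hd (by simp)).map_nhds_eq_of_equiv]
  exact image_mem_map (hJ.mem_nhds hx)

/-- The new elements are equal only if the old ones are. -/
lemma Param.Valid.new_inj (hp : p.Valid J) (hJ : IsOpen J) {θ₁ θ₂ : Elems}
    (hθ : θ₁ ∈ subclassEq J) (hn : θ₁.n = θ₂.n) (hf : Set.EqOn (p.newF θ₁) (p.newF θ₂) J)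
    (hg : Set.EqOn (p.newG θ₁) (p.newG θ₂) J) (hh : Set.EqOn (p.newH θ₁) (p.newH θ₂) J) :
    Set.EqOn θ₁.f θ₂.f J ∧ Set.EqOn θ₁.g θ₂.g J ∧ Set.EqOn θ₁.h θ₂.h J := by
  obtain ⟨h0, h1, h3⟩ := hp.ne
  have hg' : Set.EqOn θ₁.g θ₂.g J := fun x hx => by
    have := hg hx
    unfold Param.newG at this
    rw [← hn] at this
    exact mul_left_cancel₀ (mul_ne_zero (mul_ne_zero h0 (hp.2.2.2 x hx))
      (pow_ne_zero _ (p.bigPsi_ne_zero _ _))) this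
  refine ⟨fun x hx => ?_, hg', fun x hx => ?_⟩
  · have := hf hx
    unfold Param.newF at this
    rw [← hn] at this
    exact mul_left_cancel₀ (mul_ne_zero (div_ne_zero (mul_ne_zero h0 h1) (hp.2.2.2 x hx))
      (p.bigPsi_ne_zero _ _)) this
  · have := hh hx
    unfold Param.newH at this
    have e : deriv (fun y => θ₁.g y * deriv (p.bigPsi θ₁.n) y) x
        = deriv (fun y => θ₂.g y * deriv (p.bigPsi θ₁.n) y) x :=
      deriv_eq_of_eqOn hJ (fun y hy => by simp only [hg' hy]) hx
    rw [← hn, e] at this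
    have hn0 := hθ.1.2.2.2.2
    have := add_right_cancel (mul_left_cancel₀ (div_ne_zero (mul_ne_zero h0 h3)
      (mul_ne_zero hn0 (hp.2.2.2 x hx))) (mul_right_cancel₀ (p.bigPsi_ne_zero _ _) this))
    exact mul_left_cancel₀ hn0 (mul_right_cancel₀ (p.bigPsi_ne_zero _ _) this)

/-- Every equation of the subclass over the new interval is the image of one over `J`. -/
lemma Param.Valid.exists_preimage (hp : p.Valid J) (hJ : IsOpen J) (hJ' : J.OrdConnected)
    {θ' : Elems} (hθ' : θ' ∈ subclassEq (p.φ '' J)) :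
    ∃ θ₀ ∈ subclassEq J, ((p.toTransf J).img θ₀).Agree (p.φ '' J) θ' := by
  obtain ⟨h0, h1, h3⟩ := hp.ne
  obtain ⟨⟨hf, hg, hh, hfg, hn⟩, hmn⟩ := hθ'
  obtain ⟨d1, d2, d3⟩ := hp.deriv_smooth hJ
  -- The formulas are inverted in the order in which they can be solved. `n₀` comes first because it
  -- enters `Ψ`, and `g₀` precedes `h₀`, whose formula contains its derivative.
  set n₀ := p.δ₃ * θ'.n with hn₀
  have hn₀0 : n₀ ≠ 0 := mul_ne_zero h3 hn
  have hΨ : ContDiffOn ℝ ∞ (p.bigPsi n₀) J :=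
    (((contDiffOn_const.mul hp.2.2.1).div_const p.δ₃).neg).exp
  have hm : Set.MapsTo p.φ J (p.φ '' J) := Set.mapsTo_image _ _
  set f₀ : ℝ → ℝ := fun x => θ'.f (p.φ x) / (p.δ₀ * p.δ₁ / deriv p.φ x * p.bigPsi n₀ x) with hf₀
  set g₀ : ℝ → ℝ := fun x => θ'.g (p.φ x) / (p.δ₀ * deriv p.φ x * p.bigPsi n₀ x ^ 2) with hg₀
  set h₀ : ℝ → ℝ := fun x => (θ'.h (p.φ x) / (p.δ₀ * p.δ₃ / (n₀ * deriv p.φ x) * p.bigPsi n₀ x)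
    - deriv (fun y => g₀ y * deriv (p.bigPsi n₀) y) x) / (n₀ * p.bigPsi n₀ x) with hh₀
  have n1 : ∀ x ∈ J, p.δ₀ * p.δ₁ / deriv p.φ x * p.bigPsi n₀ x ≠ 0 := fun x hx =>
    mul_ne_zero (div_ne_zero (mul_ne_zero h0 h1) (hp.2.2.2 x hx)) (p.bigPsi_ne_zero _ _)
  have n2 : ∀ x ∈ J, p.δ₀ * deriv p.φ x * p.bigPsi n₀ x ^ 2 ≠ 0 := fun x hx =>
    mul_ne_zero (mul_ne_zero h0 (hp.2.2.2 x hx)) (pow_ne_zero _ (p.bigPsi_ne_zero _ _))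
  have n3 : ∀ x ∈ J, p.δ₀ * p.δ₃ / (n₀ * deriv p.φ x) * p.bigPsi n₀ x ≠ 0 := fun x hx =>
    mul_ne_zero (div_ne_zero (mul_ne_zero h0 h3) (mul_ne_zero hn₀0 (hp.2.2.2 x hx)))
      (p.bigPsi_ne_zero _ _)
  have n4 : ∀ x ∈ J, n₀ * p.bigPsi n₀ x ≠ 0 := fun x hx =>
    mul_ne_zero hn₀0 (p.bigPsi_ne_zero _ _)
  have sg : ContDiffOn ℝ ∞ g₀ J :=
    (hg.comp hp.2.1 hm).div ((contDiffOn_const.mul d1).mul (hΨ.pow 2)) n2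
  refine ⟨⟨f₀, g₀, h₀, n₀, n₀⟩, ⟨⟨?_, sg, ?_, fun x hx => ?_, hn₀0⟩, rfl⟩, ?_⟩
  · exact (hf.comp hp.2.1 hm).div ((contDiffOn_const.div d1 hp.2.2.2).mul hΨ) n1
  · refine (((hh.comp hp.2.1 hm).div ((contDiffOn_const.div (contDiffOn_const.mul d1)
      (fun x hx => mul_ne_zero hn₀0 (hp.2.2.2 x hx))).mul hΨ) n3).sub ?_).div
      (contDiffOn_const.mul hΨ) n4
    exact (sg.mul (hΨ.deriv_of_isOpen (m := ∞) hJ (by simp))).deriv_of_isOpen (m := ∞) hJ (by simp)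
  · exact ⟨div_ne_zero (hfg _ (hm hx)).1 (n1 x hx), div_ne_zero (hfg _ (hm hx)).2 (n2 x hx)⟩
  · have e : n₀ / p.δ₃ = θ'.n := by rw [hn₀]; field_simp
    refine ⟨e, e.trans hmn.symm, ?_, ?_, ?_⟩
    · rintro _ ⟨x, hx, rfl⟩
      rw [(hp.img_apply hJ hJ' _ hx).1]
      exact mul_div_cancel₀ _ (n1 x hx)
    · rintro _ ⟨x, hx, rfl⟩
      rw [(hp.img_apply hJ hJ' _ hx).2.1]
      exact mul_div_cancel₀ _ (n2 x hx)
    · rintro _ ⟨x, hx, rfl⟩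
      rw [(hp.img_apply hJ hJ' _ hx).2.2]
      change p.δ₀ * p.δ₃ / (n₀ * deriv p.φ x) * (n₀ * h₀ x * p.bigPsi n₀ x
        + deriv (fun y => g₀ y * deriv (p.bigPsi n₀) y) x) * p.bigPsi n₀ x = _
      have hP := p.bigPsi_ne_zero n₀ x
      have hφ0 := hp.2.2.2 x hx
      simp only [hh₀]
      field_simp
      ring

lemma Param.Valid.dependsSmoothly (hp : p.Valid J) (hA : IsOpen A) (hJ : IsOpen J)
    (hJ' : J.OrdConnected) (hC : IsOpen C) :
    DependsSmoothly subclassEq A J C (p.toTransf J) := by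
  intro θ hθ hs
  have hset : {z : ℝ × ℝ × ℝ × ℝ | z.2 ∈ (p.toTransf J).dom A C (θ z.1)}
      = Prod.snd ⁻¹' box A J C := rfl
  rw [hset]
  obtain ⟨a, b, c⟩ := hp.family_smooth hJ hθ hs
  have hm : Set.MapsTo (fun z : ℝ × ℝ × ℝ × ℝ => (z.1, z.2.2.1)) (Prod.snd ⁻¹' box A J C)
      ((Set.univ : Set ℝ) ×ˢ J) := fun z hz => ⟨trivial, hz.2.1⟩
  have hk : ContDiffOn ℝ ∞ (fun z : ℝ × ℝ × ℝ × ℝ => (z.1, z.2.2.1))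
      (Prod.snd ⁻¹' box A J C) := by fun_prop
  refine ⟨(box_open hA hJ hC).preimage continuous_snd, ?_, ?_, ?_, ?_,
    hs.2.2.2.1.div_const _, hs.2.2.2.1.div_const _⟩
  · exact (hp.point hA hJ hC (θ 0)).1.comp contDiffOn_snd fun z hz => hz
  · exact (a.comp hk hm).congr fun z hz => (hp.img_apply hJ hJ' (θ z.1) hz.2.1).1
  · exact (b.comp hk hm).congr fun z hz => (hp.img_apply hJ hJ' (θ z.1) hz.2.1).2.1
  · exact (c.comp hk hm).congr fun z hz => (hp.img_apply hJ hJ' (θ z.1) hz.2.1).2.2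

lemma Param.new_congr {θ₁ θ₂ : Elems} (hJ : IsOpen J) (h : θ₁.Agree J θ₂) {x : ℝ} (hx : x ∈ J) :
    p.newF θ₁ x = p.newF θ₂ x ∧ p.newG θ₁ x = p.newG θ₂ x ∧ p.newH θ₁ x = p.newH θ₂ x := by
  obtain ⟨hn, -, hf, hg, hh⟩ := h
  have e : deriv (fun y => θ₁.g y * deriv (p.bigPsi θ₂.n) y) x
        = deriv (fun y => θ₂.g y * deriv (p.bigPsi θ₂.n) y) x :=
      deriv_eq_of_eqOn hJ (fun y hy => by simp only [hg hy]) hx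
  unfold Param.newF Param.newG Param.newH
  rw [hn, hf hx, hg hx, hh hx, e]
  exact ⟨rfl, rfl, rfl⟩

/-- The members of the explicit family are usual equivalence transformations of the subclass. -/
theorem Param.Valid.isUsualEquiv (hp : p.Valid J) (hA : IsOpen A ∧ A.OrdConnected ∧ A.Nonempty)
    (hJ : IsOpen J ∧ J.OrdConnected ∧ J.Nonempty) (hC : IsOpen C ∧ C.OrdConnected ∧ C.Nonempty) :
    IsUsualEquiv subclassEq A J C (p.toTransf J) := by
  have hX : ∀ θ, (p.toTransf J).newX A C θ = p.φ '' J := Param.toTransf_newX hA.2.2 hC.2.2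
  have hmem : ∀ θ ∈ subclassEq J, (p.toTransf J).img θ ∈ subclassEq (p.φ '' J) := fun θ hθ =>
    hp.img_mem hJ.1 hJ.2.1 hθ
  refine
    { interval := fun θ _ => ⟨hJ.1, hJ.2.1, hJ.2.2, subset_rfl⟩
      point := fun θ _ => hp.point hA.1 hJ.1 hC.1 θ
      mem := fun θ hθ => by rw [hX]; exact hmem θ hθ
      maps := fun θ hθ => hp.maps hJ.1 hJ.2.1 hθ fun x hx =>
        ((hmem θ hθ).1.2.1.contDiffAt ((hp.isOpen_image hJ.1).mem_nhds
          ⟨x, hx, rfl⟩)).differentiableAt (by simp)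
      congr := fun θ₁ _ θ₂ _ h => ⟨rfl, fun _ _ => rfl, ?_⟩
      inj := fun θ₁ h₁ θ₂ h₂ _ h => ⟨rfl, ?_⟩
      smooth := hp.dependsSmoothly hA.1 hJ.1 hJ.2.1 hC.1
      full := fun _ _ => rfl
      indep := fun _ _ _ _ _ _ => rfl
      -- First-order jets suffice, since the only derivative of an arbitrary element in the formulas
      -- is `g_x`, in the new `h`.
      loc := ⟨1, fun θ₁ h₁ θ₂ h₂ q hq hn hm hf hg hh => ?_⟩
      surj := fun θ _ θ' hθ' => ?_ }
  · rw [hX]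
    refine ⟨by simp only [Param.toTransf, h.1], by simp only [Param.toTransf, h.1], ?_, ?_, ?_⟩ <;>
    · rintro _ ⟨x, hx, rfl⟩
      obtain ⟨a, b, c⟩ := hp.img_apply hJ.1 hJ.2.1 θ₁ hx
      obtain ⟨a', b', c'⟩ := hp.img_apply hJ.1 hJ.2.1 θ₂ hx
      obtain ⟨k1, k2, k3⟩ := Param.new_congr (p := p) hJ.1 h hx
      simp only [a, b, c, a', b', c', k1, k2, k3]
  · rw [hX] at h
    obtain ⟨hn, -, hf, hg, hh⟩ := h
    have hn' : θ₁.n = θ₂.n := (div_left_inj' hp.ne.2.2).1 hn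
    obtain ⟨k1, k2, k3⟩ := hp.new_inj hJ.1 h₁ hn'
      (fun x hx => by
        rw [← (hp.img_apply hJ.1 hJ.2.1 θ₁ hx).1, ← (hp.img_apply hJ.1 hJ.2.1 θ₂ hx).1]
        exact hf ⟨x, hx, rfl⟩)
      (fun x hx => by
        rw [← (hp.img_apply hJ.1 hJ.2.1 θ₁ hx).2.1, ← (hp.img_apply hJ.1 hJ.2.1 θ₂ hx).2.1]
        exact hg ⟨x, hx, rfl⟩)
      (fun x hx => by
        rw [← (hp.img_apply hJ.1 hJ.2.1 θ₁ hx).2.2, ← (hp.img_apply hJ.1 hJ.2.1 θ₂ hx).2.2]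
        exact hh ⟨x, hx, rfl⟩)
    exact ⟨hn', by rw [h₁.2, h₂.2, hn'], k1, k2, k3⟩
  · obtain ⟨t, x, u⟩ := q
    have hx : x ∈ J := hq.2.1
    obtain ⟨a, b, c⟩ := hp.img_apply hJ.1 hJ.2.1 θ₁ hx
    obtain ⟨a', b', c'⟩ := hp.img_apply hJ.1 hJ.2.1 θ₂ hx
    have f0 : θ₁.f x = θ₂.f x := by simpa using hf 0 (by norm_num)
    have g0 : θ₁.g x = θ₂.g x := by simpa using hg 0 (by norm_num)
    have h0 : θ₁.h x = θ₂.h x := by simpa using hh 0 (by norm_num)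
    have g1 : deriv θ₁.g x = deriv θ₂.g x := by simpa using hg 1 le_rfl
    have e : deriv (fun y => θ₁.g y * deriv (p.bigPsi θ₂.n) y) x
        = deriv (fun y => θ₂.g y * deriv (p.bigPsi θ₂.n) y) x := by
      rw [deriv_g_bigPsi _ (hp.smoothAt hJ.1 hx).2
          ((h₁.1.2.1.contDiffAt (hJ.1.mem_nhds hx)).differentiableAt (by simp)),
        deriv_g_bigPsi _ (hp.smoothAt hJ.1 hx).2
          ((h₂.1.2.1.contDiffAt (hJ.1.mem_nhds hx)).differentiableAt (by simp)), g0, g1]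
    change ((p.toTransf J).img θ₁).f (p.φ x) = ((p.toTransf J).img θ₂).f (p.φ x) ∧
      ((p.toTransf J).img θ₁).g (p.φ x) = ((p.toTransf J).img θ₂).g (p.φ x) ∧
      ((p.toTransf J).img θ₁).h (p.φ x) = ((p.toTransf J).img θ₂).h (p.φ x) ∧ _
    rw [a, b, c, a', b', c']
    refine ⟨?_, ?_, ?_, ?_, ?_⟩
    · unfold Param.newF; rw [hn, f0]
    · unfold Param.newG; rw [hn, g0]
    · unfold Param.newH; rw [hn, h0, e]
    · simp only [Param.toTransf, hn]
    · simp only [Param.toTransf, hn]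
  · rw [hX] at hθ' ⊢
    exact hp.exists_preimage hJ.1 hJ.2.1 hθ'

lemma Param.Valid.acts (hp : p.Valid J) (hJ : IsOpen J) (hJ' : J.OrdConnected) (θ : Elems) :
    p.Acts A J C (p.toTransf J) θ :=
  ⟨fun _ _ _ _ _ _ => rfl, fun _ hx => hp.img_apply hJ hJ' θ hx, rfl, rfl⟩

end Family

/-! ### Nontriviality of the conditional equivalence group. -/

/-- The explicit `0` keeps the shape of the relation, so that the differentiation can be iterated.
-/
lemma exp_relation_deriv {S : Set ℝ} (hS : IsOpen S) {a b c d m k : ℝ}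
    (h : ∀ u ∈ S, a * Real.exp (m * u) + b + c * Real.exp u + d * Real.exp (k * u) = 0) :
    ∀ u ∈ S, m * a * Real.exp (m * u) + 0 + c * Real.exp u + k * d * Real.exp (k * u) = 0 := by
  intro u hu
  have e : ∀ r : ℝ, HasDerivAt (fun u => Real.exp (r * u)) (r * Real.exp (r * u)) u := fun r => by
    have := ((hasDerivAt_id u).const_mul r).exp
    refine this.congr_deriv ?_
    simp; ring
  have h1 := ((((e m).const_mul a).add_const b).add ((Real.hasDerivAt_exp u).const_mul c)).add
    ((e k).const_mul d)
  have h2 : (fun u => a * Real.exp (m * u) + b + c * Real.exp u + d * Real.exp (k * u))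
      =ᶠ[𝓝 u] fun _ => 0 := by
    filter_upwards [hS.mem_nhds hu] with y hy using h y hy
  have h3 := (h1.congr_of_eventuallyEq h2.symm).unique (hasDerivAt_const u (0 : ℝ))
  linear_combination h3

/-- The exponent `k` is unknown and may coincide with any of the others. Since `a ≠ 0`, the term in
`e^{mu}` can only be cancelled by the last one, which forces `k = m` and leaves nothing to cancel `c
e^u`. -/
lemma exp_relation {S : Set ℝ} (hS : IsOpen S) (hne : S.Nonempty) {a b c d m k : ℝ} (hm : 1 < m)
    (ha : a ≠ 0)
    (h : ∀ u ∈ S, a * Real.exp (m * u) + b + c * Real.exp u + d * Real.exp (k * u) = 0) :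
    c = 0 := by
  obtain ⟨u, hu⟩ := hne
  have s1 := exp_relation_deriv hS h
  have s2 := exp_relation_deriv hS s1
  have s3 := exp_relation_deriv hS s2
  have e1 := s1 u hu
  have e2 := s2 u hu
  have e3 := s3 u hu
  have hA : a * Real.exp (m * u) ≠ 0 := mul_ne_zero ha (Real.exp_ne_zero _)
  have hk : m = k := by
    -- Applying `(∂ - 1)(∂ - k)` to the once differentiated relation removes the terms with `c` and
    -- `d`.
    have : m * (m - 1) * (m - k) * (a * Real.exp (m * u)) = 0 := by
      linear_combination e3 - e2 - k * (e2 - e1)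
    have := (mul_eq_zero.1 this).resolve_right hA
    have := (mul_eq_zero.1 this).resolve_left (mul_ne_zero (by linarith) (by linarith))
    linarith
  subst hk
  have : (1 - m) * (c * Real.exp u) = 0 := by linear_combination e2 - m * e1
  have := (mul_eq_zero.1 this).resolve_left (by linarith)
  exact (mul_eq_zero.1 this).resolve_right (Real.exp_ne_zero _)

/-- The equation `u_t = (e^u u_x)_x + e^{m u}`. -/
def powerElems (m : ℝ) : Elems := ⟨fun _ => 1, fun _ => 1, fun _ => 1, 1, m⟩

lemma powerElems_mem (J : Set ℝ) (m : ℝ) : powerElems m ∈ wholeClass J :=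
  ⟨contDiffOn_const, contDiffOn_const, contDiffOn_const,
    fun _ _ => ⟨one_ne_zero, one_ne_zero⟩, one_ne_zero⟩

/-- For `m > 1`, the function `e^{-ψ/δ}` of an admissible transformation of
`u_t = (e^u u_x)_x + e^{m u}` is affine in `x`. -/
lemma powerElems_affine {A J C : Set ℝ}
    (hA : IsOpen A ∧ A.OrdConnected ∧ A.Nonempty)
    (hJ : IsOpen J ∧ J.OrdConnected ∧ J.Nonempty)
    (hC : IsOpen C ∧ C.OrdConnected ∧ C.Nonempty)
    {τ : ℝ × ℝ × ℝ → ℝ × ℝ × ℝ} {m : ℝ} (hm1 : 1 < m) {θ' : Elems}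
    (hτ : IsPointTransf (box A J C) τ)
    (hθ' : θ' ∈ wholeClass (newInterval (box A J C) τ))
    (hm : MapsEquation (box A J C) τ (powerElems m) θ') {t u₀ u₁ x d : ℝ} (ht : t ∈ A)
    (hu₀ : u₀ ∈ C) (hu₁ : u₁ ∈ C) (hu : u₀ ≠ u₁) (hx : x ∈ J) (hx₁ : x - d ∈ J)
    (hx₂ : x + d ∈ J) :
    let S := fun x => Real.exp (u₀ - (τ (t, x, u₀)).2.2 * (u₁ - u₀) /
      ((τ (t, x, u₁)).2.2 - (τ (t, x, u₀)).2.2))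
    S (x - d) + S (x + d) = 2 * S x := by
  intro S
  obtain ⟨T, X, ψ, hform, hT, hXψ⟩ := normal_form hA hJ hC hτ (powerElems_mem J m) hθ' hm
  have hn' : θ'.n ≠ 0 := hθ'.2.2.2.2
  -- Two values of `u` recover the slope `1 / ñ` from `τ` alone, so `S` is `e^{-ñψ}` written without
  -- the new arbitrary elements.
  have hS : ∀ x ∈ J, S x = Real.exp (-(θ'.n * ψ t x)) := by
    intro x hx
    simp only [S]
    rw [hform t ht x hx u₀ hu₀, hform t ht x hx u₁ hu₁]
    congr 1
    have : u₁ - u₀ ≠ 0 := sub_ne_zero.2 hu.symm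
    have e : (powerElems m).n / θ'.n * u₁ + ψ t x - ((powerElems m).n / θ'.n * u₀ + ψ t x)
        = (u₁ - u₀) / θ'.n := by simp only [powerElems]; ring
    simp only [e]
    simp only [powerElems]
    field_simp
    ring
  have hψ2 : ∀ x ∈ J, deriv (deriv (ψ t)) x = θ'.n * deriv (ψ t) x ^ 2 := by
    intro x hx
    obtain ⟨a1, a2, a3, a4, a5, a6, a7⟩ := hXψ t ht x hx
    obtain ⟨-, hT0⟩ := hT t ht
    have bal : ∀ u ∈ C, ∀ q, _ := fun u hu q =>
      balance hA.1 hJ.1 hC.1 hτ hm hn' hform ht hx hu (hT t ht).1 (hT t ht).2 a1 a3 a2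
        (one_ne_zero) (differentiableAt_const _) (a4.differentiableAt (by simp)) q
    simp only [powerElems, deriv_const, zero_mul, zero_add, one_mul, mul_one, div_one] at bal a7
    have hE := Real.exp_ne_zero (θ'.n * ψ t x)
    -- Here `X_t` need not vanish. The difference between `q = 1` and `q = -1` leaves the part odd
    -- in `q`, and subtracting its values at `u₀` and `u₁` removes the term with `X_t`.
    have L : deriv θ'.g (X t x) * deriv (X t) x ^ 2 +
        2 * θ'.n * θ'.g (X t x) * deriv (ψ t) x * deriv (X t) x
        - θ'.g (X t x) * deriv (deriv (X t)) x = 0 := by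
      have b1 := bal u₀ hu₀ 1
      have b2 := bal u₀ hu₀ (-1)
      have b3 := bal u₁ hu₁ 1
      have b4 := bal u₁ hu₁ (-1)
      have e : (Real.exp u₀ - Real.exp u₁) * (Real.exp (θ'.n * ψ t x) * (2 / θ'.n) *
          ((deriv θ'.g (X t x) * deriv (X t) x ^ 2 +
        2 * θ'.n * θ'.g (X t x) * deriv (ψ t) x * deriv (X t) x
        - θ'.g (X t x) * deriv (deriv (X t)) x) / deriv (X t) x ^ 3)) = 0 := by
        have e1 : deriv θ'.g (X t x) / deriv (X t) x
            = deriv θ'.g (X t x) * deriv (X t) x ^ 2 / deriv (X t) x ^ 3 := by field_simp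
        have e2 : θ'.g (X t x) * deriv (ψ t) x / deriv (X t) x ^ 2
            = θ'.g (X t x) * deriv (ψ t) x * deriv (X t) x / deriv (X t) x ^ 3 := by field_simp
        linear_combination -b1 + b2 + b3 - b4
          - (Real.exp u₀ - Real.exp u₁) * Real.exp (θ'.n * ψ t x) * (2 / θ'.n) * e1
          - (Real.exp u₀ - Real.exp u₁) * Real.exp (θ'.n * ψ t x) * (2 / θ'.n) * 2 * θ'.n * e2
      have e' := (mul_eq_zero.1 e).resolve_left (sub_ne_zero.2 (Real.exp_injective.ne hu))
      have e'' := (mul_eq_zero.1 e').resolve_left (mul_ne_zero hE (div_ne_zero two_ne_zero hn'))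
      exact (div_eq_zero_iff.1 e'').resolve_right (pow_ne_zero 3 a3)
    -- At `q = 0` the identity is a relation between exponentials of `u` with a nonzero coefficient
    -- at `e^{mu}`. The vanishing coefficient of `e^u` gives `ψ_xx = ñ ψ_x²`, that is, `(e^{-ñψ})_xx
    -- = 0`.
    have hc := exp_relation hC.1 hC.2.2 (m := m) (k := θ'.m / θ'.n)
      (a := θ'.f (X t x) / θ'.n / deriv T t)
      (b := θ'.f (X t x) * (deriv (fun s => ψ s x) t
        - deriv (ψ t) x / deriv (X t) x * deriv (fun s => X s x) t) / deriv T t)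
      (c := -(Real.exp (θ'.n * ψ t x) * (θ'.g (X t x) / deriv (X t) x ^ 2 *
        (deriv (deriv (ψ t)) x - θ'.n * deriv (ψ t) x ^ 2))))
      (d := -(θ'.h (X t x) * Real.exp (θ'.m * ψ t x))) hm1
      (div_ne_zero (div_ne_zero a5 hn') hT0) (by
        intro u hu
        have b := bal u hu 0
        have ee : Real.exp (θ'.m * (1 / θ'.n * u + ψ t x)) =
            Real.exp (θ'.m * ψ t x) * Real.exp (θ'.m / θ'.n * u) := by
          rw [← Real.exp_add]; congr 1; ring
        rw [ee] at b
        have hg' : deriv θ'.g (X t x) = (θ'.g (X t x) * deriv (deriv (X t)) x -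
            2 * θ'.n * θ'.g (X t x) * deriv (ψ t) x * deriv (X t) x) / deriv (X t) x ^ 2 := by
          rw [eq_div_iff (pow_ne_zero 2 a3)]; linear_combination L
        rw [hg'] at b
        have e3 : deriv (X t) x / deriv (X t) x = 1 := div_self a3
        linear_combination b - 2 * θ'.n * θ'.g (X t x) * deriv (ψ t) x ^ 2 / deriv (X t) x ^ 2
          * Real.exp u * Real.exp (θ'.n * ψ t x) * e3)
    have := neg_eq_zero.1 hc
    have := (mul_eq_zero.1 this).resolve_left hE
    have := (mul_eq_zero.1 this).resolve_left (div_ne_zero a6 (pow_ne_zero 2 a3))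
    linarith
  have hd1 : ∀ x ∈ J, HasDerivAt (fun x => Real.exp (-(θ'.n * ψ t x)))
      (-θ'.n * deriv (ψ t) x * Real.exp (-(θ'.n * ψ t x))) x := by
    intro x hx
    have hs := (line_derivs (hXψ t ht x hx).2.1).2.2.2.1
    refine (((hs.differentiableAt (by simp)).hasDerivAt.const_mul θ'.n).neg).exp.congr_deriv ?_
    simp only [Pi.neg_apply]
    ring
  have hd2 : ∀ x ∈ J, HasDerivAt (fun x => -θ'.n * deriv (ψ t) x * Real.exp (-(θ'.n * ψ t x)))
      0 x := by
    intro x hx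
    have hs := (line_derivs (hXψ t ht x hx).2.1).2.2.2.1
    have := ((((contDiffAt_deriv (m := 1) hs (by norm_cast)).differentiableAt
      (by simp)).hasDerivAt.const_mul (-θ'.n))).mul (hd1 x hx)
    refine this.congr_deriv ?_
    rw [hψ2 x hx]
    ring
  set κ := -θ'.n * deriv (ψ t) x * Real.exp (-(θ'.n * ψ t x)) with hκ
  have hcst : ∀ y ∈ J, -θ'.n * deriv (ψ t) y * Real.exp (-(θ'.n * ψ t y)) = κ := fun y hy =>
    const_of_hasDerivAt_zero hJ.1 hJ.2.1 hd2 hy hx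
  have hlin : ∀ y ∈ J, Real.exp (-(θ'.n * ψ t y)) - κ * y = Real.exp (-(θ'.n * ψ t x)) - κ * x :=
    fun y hy => const_of_hasDerivAt_zero hJ.1 hJ.2.1
      (F := fun y => Real.exp (-(θ'.n * ψ t y)) - κ * y) (fun z hz => by
        have := (hd1 z hz).sub ((hasDerivAt_id z).const_mul κ)
        rw [hcst z hz] at this
        exact this.congr_deriv (by simp)) hy hx
  rw [hS _ hx₁, hS _ hx₂, hS _ hx]
  linear_combination hlin _ hx₁ + hlin _ hx₂

theorem nontrivialConditional {A J C : Set ℝ}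
    (hA : IsOpen A ∧ A.OrdConnected ∧ A.Nonempty)
    (hJ : IsOpen J ∧ J.OrdConnected ∧ J.Nonempty)
    (hC : IsOpen C ∧ C.OrdConnected ∧ C.Nonempty) :
    NontrivialConditional subclassEq wholeClass A J C := by
  refine ⟨fun I θ hθ => hθ.1, ?_⟩
  -- This is `t̃ = t`, `x̃ = x`, `ũ = u + x`.
  set p : Param := ⟨1, 1, 0, 1, fun x => x, fun x => x⟩ with hpdef
  have hp : p.Valid J := ⟨by norm_num [p], contDiffOn_id, contDiffOn_id, fun x _ => by
    simp [p]⟩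
  refine ⟨p.toTransf J, hp.isUsualEquiv hA hJ hC, ?_⟩
  rintro ⟨Φ₀, hΦ, hres⟩
  -- The family meets the subclass at `ε = 0` only. The square makes `m > 1` on both sides while
  -- keeping `m` smooth in `ε`.
  set θ : ℝ → Elems := fun ε => powerElems (1 + ε ^ 2) with hθ
  have hmem : ∀ ε, θ ε ∈ wholeClass J := fun ε => powerElems_mem J _
  have hsub : θ 0 ∈ subclassEq J := ⟨hmem 0, by simp [θ, powerElems]⟩
  obtain ⟨hop, hsm, -⟩ := hΦ.smooth θ hmem ⟨contDiffOn_const, contDiffOn_const, contDiffOn_const,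
    contDiff_const, by simp only [θ, powerElems]; fun_prop⟩
  obtain ⟨i1, i2, i3, -⟩ := hΦ.interval (θ 0) (hmem 0)
  obtain ⟨t, ht⟩ := hA.2.2
  obtain ⟨u₀, hu₀, u₁, hu₁, hu⟩ := exists_pair hC.1 hC.2.2
  obtain ⟨a, ha, b, hb, hab⟩ := exists_pair i1 i3
  set x := (a + b) / 2 with hx
  set d := (b - a) / 2 with hd
  have hd0 : 0 < d := by rw [hd]; linarith
  have hxd1 : x - d = a := by rw [hx, hd]; ring
  have hxd2 : x + d = b := by rw [hx, hd]; ring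
  have hxm : x ∈ Φ₀.domX (θ 0) := i2.out ha hb ⟨by rw [hx]; linarith, by rw [hx]; linarith⟩
  -- The interval `domX (θ ε)` may vary with `ε`. Openness of the joint domain keeps each fixed `y`
  -- inside it for small `ε`.
  have near : ∀ y ∈ Φ₀.domX (θ 0), ∀ u ∈ C,
      (∀ᶠ ε in 𝓝 (0 : ℝ), y ∈ Φ₀.domX (θ ε)) ∧
      ContinuousAt (fun ε => (Φ₀.tr (θ ε) (t, y, u)).2.2) 0 ∧
      (Φ₀.tr (θ 0) (t, y, u)).2.2 = u + y := by
    intro y hy u hu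
    have hc : ContinuousAt (fun ε : ℝ => (ε, t, y, u)) 0 := by fun_prop
    have h0 : ((0 : ℝ), t, y, u) ∈ {z : ℝ × ℝ × ℝ × ℝ | z.2 ∈ Φ₀.dom A C (θ z.1)} := ⟨ht, hy, hu⟩
    refine ⟨?_, ?_, ?_⟩
    · filter_upwards [hc.eventually (p := fun z => z ∈ {z : ℝ × ℝ × ℝ × ℝ |
        z.2 ∈ Φ₀.dom A C (θ z.1)}) (hop.mem_nhds h0)] with ε hε using hε.2.1
    · have := (hsm.contDiffAt (hop.mem_nhds h0)).continuousAt
      exact (ContinuousAt.comp (f := fun ε : ℝ => (ε, t, y, u)) this hc).snd.snd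
    · rw [hres (θ 0) hsub ⟨ht, hy, hu⟩]
      simp [Param.toTransf, p]
  set S : ℝ → ℝ → ℝ := fun ε y => Real.exp (u₀ - (Φ₀.tr (θ ε) (t, y, u₀)).2.2 * (u₁ - u₀) /
      ((Φ₀.tr (θ ε) (t, y, u₁)).2.2 - (Φ₀.tr (θ ε) (t, y, u₀)).2.2)) with hS
  have hS0 : ∀ y ∈ Φ₀.domX (θ 0), S 0 y = Real.exp (-y) := by
    intro y hy
    simp only [hS, (near y hy u₀ hu₀).2.2, (near y hy u₁ hu₁).2.2]
    congr 1
    have : u₁ - u₀ ≠ 0 := by linarith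
    have e : u₁ + y - (u₀ + y) = u₁ - u₀ := by ring
    rw [e]
    field_simp
    ring
  have hSc : ∀ y ∈ Φ₀.domX (θ 0), ContinuousAt (fun ε => S ε y) 0 := by
    intro y hy
    have k0 := (near y hy u₀ hu₀).2
    have k1 := (near y hy u₁ hu₁).2
    refine ContinuousAt.rexp (continuousAt_const.sub ((k0.1.mul continuousAt_const).div
      (k1.1.sub k0.1) ?_))
    rw [k0.2, k1.2]
    have : u₁ - u₀ ≠ 0 := by linarith
    intro h; apply this; linarith
  have hev : ∀ᶠ ε in 𝓝[≠] (0 : ℝ), S ε a + S ε b - 2 * S ε x = 0 := by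
    filter_upwards [nhdsWithin_le_nhds (near a ha u₀ hu₀).1,
      nhdsWithin_le_nhds (near b hb u₀ hu₀).1, nhdsWithin_le_nhds (near x hxm u₀ hu₀).1,
      self_mem_nhdsWithin] with ε e1 e2 e3 e4
    obtain ⟨j1, j2, j3, -⟩ := hΦ.interval (θ ε) (hmem ε)
    have hpos : (1 : ℝ) < 1 + ε ^ 2 := by
      have hε : ε ≠ 0 := e4
      have : 0 < ε ^ 2 := by positivity
      linarith
    have := powerElems_affine hA ⟨j1, j2, j3⟩ hC hpos (hΦ.point _ (hmem ε)) (hΦ.mem _ (hmem ε))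
      (hΦ.maps _ (hmem ε)) ht hu₀ hu₁ hu.ne e3 (hxd1.symm ▸ e1) (hxd2.symm ▸ e2)
    simp only [hxd1, hxd2] at this
    simp only [hS]
    linarith
  -- The second difference of `S ε` is continuous at `ε = 0` and vanishes for small `ε ≠ 0`, so it
  -- vanishes at `0` too.
  have hlim := ((hSc a ha).add (hSc b hb)).sub ((hSc x hxm).const_mul 2)
  have h0 : S 0 a + S 0 b - 2 * S 0 x = 0 :=
    tendsto_nhds_unique (hlim.tendsto.mono_left nhdsWithin_le_nhds)
      ((tendsto_const_nhds (x := (0 : ℝ))).congr' (hev.mono fun ε h => h.symm))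
  rw [hS0 a ha, hS0 b hb, hS0 x hxm, ← hxd1, ← hxd2] at h0
  have e1 : Real.exp (-(x - d)) = Real.exp (-x) * Real.exp d := by
    rw [← Real.exp_add]; congr 1; ring
  have e2 : Real.exp (-(x + d)) = Real.exp (-x) * Real.exp (-d) := by
    rw [← Real.exp_add]; congr 1; ring
  have e3 : Real.exp d * Real.exp (-d) = 1 := by rw [← Real.exp_add]; simp
  rw [e1, e2] at h0
  have e4 : Real.exp d + Real.exp (-d) - 2 = 0 := by
    refine mul_left_cancel₀ (Real.exp_ne_zero (-x)) ?_
    linear_combination h0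
  -- Multiplied by `e^d`, the equality `e^d + e^{-d} = 2` becomes a vanishing square, which
  -- contradicts `d > 0`.
  have e5 : (Real.exp d - 1) ^ 2 = 0 := by
    linear_combination Real.exp d * e4 - e3
  have e6 : Real.exp d = 1 := by
    have := pow_eq_zero_iff (two_ne_zero) |>.1 e5
    linarith
  exact hd0.ne' (Real.exp_eq_one_iff d |>.1 e6)

/-! ### From single equations to whole transformations, and the multiplier `δ₀`. -/

lemma subclassEq_mono {I J : Set ℝ} (h : I ⊆ J) {θ : Elems} (hθ : θ ∈ subclassEq J) :
    θ ∈ subclassEq I :=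
  ⟨⟨hθ.1.1.mono h, hθ.1.2.1.mono h, hθ.1.2.2.1.mono h, fun x hx => hθ.1.2.2.2.1 x (h hx),
    hθ.1.2.2.2.2⟩, hθ.2⟩

/-- A generalized extended equivalence transformation acts on each equation of the subclass as a
member of the explicit family. -/
theorem IsGenExtEquiv.exists_param {A J C : Set ℝ}
    (hA : IsOpen A ∧ A.OrdConnected ∧ A.Nonempty)
    (hC : IsOpen C ∧ C.OrdConnected ∧ C.Nonempty) {Φ : Transf}
    (hΦ : IsGenExtEquiv subclassEq A J C Φ) {θ : Elems} (hθ : θ ∈ subclassEq J) :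
    ∃ p : Param, p.Valid (Φ.domX θ) ∧ p.Acts A (Φ.domX θ) C Φ θ := by
  obtain ⟨i1, i2, i3, i4⟩ := hΦ.interval θ hθ
  obtain ⟨p, hp, h1, h2, h3, h4⟩ := subclass_param hA ⟨i1, i2, i3⟩ hC (hΦ.point θ hθ)
    (subclassEq_mono i4 hθ) (hΦ.mem θ hθ) (hΦ.maps θ hθ)
  exact ⟨p, hp, h1, h2, h3, h4⟩

/-- Parameters of the same transformation of `(t, x, u)`. -/
lemma param_unique {A J C : Set ℝ} (hA : IsOpen A) (hA' : A.Nonempty) (hJ : J.Nonempty)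
    (hC : IsOpen C) (hC' : C.Nonempty) {p p' : Param}
    (h : ∀ t ∈ A, ∀ x ∈ J, ∀ u ∈ C, (p.δ₁ * t + p.δ₂, p.φ x, p.δ₃ * u + p.ψ x)
      = (p'.δ₁ * t + p'.δ₂, p'.φ x, p'.δ₃ * u + p'.ψ x)) :
    p.δ₁ = p'.δ₁ ∧ p.δ₂ = p'.δ₂ ∧ p.δ₃ = p'.δ₃ ∧ Set.EqOn p.φ p'.φ J ∧ Set.EqOn p.ψ p'.ψ J := by
  simp only [Prod.mk.injEq] at h
  obtain ⟨t₀, ht₀, t₁, ht₁, ht⟩ := exists_pair hA hA'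
  obtain ⟨u₀, hu₀, u₁, hu₁, hu⟩ := exists_pair hC hC'
  obtain ⟨x₀, hx₀⟩ := hJ
  have a0 := (h t₀ ht₀ x₀ hx₀ u₀ hu₀).1
  have a1 := (h t₁ ht₁ x₀ hx₀ u₀ hu₀).1
  have b0 := (h t₀ ht₀ x₀ hx₀ u₀ hu₀).2.2
  have b1 := (h t₀ ht₀ x₀ hx₀ u₁ hu₁).2.2
  have e1 : p.δ₁ = p'.δ₁ :=
    mul_right_cancel₀ (sub_ne_zero.2 ht.ne) (by linear_combination a0 - a1)
  have e3 : p.δ₃ = p'.δ₃ :=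
    mul_right_cancel₀ (sub_ne_zero.2 hu.ne) (by linear_combination b0 - b1)
  refine ⟨e1, by rw [e1] at a0; linarith, e3, fun x hx => (h t₀ ht₀ x hx u₀ hu₀).2.1,
    fun x hx => ?_⟩
  have := (h t₀ ht₀ x hx u₀ hu₀).2.2
  rw [e3] at this
  linarith

/-- The formulas depend only on the values of `φ` and `ψ` over the interval. -/
lemma Param.Acts.congr {A J C : Set ℝ} (hJ : IsOpen J) {p p' : Param} {Φ : Transf} {θ : Elems}
    (h : p.Acts A J C Φ θ) (h0 : p.δ₀ = p'.δ₀) (h1 : p.δ₁ = p'.δ₁) (h2 : p.δ₂ = p'.δ₂)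
    (h3 : p.δ₃ = p'.δ₃) (hφ : Set.EqOn p.φ p'.φ J) (hψ : Set.EqOn p.ψ p'.ψ J) :
    p'.Acts A J C Φ θ := by
  obtain ⟨a, b, c, d⟩ := h
  have hP : Set.EqOn (p.bigPsi θ.n) (p'.bigPsi θ.n) J := fun x hx => by
    simp only [Param.bigPsi, h3, hψ hx]
  have hdP : Set.EqOn (deriv (p.bigPsi θ.n)) (deriv (p'.bigPsi θ.n)) J := fun x hx =>
    deriv_eq_of_eqOn hJ hP hx
  refine ⟨fun t ht x hx u hu => ?_, fun x hx => ?_, by rw [c, h3], d⟩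
  · rw [a t ht x hx u hu, h1, h2, h3, hφ hx, hψ hx]
  · have e : deriv (fun y => θ.g y * deriv (p.bigPsi θ.n) y) x
        = deriv (fun y => θ.g y * deriv (p'.bigPsi θ.n) y) x :=
      deriv_eq_of_eqOn hJ (fun y hy => by simp only [hdP hy]) hx
    have := b x hx
    rw [e, hP hx, hφ hx, deriv_eq_of_eqOn hJ hφ hx, h0, h1, h3] at this
    exact this

lemma Param.Valid.congr {J : Set ℝ} (hJ : IsOpen J) {p p' : Param} (h : p.Valid J)
    (h0 : p.δ₀ = p'.δ₀) (h1 : p.δ₁ = p'.δ₁) (h3 : p.δ₃ = p'.δ₃) (hφ : Set.EqOn p.φ p'.φ J)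
    (hψ : Set.EqOn p.ψ p'.ψ J) : p'.Valid J := by
  obtain ⟨a, b, c, d⟩ := h
  refine ⟨by rwa [← h0, ← h1, ← h3], b.congr fun x hx => (hφ hx).symm,
    c.congr fun x hx => (hψ hx).symm, fun x hx => ?_⟩
  rw [← deriv_eq_of_eqOn hJ hφ hx]
  exact d x hx

/-- A smooth cutoff, `0` near `a` and `1` near `b`. -/
lemma exists_cutoff {a b : ℝ} (hab : a < b) : ∃ χ : ℝ → ℝ, ContDiff ℝ ∞ χ ∧
    (∀ x, 0 ≤ χ x ∧ χ x ≤ 1) ∧ (∀ᶠ x in 𝓝 a, χ x = 0) ∧ ∀ᶠ x in 𝓝 b, χ x = 1 := by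
  have hba : 0 < b - a := sub_pos.2 hab
  refine ⟨fun x => Real.smoothTransition (3 * ((x - a) / (b - a)) - 1),
    Real.smoothTransition.contDiff.comp (by fun_prop),
    fun x => ⟨Real.smoothTransition.nonneg _, Real.smoothTransition.le_one _⟩, ?_, ?_⟩
  · have : ContinuousAt (fun x => 3 * ((x - a) / (b - a)) - 1) a := by fun_prop
    filter_upwards [this.eventually_lt (continuousAt_const (y := (0 : ℝ))) (by simp)] with x hx
    exact Real.smoothTransition.zero_of_nonpos (le_of_lt hx)
  · have : ContinuousAt (fun x => 3 * ((x - a) / (b - a)) - 1) b := by fun_prop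
    filter_upwards [(continuousAt_const (y := (1 : ℝ))).eventually_lt this
      (by simp only [div_self hba.ne']; norm_num)] with x hx
    exact Real.smoothTransition.one_of_one_le (le_of_lt hx)

/-- Convex combinations of numbers of the same sign keep that sign. This is why gluing needs equal
signs of `f` and of `g`. -/
lemma mix_ne_zero {α β c : ℝ} (hc : 0 ≤ c ∧ c ≤ 1) (h : 0 < α * β) :
    (1 - c) * α + c * β ≠ 0 := by
  intro h0
  have hα : 0 < α ^ 2 := by
    have : α ≠ 0 := left_ne_zero_of_mul h.ne'
    positivity
  have : (1 - c) * α ^ 2 + c * (α * β) = 0 := by linear_combination α * h0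
  rcases hc.1.eq_or_lt with h1 | h1
  · rw [← h1] at this; linarith
  · nlinarith [mul_nonneg (sub_nonneg.2 hc.2) hα.le, mul_pos h1 h]

lemma sameJet_of_eventuallyEq {a b : ℝ → ℝ} {x : ℝ} (h : a =ᶠ[𝓝 x] b) (k : ℕ) :
    SameJet k a b x := fun i _ => h.iteratedDeriv_eq i

/-- The multiplier is determined by the arbitrary elements near any point. -/
lemma multiplier_eq {A J C : Set ℝ} (hA : A.Nonempty) (hC : C.Nonempty) {Φ : Transf}
    (hΦ : IsUsualEquiv subclassEq A J C Φ) {θ θ' : Elems} (hθ : θ ∈ subclassEq J)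
    (hθ' : θ' ∈ subclassEq J) (hn : θ.n = θ'.n) {d d' δ₁ δ₂ δ₃ : ℝ} {φ ψ : ℝ → ℝ}
    (hv : (Param.mk d δ₁ δ₂ δ₃ φ ψ).Valid J)
    (ha : (Param.mk d δ₁ δ₂ δ₃ φ ψ).Acts A J C Φ θ)
    (ha' : (Param.mk d' δ₁ δ₂ δ₃ φ ψ).Acts A J C Φ θ') {x : ℝ} (hx : x ∈ J)
    (hf : θ.f =ᶠ[𝓝 x] θ'.f) (hg : θ.g =ᶠ[𝓝 x] θ'.g) (hh : θ.h =ᶠ[𝓝 x] θ'.h) : d = d' := by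
  obtain ⟨k, hk⟩ := hΦ.loc
  obtain ⟨t, ht⟩ := hA
  obtain ⟨u, hu⟩ := hC
  -- Equal germs have equal jets of every order, so locality makes the new `f` agree at this point,
  -- and its formula can be divided by everything but the multiplier.
  have h := (hk θ hθ θ' hθ' (t, x, u) ⟨ht, hx, hu⟩ hn (by rw [hθ.2, hθ'.2, hn])
    (sameJet_of_eventuallyEq hf k) (sameJet_of_eventuallyEq hg k)
    (sameJet_of_eventuallyEq hh k)).1
  rw [ha.1 t ht x hx u hu, ha'.1 t ht x hx u hu] at h
  have h1 := (ha.2.1 x hx).1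
  have h2 := (ha'.2.1 x hx).1
  have h3 := h1.symm.trans (h.trans h2)
  rw [← hf.self_of_nhds, ← hn] at h3
  have hP : (Param.mk d' δ₁ δ₂ δ₃ φ ψ).bigPsi θ.n x = (Param.mk d δ₁ δ₂ δ₃ φ ψ).bigPsi θ.n x := rfl
  rw [hP] at h3
  have hne : δ₁ / deriv φ x * (Param.mk d δ₁ δ₂ δ₃ φ ψ).bigPsi θ.n x * θ.f x ≠ 0 :=
    mul_ne_zero (mul_ne_zero (div_ne_zero hv.ne.2.1 (hv.2.2.2 x hx)) (Param.bigPsi_ne_zero _ _ _))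
      (hθ.1.2.2.2.1 x hx).1
  refine mul_right_cancel₀ hne ?_
  simp only at h3
  linear_combination h3

/-- Two tuples of the subclass with the same `n` and the same signs of `f` and `g` can be glued. -/
lemma exists_glue {J : Set ℝ} {θ θ' : Elems} (hθ : θ ∈ subclassEq J) (hθ' : θ' ∈ subclassEq J)
    (hs : ∀ x ∈ J, 0 < θ.f x * θ'.f x ∧ 0 < θ.g x * θ'.g x) {a b : ℝ} (hab : a < b) :
    ∃ θ₁ ∈ subclassEq J, θ₁.n = θ.n ∧
      (θ₁.f =ᶠ[𝓝 a] θ.f ∧ θ₁.g =ᶠ[𝓝 a] θ.g ∧ θ₁.h =ᶠ[𝓝 a] θ.h) ∧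
      (θ₁.f =ᶠ[𝓝 b] θ'.f ∧ θ₁.g =ᶠ[𝓝 b] θ'.g ∧ θ₁.h =ᶠ[𝓝 b] θ'.h) := by
  obtain ⟨χ, hχ, h01, ha, hb⟩ := exists_cutoff hab
  have mix : ∀ {F G : ℝ → ℝ}, ContDiffOn ℝ ∞ F J → ContDiffOn ℝ ∞ G J →
      ContDiffOn ℝ ∞ (fun x => (1 - χ x) * F x + χ x * G x) J := fun hF hG =>
    ((contDiffOn_const.sub hχ.contDiffOn).mul hF).add (hχ.contDiffOn.mul hG)
  have ea : ∀ F G : ℝ → ℝ, (fun x => (1 - χ x) * F x + χ x * G x) =ᶠ[𝓝 a] F := fun F G => by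
    filter_upwards [ha] with x hx
    rw [hx]; ring
  have eb : ∀ F G : ℝ → ℝ, (fun x => (1 - χ x) * F x + χ x * G x) =ᶠ[𝓝 b] G := fun F G => by
    filter_upwards [hb] with x hx
    rw [hx]; ring
  exact ⟨⟨fun x => (1 - χ x) * θ.f x + χ x * θ'.f x, fun x => (1 - χ x) * θ.g x + χ x * θ'.g x,
    fun x => (1 - χ x) * θ.h x + χ x * θ'.h x, θ.n, θ.n⟩,
    ⟨⟨mix hθ.1.1 hθ'.1.1, mix hθ.1.2.1 hθ'.1.2.1, mix hθ.1.2.2.1 hθ'.1.2.2.1,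
      fun x hx => ⟨mix_ne_zero (h01 x) (hs x hx).1, mix_ne_zero (h01 x) (hs x hx).2⟩,
      hθ.1.2.2.2.2⟩, rfl⟩, rfl, ⟨ea _ _, ea _ _, ea _ _⟩, ⟨eb _ _, eb _ _, eb _ _⟩⟩

/-- Usual equivalence transformations of the subclass belong to the explicit family. -/
theorem IsUsualEquiv.exists_params {A J C : Set ℝ}
    (hA : IsOpen A ∧ A.OrdConnected ∧ A.Nonempty)
    (hJ : IsOpen J ∧ J.OrdConnected ∧ J.Nonempty)
    (hC : IsOpen C ∧ C.OrdConnected ∧ C.Nonempty) {Φ : Transf}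
    (hΦ : IsUsualEquiv subclassEq A J C Φ) :
    ∃ (δ₁ δ₂ δ₃ : ℝ) (φ ψ : ℝ → ℝ) (δ₀ : Elems → ℝ),
      (∀ θ ∈ subclassEq J, (Param.mk (δ₀ θ) δ₁ δ₂ δ₃ φ ψ).Valid J ∧
        (Param.mk (δ₀ θ) δ₁ δ₂ δ₃ φ ψ).Acts A J C Φ θ) ∧
      (∀ θ ∈ subclassEq J, ∀ θ' ∈ subclassEq J, θ.n = θ'.n →
        (∀ x ∈ J, 0 < θ.f x * θ'.f x ∧ 0 < θ.g x * θ'.g x) → δ₀ θ = δ₀ θ') := by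
  have hex : ∀ θ : Elems, ∃ p : Param, θ ∈ subclassEq J → p.Valid J ∧ p.Acts A J C Φ θ := by
    intro θ
    by_cases hθ : θ ∈ subclassEq J
    · obtain ⟨p, h1, h2⟩ := hΦ.toIsGenExtEquiv.exists_param hA hC hθ
      rw [hΦ.full θ hθ] at h1 h2
      exact ⟨p, fun _ => ⟨h1, h2⟩⟩
    · exact ⟨⟨0, 0, 0, 0, 0, 0⟩, fun h => absurd h hθ⟩
  choose P hP using hex
  have hB : powerElems 1 ∈ subclassEq J := ⟨powerElems_mem J 1, rfl⟩
  -- A reference equation. Independence of the point transformation from `θ` lets its parameters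
  -- replace those of every other equation, except for `δ₀`, which is invisible in `(t, x, u)`.
  set b := P (powerElems 1) with hb
  have main : ∀ θ ∈ subclassEq J, (Param.mk (P θ).δ₀ b.δ₁ b.δ₂ b.δ₃ b.φ b.ψ).Valid J ∧
      (Param.mk (P θ).δ₀ b.δ₁ b.δ₂ b.δ₃ b.φ b.ψ).Acts A J C Φ θ := by
    intro θ hθ
    obtain ⟨v, a⟩ := hP θ hθ
    obtain ⟨v', a'⟩ := hP _ hB
    obtain ⟨e1, e2, e3, e4, e5⟩ := param_unique hA.1 hA.2.2 hJ.2.2 hC.1 hC.2.2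
      (p := P θ) (p' := b) fun t ht x hx u hu => by
        rw [← a.1 t ht x hx u hu, ← a'.1 t ht x hx u hu]
        exact hΦ.indep θ hθ _ hB ⟨ht, hx, hu⟩
    exact ⟨v.congr hJ.1 rfl e1 e3 e4 e5, a.congr hJ.1 rfl e1 e2 e3 e4 e5⟩
  refine ⟨b.δ₁, b.δ₂, b.δ₃, b.φ, b.ψ, fun θ => (P θ).δ₀, main, ?_⟩
  intro θ hθ θ' hθ' hn hs
  -- A tuple equal to `θ` near `x₀` and to `θ'` near `x₁` has a single multiplier over `J`, which
  -- must agree with both.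
  obtain ⟨x₀, hx₀, x₁, hx₁, hx⟩ := exists_pair hJ.1 hJ.2.2
  obtain ⟨θ₁, h₁, n₁, ⟨f0, g0, h0⟩, ⟨f1, g1, h1⟩⟩ := exists_glue hθ hθ' hs hx
  have k0 := multiplier_eq hA.2.2 hC.2.2 hΦ h₁ hθ n₁ (main θ₁ h₁).1 (main θ₁ h₁).2 (main θ hθ).2
    hx₀ f0 g0 h0
  have k1 := multiplier_eq hA.2.2 hC.2.2 hΦ h₁ hθ' (n₁.trans hn) (main θ₁ h₁).1 (main θ₁ h₁).2
    (main θ' hθ').2 hx₁ f1 g1 h1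
  exact k0.symm.trans k1

end ExpRD

theorem theorem2 (A J C : Set ℝ)
    (hA : IsOpen A ∧ A.OrdConnected ∧ A.Nonempty)
    (hJ : IsOpen J ∧ J.OrdConnected ∧ J.Nonempty)
    (hC : IsOpen C ∧ C.OrdConnected ∧ C.Nonempty) :
    -- every member of the explicit family is a usual equivalence transformation of the subclass
    (∀ p : ExpRD.Param, p.Valid J →
      ∃ Φ, ExpRD.IsUsualEquiv ExpRD.subclassEq A J C Φ ∧
        ∀ θ ∈ ExpRD.subclassEq J, p.Acts A J C Φ θ) ∧
    -- every usual equivalence transformation of the subclass is of this form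
    (∀ Φ, ExpRD.IsUsualEquiv ExpRD.subclassEq A J C Φ →
      ∃ (δ₁ δ₂ δ₃ : ℝ) (φ ψ : ℝ → ℝ) (δ₀ : ExpRD.Elems → ℝ),
        (∀ θ ∈ ExpRD.subclassEq J,
          (ExpRD.Param.mk (δ₀ θ) δ₁ δ₂ δ₃ φ ψ).Valid J ∧
          (ExpRD.Param.mk (δ₀ θ) δ₁ δ₂ δ₃ φ ψ).Acts A J C Φ θ) ∧
        -- the overall multiplier `δ₀` can depend only on `n` and on the signs of `f` and `g`
        (∀ θ ∈ ExpRD.subclassEq J, ∀ θ' ∈ ExpRD.subclassEq J, θ.n = θ'.n →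
          (∀ x ∈ J, 0 < θ.f x * θ'.f x ∧ 0 < θ.g x * θ'.g x) → δ₀ θ = δ₀ θ')) ∧
    -- every generalized extended equivalence transformation of the subclass acts on each equation
    -- as a usual one from the explicit family
    (∀ Φ, ExpRD.IsGenExtEquiv ExpRD.subclassEq A J C Φ → ∀ θ ∈ ExpRD.subclassEq J,
      ∃ (p : ExpRD.Param) (Φ' : ExpRD.Transf), p.Valid (Φ.domX θ) ∧
        ExpRD.IsUsualEquiv ExpRD.subclassEq A (Φ.domX θ) C Φ' ∧
        (∀ θ' ∈ ExpRD.subclassEq (Φ.domX θ), p.Acts A (Φ.domX θ) C Φ' θ') ∧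
        p.Acts A (Φ.domX θ) C Φ θ) ∧
    -- the group of the subclass is a nontrivial conditional equivalence group of the whole class
    ExpRD.NontrivialConditional ExpRD.subclassEq ExpRD.wholeClass A J C := by
  refine ⟨fun p hp => ⟨p.toTransf J, hp.isUsualEquiv hA hJ hC, fun θ _ => hp.acts hJ.1 hJ.2.1 θ⟩,
    fun Φ hΦ => hΦ.exists_params hA hJ hC, fun Φ hΦ θ hθ => ?_,
    ExpRD.nontrivialConditional hA hJ hC⟩
  obtain ⟨p, hp, ha⟩ := hΦ.exists_param hA hC hθ
  obtain ⟨i1, i2, i3, -⟩ := hΦ.interval θ hθ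
  -- The usual transformation is taken over `Φ.domX θ`, which may be smaller than `J`.
  exact ⟨p, p.toTransf (Φ.domX θ), hp, hp.isUsualEquiv hA ⟨i1, i2, i3⟩ hC,
    fun θ' _ => hp.acts i1 i2 θ', ha⟩
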